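/- **Setting.** A turn sequence is a finite word $\sigma=\sigma_1\cdots\sigma_n$ in the letters $\mathtt L$ (left) and $\mathtt R$ (right). A chain realizing $\sigma$ is a simple (non-self-intersecting) rectilinear polygonal chain that starts at the origin $o$, consists of $n+1$ segments of positive integral length, has a first segment heading in the $+x$-direction, and makes the $90^\circ$ turns $\sigma_1,\dots,\sigma_n$ in this order at its bends. Its endpoint $p$ is said to be reachable by $\sigma$. If $\sigma$ reaches some point of the positive $x$-axis, let $x^+_\sigma$ be the least integer $a>0$ such that $(a,0)$ is reachable by $\sigma$. Let $x^+_{l,r}$ be the maximum of $x^+_\sigma$ over all $\sigma$ with $l$ left and $r$ right turns for which $x^+_\sigma$ exists. For perpendicular axis directions $z_1,z_2$, a $(z_1,z_2)$-staircase is a subchain of consecutive segments without segments directed in $-z_1$ or $-z_2$; ${}_{z_1}m^{o}_{z_2}$ and ${}_{z_1}m^{p}_{z_2}$ denote the number of $z_2$-directed segments in the maximal $(z_1,z_2)$-staircase of a chain realizing $\sigma$ that contains its first segment, respectively its last segment (these numbers depend only on $\sigma$). **Theorem.** Let $\sigma=\sigma_1\cdots\sigma_n$ be a turn sequence with $l$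 left turns and $r$ right turns, $l-r\ge 0$. If $\sigma$ reaches a point of the positive $x$-axis, then $x^+_{l,r}\ge x^+_\sigma$, and $x^+_\sigma$ (hence also $x^+_{l,r}$) satisfies the following lower bounds. 1. If $l-r\equiv1\pmod 4$: $x^+_\sigma\ge\min\{{}_{+x}m^{o}_{-y},\,{}_{+x}m^{p}_{+y}\}+\left\lfloor\frac{l-r+2}{4}\right\rfloor+1$ if $\sigma_1=\mathtt R$; $x^+_\sigma\ge\left|\left\lfloor\frac{l-r+2}{4}\right\rfloor-1\right|+2$ if $\sigma_1=\mathtt L$. 2. If $l-r\equiv3\pmod 4$: $x^+_\sigma\ge\min\{{}_{+x}m^{o}_{+y},\,{}_{+x}m^{p}_{-y}\}+\left|\left\lfloor\frac{l-r+2}{4}\right\rfloor-2\right|+1$ if $\sigma_1=\mathtt L$; $x^+_\sigma\ge\left\lfloor\frac{l-r+2}{4}\right\rfloor+1$ if $\sigma_1=\mathtt R$. 3. If $l-r\equiv2\pmod 4$: $x^+_\sigma\ge\left|\left\lfloor\frac{l-r+2}{4}\right\rfloor-2\right|+2$ if $\sigma_1=\mathtt L$; $x^+_\sigma\ge\left\lfloor\frac{l-r+2}{4}\right\rfloor+1$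 if $\sigma_1=\mathtt R$. 4. If $l-r\equiv0\pmod 4$ and $l-r\ge8$: $x^+_\sigma\ge\min\{{}_{+x}m^{o}_{+y},\,{}_{+x}m^{p}_{-y},\,2\}+\left\lfloor\frac{l-r+2}{4}\right\rfloor$ if $\sigma_1=\mathtt L$; $x^+_\sigma\ge\left\lfloor\frac{l-r+2}{4}\right\rfloor+2$ if $\sigma_1=\mathtt R$. 5. If $l-r=0$: $x^+_\sigma\ge\min\{{}_{+x}m^{o}_{+y},\,{}_{+x}m^{p}_{-y},\,2\}+2$ if $\sigma_1=\mathtt L$; $x^+_\sigma\ge\min\{{}_{+x}m^{o}_{-y},\,{}_{+x}m^{p}_{+y},\,2\}+2$ if $\sigma_1=\mathtt R$. 6. If $l-r=4$: $x^+_\sigma\ge3$. Moreover, if $l-r=5$, or if $l-r\equiv2\pmod4$ and $l-r\ge6$, then $\sigma$ reaches the positive $x$-axis, and the corresponding inequality in item 1, respectively item 3, is an equality. -/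

import Mathlib

/-- A turn: left or right. A turn sequence is a `List Turn`. -/
inductive Turn : Type
  | L : Turn
  | R : Turn
  deriving DecidableEq

namespace Turn

/-- Rotation of a direction vector by 90 degrees: counterclockwise for a left turn,
clockwise for a right turn. -/
def rotate : Turn → ℤ × ℤ → ℤ × ℤ
  | L, d => (-d.2, d.1)
  | R, d => (d.2, -d.1)

/-- Direction `+x`. -/
def east : ℤ × ℤ := (1, 0)

/-- Direction `+y`. -/
def north : ℤ × ℤ := (0, 1)

/-- Direction `-y`. -/
def south : ℤ × ℤ := (0, -1)

/-- The direction of the `i`-th segment (`0 ≤ i ≤ n`) of a chain with turn sequence `σ` of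
length `n`: segment `0` heads east, and segment `i` is obtained after the first `i` turns. -/
def segDir (σ : List Turn) (i : ℕ) : ℤ × ℤ :=
  (σ.take i).foldl (fun d t => t.rotate d) east

/-- The directions of all `n + 1` segments, in the order from the origin to the endpoint. -/
def segDirs (σ : List Turn) : List (ℤ × ℤ) :=
  (List.range (σ.length + 1)).map (segDir σ)

/-- An integer point as a point of the real plane. -/
def toPlane (q : ℤ × ℤ) : ℝ × ℝ := ((q.1 : ℝ), (q.2 : ℝ))

/-- The `i`-th closed segment of the polygonal chain with vertices `v 0, v 1, …`. -/
def side (v : ℕ → ℤ × ℤ) (i : ℕ) : Set (ℝ × ℝ) :=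
  segment ℝ (toPlane (v i)) (toPlane (v (i + 1)))

/-- The chain with vertices `v 0, …, v (n + 1)` realizes the turn sequence `σ` of length `n`:
it starts at the origin, its segments have positive integral lengths and the directions
prescribed by `σ` (the first one heading east), and it is simple. -/
structure Realizes (v : ℕ → ℤ × ℤ) (σ : List Turn) : Prop where
  start : v 0 = (0, 0)
  step : ∀ i ≤ σ.length, ∃ k : ℕ, 0 < k ∧ v (i + 1) = v i + k • segDir σ i
  consecutive : ∀ i < σ.length, side v i ∩ side v (i + 1) = {toPlane (v (i + 1))}
  disjoint : ∀ i j, i + 1 < j → j ≤ σ.length → Disjoint (side v i) (side v j)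

/-- The set `A(σ)` of points reachable by `σ`. -/
def reachable (σ : List Turn) : Set (ℤ × ℤ) :=
  {p | ∃ v : ℕ → ℤ × ℤ, Realizes v σ ∧ v (σ.length + 1) = p}

/-- The distances from the origin of the points of the positive `x`-axis reachable by `σ`. -/
def posXDistances (σ : List Turn) : Set ℕ :=
  {a | 0 < a ∧ ((a : ℤ), (0 : ℤ)) ∈ reachable σ}

/-- `x⁺_σ` exists. -/
def ReachesPosX (σ : List Turn) : Prop := (posXDistances σ).Nonempty

/-- `x⁺_σ`: the distance from the origin to the closest reachable point on the positive
`x`-axis (meaningful when `ReachesPosX σ`). -/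
noncomputable def xPlus (σ : List Turn) : ℕ := sInf (posXDistances σ)

/-- `x⁺_{l,r}`: the maximum of `x⁺_σ` over the turn sequences `σ` with `l` left turns and
`r` right turns for which `x⁺_σ` exists (there are finitely many such `σ`). -/
noncomputable def xPlusMax (l r : ℕ) : ℕ :=
  sSup {d | ∃ σ : List Turn, σ.count L = l ∧ σ.count R = r ∧ ReachesPosX σ ∧ d = xPlus σ}

/-- The number of segments of direction `z₂` in the longest initial piece of a list of
directions that is `z₁`-monotone and `z₂`-monotone, i.e. has no segment of direction
`-z₁` or `-z₂`. -/
def staircaseCount (z₁ z₂ : ℤ × ℤ) (ds : List (ℤ × ℤ)) : ℕ :=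
  (ds.takeWhile (fun d => d ≠ -z₁ ∧ d ≠ -z₂)).count z₂

/-- The number of `z₂`-segments in the maximal `(z₁, z₂)`-staircase containing the origin. -/
def mO (z₁ z₂ : ℤ × ℤ) (σ : List Turn) : ℕ := staircaseCount z₁ z₂ (segDirs σ)

/-- The number of `z₂`-segments in the maximal `(z₁, z₂)`-staircase containing the endpoint. -/
def mP (z₁ z₂ : ℤ × ℤ) (σ : List Turn) : ℕ := staircaseCount z₁ z₂ (segDirs σ).reverse

end Turn

/-! Lower bounds. A realization is replaced by the path through all its lattice points
(`latticePath`). Consider an arc of it from (x₀, r) to (x₁, r) with x₀ < x₁, starting vertically and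
not ending eastward. If the arc avoids the row strictly between its endpoints, walking back west
along the row closes it to a simple lattice polygon. Hopf's rotation-index argument
(`hopf_triangle`, `umlauf`) gives total turning ±4 quarter turns, so the arc turns by 4e plus a
correction depending only on its first and last directions, with e = ±1. In general the arc is cut
at the leftmost point of the row beyond x₀ that it visits, and the rest is treated recursively. Then
e is a sum of j signs with 1 ≤ j ≤ x₁ - x₀ and j ≡ e mod 2 (`turning_of_arc`). Applied between the
first bend and the endpoint (or the last bend, if the chain ends eastward), this fixes e through l -
r and bounds the distance below by |e|. If e = 0, parity forces j ≥ 2; this explains the absolute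
values in the bounds.

Staircase terms. If staircases leave both ends towards the same side of the axis, the row can be
moved along both at once. Their columns approach each other while the turning of the arc between
them stays the same, so every step costs one more column (`Realizes.staircase_bound`).

Equality. Chains are assembled from pieces in disjoint rectangles. A word of net turning 0 fits into
a box (`exists_box`), one of net turning 2 makes a U-turn whose end is shifted by a single column
(`exists_uTurn`), and a surplus of 4k is wound inwards in k spiral layers, each costing one column
(`Spiral.exists_route`). This settles l - r ≡ 2. For l - r = 5, the pairs RL at either end are
peeled off as a staircase and the remainder is led around it, so that each of the two staircase
counts plus 2 bounds the minimum from above. -/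

namespace Turn

/-! ### Directions and sectors -/

/-- Unit coordinate direction vectors. -/
def IsDir (d : ℤ × ℤ) : Prop := d = (1, 0) ∨ d = (0, 1) ∨ d = (-1, 0) ∨ d = (0, -1)

/-- The cross product of two planar integer vectors. -/
def cross (d e : ℤ × ℤ) : ℤ := d.1 * e.2 - d.2 * e.1

/-- The octant index of a nonzero vector: even for the axes, odd for the open quadrants. -/
def sector (u : ℤ × ℤ) : ℤ :=
  if 0 < u.1 then (if 0 < u.2 then 1 else if u.2 = 0 then 0 else 7)
  else if u.1 = 0 then (if 0 < u.2 then 2 else 6)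
  else (if 0 < u.2 then 3 else if u.2 = 0 then 4 else 5)

/-- The signed change of octant between neighbouring lattice vectors. -/
def sectorStep (u w : ℤ × ℤ) : ℤ :=
  if (sector w - sector u) % 8 = 0 then 0 else if (sector w - sector u) % 8 = 1 then 1 else -1

theorem sectorStep_le (u w : ℤ × ℤ) : -1 ≤ sectorStep u w ∧ sectorStep u w ≤ 1 := by
  unfold sectorStep; split_ifs <;> simp

/-- A unit step cannot pass between open quadrants without landing on an axis, so away from the
origin octants change at most to an adjacent one, cyclically. -/
theorem sector_neighbour {a b c d : ℤ} (h : ¬(a = 0 ∧ b = 0)) (h' : ¬(c = 0 ∧ d = 0))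
    (hn : (c = a + 1 ∨ a = c + 1) ∧ d = b ∨ (d = b + 1 ∨ b = d + 1) ∧ c = a) :
    let y := sector (c, d) - sector (a, b)
    y = 0 ∨ y = 1 ∨ y = -1 ∨ y = 7 ∨ y = -7 := by
  intro y
  have h1 : sector (a, b) = if 0 < a then (if 0 < b then 1 else if b = 0 then 0 else 7)
    else if a = 0 then (if 0 < b then 2 else 6)
    else (if 0 < b then 3 else if b = 0 then 4 else 5) := rfl
  have h2 : sector (c, d) = if 0 < c then (if 0 < d then 1 else if d = 0 then 0 else 7)
    else if c = 0 then (if 0 < d then 2 else 6)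
    else (if 0 < d then 3 else if d = 0 then 4 else 5) := rfl
  have hy : y = sector (c, d) - sector (a, b) := rfl
  clear_value y
  omega

/-- Between neighbours the only residues are 0, 1 and 7, so the default branch -1 of `sectorStep` is
the right lift. -/
theorem sectorStep_modEq {u w d : ℤ × ℤ} (hd : IsDir d) (hu : u ≠ 0) (hw : w ≠ 0)
    (h : w = u + d ∨ u = w + d) : (8 : ℤ) ∣ sectorStep u w - (sector w - sector u) := by
  obtain ⟨a, b⟩ := u
  obtain ⟨c, e⟩ := w
  have hu' : ¬ (a = 0 ∧ b = 0) := fun h => hu (by simp [h.1, h.2])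
  have hw' : ¬ (c = 0 ∧ e = 0) := fun h => hw (by simp [h.1, h.2])
  have hn : (c = a + 1 ∨ a = c + 1) ∧ e = b ∨ (e = b + 1 ∨ b = e + 1) ∧ c = a := by
    rcases hd with rfl | rfl | rfl | rfl <;> rcases h with h | h <;>
      simp only [Prod.mk_add_mk, Prod.mk.injEq] at h <;> omega
  have := sector_neighbour hu' hw' hn
  unfold sectorStep
  omega

/-- A quarter turn is two octants; excluding reversal makes the diagonal vector d + e nonzero. -/
theorem sectorStep_turn {d e : ℤ × ℤ} (hd : IsDir d) (he : IsDir e) (h : d + e ≠ 0) :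
    sectorStep d (d + e) + sectorStep (d + e) e = 2 * cross d e := by
  rcases hd with rfl | rfl | rfl | rfl <;> rcases he with rfl | rfl | rfl | rfl <;>
    first
    | exact absurd (by decide) h
    | decide

/-- Discrete homotopy invariance across a unit square avoiding the origin: both sides agree mod 8,
and each has absolute value at most 2. -/
theorem sectorStep_square {a b c d e f : ℤ × ℤ} (he : IsDir e) (hf : IsDir f)
    (ha : a ≠ 0) (hb : b ≠ 0) (hc : c ≠ 0) (hd : d ≠ 0)
    (hab : b = a + e) (hdc : c = d + e) (had : a = d + f) (hbc : b = c + f) :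
    sectorStep a b + sectorStep b c = sectorStep a d + sectorStep d c := by
  have h1 := sectorStep_modEq he ha hb (Or.inl hab)
  have h2 := sectorStep_modEq hf hb hc (Or.inr hbc)
  have h3 := sectorStep_modEq hf ha hd (Or.inr had)
  have h4 := sectorStep_modEq he hd hc (Or.inl hdc)
  have := sectorStep_le a b
  have := sectorStep_le b c
  have := sectorStep_le a d
  have := sectorStep_le d c
  omega

/-- The sectors along a walk in the open upper half-plane together with the positive `x`-axis
determine the sector steps. -/
theorem sectorStep_eq_sub {u w d : ℤ × ℤ} (hd : IsDir d) (hu : u ≠ 0) (hw : w ≠ 0)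
    (h : w = u + d ∨ u = w + d) (hs : |sector w - sector u| ≤ 3) :
    sectorStep u w = sector w - sector u := by
  have h1 := sectorStep_modEq hd hu hw h
  have := sectorStep_le u w
  rw [abs_le] at hs
  omega

/-- Hopf's triangle argument: the total turning of a lattice path is the winding of the path seen
from its starting point plus the winding of the endpoint seen from the path. -/
theorem hopf_triangle (γ : ℕ → ℤ × ℤ) (m : ℕ)
    (hstep : ∀ i, i ≤ m → IsDir (γ (i + 1) - γ i))
    (hinj : ∀ i j, i < j → j ≤ m + 1 → γ j - γ i ≠ 0) :
    ∑ i ∈ Finset.range m, 2 * cross (γ (i + 1) - γ i) (γ (i + 2) - γ (i + 1)) =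
      ∑ j ∈ Finset.range m, sectorStep (γ (j + 1) - γ 0) (γ (j + 2) - γ 0) +
      ∑ i ∈ Finset.range m, sectorStep (γ (m + 1) - γ i) (γ (m + 1) - γ (i + 1)) := by
  -- The vectors γ j - γ i with i < j form a triangular grid. The turning is read along its
  -- hypotenuse, the two windings along its legs; the induction adds one column.
  induction m with
  | zero => simp
  | succ m ih =>
    have ih := ih (fun i hi => hstep i (by omega)) (fun i j hij hj => hinj i j hij (by omega))
    -- The new column is swept one unit square at a time.
    have row : ∀ k, k ≤ m → ∑ i ∈ Finset.range k, sectorStep (γ (m + 1) - γ i) (γ (m + 1) - γ (i + 1))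
        + sectorStep (γ (m + 1) - γ k) (γ (m + 2) - γ k)
        = sectorStep (γ (m + 1) - γ 0) (γ (m + 2) - γ 0)
        + ∑ i ∈ Finset.range k, sectorStep (γ (m + 2) - γ i) (γ (m + 2) - γ (i + 1)) := by
      intro k
      induction k with
      | zero => intro _; simp
      | succ k ihk =>
        intro hk
        have ihk := ihk (by omega)
        rw [Finset.sum_range_succ, Finset.sum_range_succ]
        have sq := sectorStep_square (a := γ (m + 1) - γ k) (b := γ (m + 2) - γ k)
          (c := γ (m + 2) - γ (k + 1)) (d := γ (m + 1) - γ (k + 1))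
          (hstep (m + 1) (by omega)) (hstep k (by omega))
          (hinj _ _ (by omega) (by omega)) (hinj _ _ (by omega) (by omega))
          (hinj _ _ (by omega) (by omega)) (hinj _ _ (by omega) (by omega))
          (by abel) (by abel) (by abel) (by abel)
        linarith
    have row := row m le_rfl
    rw [Finset.sum_range_succ, Finset.sum_range_succ, Finset.sum_range_succ, ih]
    have tn := sectorStep_turn (hstep m (by omega)) (hstep (m + 1) (by omega)) (by
      have := hinj m (m + 2) (by omega) (by omega)
      convert this using 1; abel)
    have e1 : γ (m + 1) - γ m + (γ (m + 1 + 1) - γ (m + 1)) = γ (m + 2) - γ m := by abel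
    rw [e1] at tn
    have e2 : m + 1 + 1 = m + 2 := rfl
    rw [e2] at tn ⊢
    linarith

/-! ### The turning number of a closed lattice path -/

/-- The column sweep in isolation, needed for the closing edge of a polygon, where the triangle
degenerates. -/
theorem sectorStep_row (g : ℕ → ℤ × ℤ) (p q : ℤ × ℤ) (hpq : IsDir (q - p)) (k : ℕ)
    (hstep : ∀ i < k, IsDir (g (i + 1) - g i)) (hp : ∀ i ≤ k, p - g i ≠ 0)
    (hq : ∀ i ≤ k, q - g i ≠ 0) :
    ∑ i ∈ Finset.range k, sectorStep (p - g i) (p - g (i + 1)) + sectorStep (p - g k) (q - g k) =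
      sectorStep (p - g 0) (q - g 0) +
        ∑ i ∈ Finset.range k, sectorStep (q - g i) (q - g (i + 1)) := by
  induction k with
  | zero => simp
  | succ k ih =>
    have ih := ih (fun i hi => hstep i (by omega)) (fun i hi => hp i (by omega))
      (fun i hi => hq i (by omega))
    rw [Finset.sum_range_succ, Finset.sum_range_succ]
    have sq := sectorStep_square (a := p - g k) (b := q - g k) (c := q - g (k + 1))
      (d := p - g (k + 1)) hpq (hstep k (by omega)) (hp _ (by omega)) (hq _ (by omega))
      (hq _ (by omega)) (hp _ (by omega)) (by abel) (by abel) (by abel) (by abel)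
    linarith

/-- Seen from the lowest leftmost vertex, the other vertices occupy sectors 0 to 3 only, so the
octant index itself is a continuous angle and windings telescope. -/
theorem sector_upper {u : ℤ × ℤ} (h : 0 < u.2 ∨ u.2 = 0 ∧ 0 < u.1) :
    0 ≤ sector u ∧ sector u ≤ 3 ∧ sector (-u) = sector u + 4 := by
  obtain ⟨a, b⟩ := u
  simp only at h
  simp only [sector, Prod.neg_mk]
  omega

theorem IsDir.neg {d : ℤ × ℤ} (h : IsDir d) : IsDir (-d) := by
  rcases h with rfl | rfl | rfl | rfl <;> simp [IsDir]

/-- The rotation index of a closed simple lattice polygon read from its lowest leftmost point. -/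
theorem umlauf_of_lowest (γ : ℕ → ℤ × ℤ) (n : ℕ) (hclosed : γ (n + 3) = γ 0)
    (hstep : ∀ i ≤ n + 2, IsDir (γ (i + 1) - γ i))
    (hinj : ∀ i j, i < j → j < n + 3 → γ j - γ i ≠ 0)
    (hlow : ∀ j, 0 < j → j < n + 3 →
      0 < (γ j - γ 0).2 ∨ (γ j - γ 0).2 = 0 ∧ 0 < (γ j - γ 0).1) :
    ∑ i ∈ Finset.range (n + 2), cross (γ (i + 1) - γ i) (γ (i + 2) - γ (i + 1)) +
      cross (γ 0 - γ (n + 2)) (γ 1 - γ 0) = 4 ∨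
    ∑ i ∈ Finset.range (n + 2), cross (γ (i + 1) - γ i) (γ (i + 2) - γ (i + 1)) +
      cross (γ 0 - γ (n + 2)) (γ 1 - γ 0) = -4 := by
  -- The triangle stops at γ (n + 2), since γ (n + 3) - γ 0 vanishes. The closing edge is then added
  -- by a sweep that omits the vertex γ 0.
  have hopf := hopf_triangle γ (n + 1) (fun i hi => hstep i (by omega))
    (fun i j h1 h2 => hinj i j h1 (by omega))
  rw [Finset.sum_range_succ' (fun i => sectorStep (γ (n + 1 + 1) - γ i) _)] at hopf
  have row := sectorStep_row (fun i => γ (i + 1)) (γ (n + 2)) (γ (n + 3))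
    (hstep (n + 2) (by omega)) n (fun i hi => hstep (i + 1) (by omega))
    (fun i hi => hinj _ _ (by omega) (by omega))
    (fun i hi => by
      rw [hclosed, ← neg_sub]; exact neg_ne_zero.2 (hinj _ _ (by omega) (by omega)))
  have tn := sectorStep_turn (hstep (n + 1) (by omega)) (hstep (n + 2) (by omega)) (by
      have := hinj 0 (n + 1) (by omega) (by omega)
      rw [← neg_ne_zero, neg_sub, ← hclosed] at this
      convert this using 1; abel)
  have e1 : γ (n + 1 + 1) - γ (n + 1) + (γ (n + 2 + 1) - γ (n + 2)) = γ (n + 3) - γ (n + 1) := by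
    abel
  rw [e1] at tn
  have sA : ∀ k ≤ n + 1, ∑ j ∈ Finset.range k, sectorStep (γ (j + 1) - γ 0) (γ (j + 2) - γ 0) =
      sector (γ (k + 1) - γ 0) - sector (γ 1 - γ 0) := by
    intro k
    induction k with
    | zero => intro _; simp
    | succ k ih =>
      intro hk
      rw [Finset.sum_range_succ, ih (by omega)]
      have a1 := sector_upper (hlow (k + 1) (by omega) (by omega))
      have a2 := sector_upper (hlow (k + 2) (by omega) (by omega))
      rw [sectorStep_eq_sub (hstep (k + 1) (by omega)) (hinj _ _ (by omega) (by omega))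
        (hinj _ _ (by omega) (by omega)) (Or.inl (by abel)) (by rw [abs_le]; omega)]
      ring_nf
  have sB : ∀ k ≤ n + 1, ∑ i ∈ Finset.range k, sectorStep (γ (n + 3) - γ (i + 1))
      (γ (n + 3) - γ (i + 2)) = sector (γ (n + 3) - γ (k + 1)) - sector (γ (n + 3) - γ 1) := by
    intro k
    rw [hclosed]
    induction k with
    | zero => intro _; simp
    | succ k ih =>
      intro hk
      rw [Finset.sum_range_succ, ih (by omega)]
      have a1 := sector_upper (hlow (k + 1) (by omega) (by omega))
      have a2 := sector_upper (hlow (k + 2) (by omega) (by omega))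
      rw [neg_sub] at a1 a2
      rw [sectorStep_eq_sub (hstep (k + 1) (by omega))
        (by rw [← neg_sub]; exact neg_ne_zero.2 (hinj _ _ (by omega) (by omega)))
        (by rw [← neg_sub]; exact neg_ne_zero.2 (hinj _ _ (by omega) (by omega)))
        (Or.inr (by abel)) (by rw [abs_le]; omega)]
      ring_nf
  have sA' := sA (n + 1) le_rfl
  have sB' := sB (n + 1) le_rfl
  have l1 := hlow 1 (by omega) (by omega)
  have l2 := hlow (n + 2) (by omega) (by omega)
  have hd0 := hstep 0 (by omega)
  have hd2 := (hstep (n + 2) (by omega)).neg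
  have hne := hinj 1 (n + 2) (by omega) (by omega)
  have hc : γ (n + 1 + 2) = γ 0 := hclosed
  simp only [hclosed, zero_add, neg_sub] at row tn sA' sB' hopf l1 l2 hne hd0 hd2
  rw [Finset.sum_range_succ] at sB' ⊢
  rw [← Finset.mul_sum] at hopf
  have f1 : γ (n + 2) - γ 1 = (γ (n + 2) - γ 0) - (γ 1 - γ 0) := by abel
  have f2 : γ 0 - γ 1 = -(γ 1 - γ 0) := by abel
  have f3 : γ 0 - γ (n + 2) = -(γ (n + 2) - γ 0) := by abel
  have key : 2 * (∑ i ∈ Finset.range (n + 1), cross (γ (i + 1) - γ i) (γ (i + 2) - γ (i + 1)) +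
      cross (γ (n + 2) - γ (n + 1)) (γ 0 - γ (n + 2))) =
      (sector (γ (n + 2) - γ 0) - sector (γ 1 - γ 0)) +
      sectorStep (γ (n + 2) - γ 0) ((γ (n + 2) - γ 0) - (γ 1 - γ 0)) +
      sectorStep ((γ (n + 2) - γ 0) - (γ 1 - γ 0)) (-(γ 1 - γ 0)) +
      (sector (-(γ (n + 2) - γ 0)) - sector (-(γ 1 - γ 0))) := by
    rw [← f1, ← f2, ← f3]
    linarith
  rw [show n + 1 + 1 = n + 2 from rfl, hc, f3]
  rw [f3] at key
  clear row hopf tn sA' sB' sA sB e1 f1 f2 f3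
  generalize ∑ i ∈ Finset.range (n + 1), cross (γ (i + 1) - γ i) (γ (i + 2) - γ (i + 1)) +
    cross (γ (n + 2) - γ (n + 1)) (-(γ (n + 2) - γ 0)) = s at key ⊢
  have hne : γ (n + 2) - γ 0 ≠ γ 1 - γ 0 := fun h => hne (by rw [sub_left_inj.1 h, sub_self])
  generalize γ 1 - γ 0 = u at *
  generalize γ (n + 2) - γ 0 = w at *
  -- The two neighbours of the lowest leftmost vertex are its east and north neighbours; their two
  -- orders are the two orientations.
  rcases hd0 with rfl | rfl | rfl | rfl <;> rcases hd2 with rfl | rfl | rfl | rfl <;>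
    first
    | (exfalso; norm_num at l1; done)
    | (exfalso; norm_num at l2; done)
    | exact absurd rfl hne
    | (simp [sector, sectorStep, cross] at key ⊢; omega)

theorem sum_range_add_periodic (f : ℕ → ℤ) (N : ℕ) (hf : ∀ k, f (k + N) = f k) (b : ℕ) :
    ∑ i ∈ Finset.range N, f (b + i) = ∑ i ∈ Finset.range N, f i := by
  induction b with
  | zero => simp
  | succ b ih =>
    rw [← ih]
    have h1 := Finset.sum_range_succ (fun i => f (b + i)) N
    have h2 := Finset.sum_range_succ' (fun i => f (b + i)) N
    have h3 := hf b
    simp only [add_zero] at h2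
    have : ∀ i, f (b + 1 + i) = f (b + (i + 1)) := fun i => by congr 1; ring
    simp only [this]
    linarith

/-- The rotation index of a closed simple lattice polygon is one full turn. -/
theorem umlauf (γ : ℕ → ℤ × ℤ) (n : ℕ) (hclosed : γ (n + 3) = γ 0)
    (hstep : ∀ i ≤ n + 2, IsDir (γ (i + 1) - γ i))
    (hinj : ∀ i j, i < j → j < n + 3 → γ i ≠ γ j) :
    ∑ i ∈ Finset.range (n + 2), cross (γ (i + 1) - γ i) (γ (i + 2) - γ (i + 1)) +
      cross (γ 0 - γ (n + 2)) (γ 1 - γ 0) = 4 ∨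
    ∑ i ∈ Finset.range (n + 2), cross (γ (i + 1) - γ i) (γ (i + 2) - γ (i + 1)) +
      cross (γ 0 - γ (n + 2)) (γ 1 - γ 0) = -4 := by
  set Γ : ℕ → ℤ × ℤ := fun k => γ (k % (n + 3)) with hΓ
  have hper : ∀ k, Γ (k + (n + 3)) = Γ k := fun k => by simp [hΓ]
  have hlt : ∀ k, k < n + 3 → Γ k = γ k := fun k hk => by simp [hΓ, Nat.mod_eq_of_lt hk]
  have hle : ∀ k, k ≤ n + 3 → Γ k = γ k := fun k hk => by
    rcases Nat.lt_or_ge k (n + 3) with h | h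
    · exact hlt k h
    · obtain rfl : k = n + 3 := by omega
      simp [hΓ, hclosed]
  have hmod : ∀ k, ∃ r, r < n + 3 ∧ Γ k = γ r ∧ Γ (k + 1) = γ (r + 1) := by
    intro k
    refine ⟨k % (n + 3), Nat.mod_lt _ (by omega), rfl, ?_⟩
    have hr := Nat.mod_lt k (show 0 < n + 3 by omega)
    rw [← hle (k % (n + 3) + 1) (by omega)]
    simp only [hΓ]
    rw [Nat.mod_add_mod]
  have hΓstep : ∀ k, IsDir (Γ (k + 1) - Γ k) := by
    intro k
    obtain ⟨r, hr, h1, h2⟩ := hmod k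
    rw [h1, h2]
    exact hstep r (by omega)
  -- Lexicographic order with the ordinate first selects the lowest vertex and, among ties, the
  -- leftmost.
  obtain ⟨b, hb, hmin⟩ := Finset.exists_min_image (Finset.range (n + 3))
    (fun i => toLex ((γ i).2, (γ i).1)) ⟨0, by simp⟩
  rw [Finset.mem_range] at hb
  have hΓinj : ∀ i j, i < j → j < n + 3 → Γ (b + i) ≠ Γ (b + j) := by
    intro i j hij hj h
    have hi' := Nat.mod_lt (b + i) (show 0 < n + 3 by omega)
    have hj' := Nat.mod_lt (b + j) (show 0 < n + 3 by omega)
    have hne : (b + i) % (n + 3) ≠ (b + j) % (n + 3) := by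
      intro h
      have h2 : (b + i) ≡ (b + j) [MOD n + 3] := h
      have h3 : i ≡ j [MOD n + 3] := Nat.ModEq.add_left_cancel' b h2
      exact hij.ne (Nat.ModEq.eq_of_lt_of_lt h3 (by omega) hj)
    rcases Nat.lt_or_gt_of_ne hne with h3 | h3
    · exact hinj _ _ h3 hj' h
    · exact hinj _ _ h3 hi' h.symm
  have key := umlauf_of_lowest (fun k => Γ (b + k)) n (hper b)
    (fun i _ => hΓstep (b + i))
    (fun i j hij hj => sub_ne_zero.2 (hΓinj i j hij hj).symm)
    (fun j hj0 hj => by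
      have h1 := hmin ((b + j) % (n + 3)) (Finset.mem_range.2 (Nat.mod_lt _ (by omega)))
      have h2 := hΓinj 0 j hj0 hj
      simp only [add_zero, hlt b hb] at h2 ⊢
      change _ ≤ toLex ((Γ (b + j)).2, (Γ (b + j)).1) at h1
      rw [Prod.Lex.le_iff] at h1
      simp only [ofLex_toLex] at h1
      simp only [Prod.fst_sub, Prod.snd_sub]
      have h3 : ¬ ((γ b).1 = (Γ (b + j)).1 ∧ (γ b).2 = (Γ (b + j)).2) := fun h =>
        h2 (Prod.ext h.1 h.2)
      omega)
  have hs := sum_range_add_periodic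
    (fun i => cross (Γ (i + 1) - Γ i) (Γ (i + 2) - Γ (i + 1))) (n + 3)
    (fun k => by
      have e1 : k + (n + 3) + 1 = k + 1 + (n + 3) := by ring
      have e2 : k + (n + 3) + 2 = k + 2 + (n + 3) := by ring
      simp only [e1, e2, hper]) b
  rw [Finset.sum_range_succ _ (n + 2), Finset.sum_range_succ _ (n + 2)] at hs
  have l1 : Γ (n + 2 + 1) = γ 0 := hclosed ▸ hle (n + 3) le_rfl
  have l2 : Γ (n + 2 + 2) = γ 1 := by
    have := hper 1
    rw [show 1 + (n + 3) = n + 2 + 2 by ring, hlt 1 (by omega)] at this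
    exact this
  have l3 : Γ (b + (n + 2) + 1) = Γ b := hper b
  have l4 : Γ (b + (n + 2) + 2) = Γ (b + 1) := by
    have := hper (b + 1)
    rw [← this]; congr 1; ring
  have l5 : ∑ i ∈ Finset.range (n + 2), cross (Γ (i + 1) - Γ i) (Γ (i + 2) - Γ (i + 1)) =
      ∑ i ∈ Finset.range (n + 2), cross (γ (i + 1) - γ i) (γ (i + 2) - γ (i + 1)) := by
    refine Finset.sum_congr rfl fun i hi => ?_
    rw [Finset.mem_range] at hi
    rw [hle i (by omega), hle (i + 1) (by omega), hle (i + 2) (by omega)]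
  rw [l5, l1, l2, l3, l4, hle (n + 2) (by omega)] at hs
  simp only [← add_assoc, add_zero] at key hs
  rw [hs] at key
  exact key

/-- Quarter turns from the normalized start of an arc to its final direction. -/
def dirOffset (d : ℤ × ℤ) : ℤ := if d = (0, -1) then 2 else if d = (-1, 0) then 1 else 0

/-- A simple lattice arc whose endpoints lie on a common row, closed up along that row. -/
theorem turning_of_closing (γ : ℕ → ℤ × ℤ) (N : ℕ) (x₀ x₁ r : ℤ) (hx : x₀ < x₁)
    (h0 : γ 0 = (x₀, r)) (hN : γ (N + 1) = (x₁, r))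
    (hstep : ∀ i ≤ N, IsDir (γ (i + 1) - γ i))
    (hinj : ∀ i j, i < j → j ≤ N + 1 → γ i ≠ γ j)
    (hfree : ∀ i ≤ N + 1, ∀ x, x₀ < x → x < x₁ → γ i ≠ (x, r))
    (hs : γ 1 - γ 0 = (0, 1) ∨ γ 1 - γ 0 = (0, -1)) :
    (γ (N + 1) - γ N = (0, 1) ∨ γ (N + 1) - γ N = (0, -1) ∨ γ (N + 1) - γ N = (-1, 0)) ∧
    ∃ e : ℤ, (e = 1 ∨ e = -1) ∧
    ∑ i ∈ Finset.range N, cross (γ (i + 1) - γ i) (γ (i + 2) - γ (i + 1)) =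
      4 * e + dirOffset (γ (N + 1) - γ N) - dirOffset (γ 1 - γ 0) := by
  have hN0 : N ≠ 0 := by
    rintro rfl
    rw [zero_add] at hN
    rw [h0, hN] at hs
    simp at hs
  -- An eastward last step would come from a point of the free gap or from the starting point.
  have hend : γ (N + 1) - γ N = (0, 1) ∨ γ (N + 1) - γ N = (0, -1) ∨ γ (N + 1) - γ N = (-1, 0) := by
    rcases hstep N le_rfl with h | h | h | h
    · exfalso
      have h' : γ N = (x₁ - 1, r) := by
        rw [hN] at h
        have e := sub_eq_iff_eq_add.1 h
        ext
        · have := congrArg Prod.fst e; simp at this ⊢; omega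
        · have := congrArg Prod.snd e; simp at this ⊢; omega
      rcases Int.lt_or_le x₀ (x₁ - 1) with h2 | h2
      · exact hfree N (by omega) _ h2 (by omega) h'
      · refine hinj 0 N (by omega) (by omega) ?_
        rw [h0, h']; congr 1; omega
    · exact Or.inl h
    · exact Or.inr (Or.inr h)
    · exact Or.inr (Or.inl h)
  refine ⟨hend, ?_⟩
  obtain ⟨w, hw⟩ : ∃ w : ℕ, x₁ = x₀ + w + 1 := ⟨(x₁ - x₀ - 1).toNat, by omega⟩
  set Γ : ℕ → ℤ × ℤ := fun k => if k ≤ N + 1 then γ k else (x₁ - (k - (N + 1) : ℕ), r) with hΓ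
  have g1 : ∀ k, k ≤ N + 1 → Γ k = γ k := fun k hk => by simp [hΓ, hk]
  have g2 : ∀ k, Γ (N + 1 + k) = (x₁ - k, r) := fun k => by
    rcases Nat.eq_zero_or_pos k with rfl | hk
    · simp [g1, hN]
    · simp [hΓ, hk.ne']
  have g3 : ∀ k, Γ (N + 1 + (k + 1)) - Γ (N + 1 + k) = (-1, 0) := fun k => by
    rw [g2, g2]; simp
  obtain ⟨n, hn⟩ : ∃ n, n + 3 = N + 1 + (w + 1) := ⟨N + w - 1, by omega⟩
  have hclosed : Γ (n + 3) = Γ 0 := by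
    rw [hn, g2, g1 0 (by omega), h0, hw]; push_cast; congr 1; ring
  have key := umlauf Γ n hclosed
    (fun i hi => by
      rcases Nat.lt_or_ge i (N + 1) with h | h
      · rw [g1 i (by omega), g1 (i + 1) (by omega)]; exact hstep i (by omega)
      · obtain ⟨k, rfl⟩ := Nat.exists_eq_add_of_le h
        exact Or.inr (Or.inr (Or.inl (g3 k))))
    (fun i j hij hj => by
      rcases Nat.lt_or_ge j (N + 2) with h | h
      · rw [g1 i (by omega), g1 j (by omega)]; exact hinj i j hij (by omega)
      · obtain ⟨k, rfl⟩ := Nat.exists_eq_add_of_le (show N + 1 ≤ j by omega)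
        rw [g2 k]
        rcases Nat.lt_or_ge i (N + 2) with h | h
        · rw [g1 i (by omega)]
          exact hfree i (by omega) _ (by omega) (by omega)
        · obtain ⟨k', rfl⟩ := Nat.exists_eq_add_of_le (show N + 1 ≤ i by omega)
          rw [g2 k']
          intro h
          have := congrArg Prod.fst h
          simp at this; omega)
  rw [show n + 2 = N + (w + 1) by omega, Finset.sum_range_add, Finset.sum_range_succ'] at key
  -- The closing walk is straight, so only its two end corners contribute; `dirOffset` records them.
  have z1 : ∑ k ∈ Finset.range w, cross (Γ (N + (k + 1) + 1) - Γ (N + (k + 1)))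
      (Γ (N + (k + 1) + 2) - Γ (N + (k + 1) + 1)) = 0 := by
    refine Finset.sum_eq_zero fun k _ => ?_
    have a := g3 k
    have b := g3 (k + 1)
    rw [show N + 1 + (k + 1 + 1) = N + (k + 1) + 2 by ring,
      show N + 1 + (k + 1) = N + (k + 1) + 1 by ring] at b
    rw [show N + 1 + (k + 1) = N + (k + 1) + 1 by ring, show N + 1 + k = N + (k + 1) by ring] at a
    rw [a, b]; rfl
  have z2 : ∑ k ∈ Finset.range N, cross (Γ (k + 1) - Γ k) (Γ (k + 2) - Γ (k + 1)) =
      ∑ k ∈ Finset.range N, cross (γ (k + 1) - γ k) (γ (k + 2) - γ (k + 1)) := by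
    refine Finset.sum_congr rfl fun k hk => ?_
    rw [Finset.mem_range] at hk
    rw [g1 k (by omega), g1 (k + 1) (by omega), g1 (k + 2) (by omega)]
  have z3 : Γ (N + 0 + 2) - Γ (N + 0 + 1) = (-1, 0) := g3 0
  have z4 : Γ 0 - Γ (N + (w + 1)) = (-1, 0) := by
    rw [show N + (w + 1) = N + 1 + w by ring, ← hclosed, hn]; exact g3 w
  rw [z1, z2, z3, z4, g1 0 (by omega), g1 1 (by omega), add_zero, g1 (N + 1) (by omega),
    g1 N (by omega)] at key
  generalize ∑ k ∈ Finset.range N, cross (γ (k + 1) - γ k) (γ (k + 2) - γ (k + 1)) = s at key ⊢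
  rcases key with key | key
  · refine ⟨1, Or.inl rfl, ?_⟩
    rcases hend with h | h | h <;> rcases hs with h' | h' <;> rw [h, h'] at key ⊢ <;>
      simp [cross, dirOffset] at key ⊢ <;> omega
  · refine ⟨-1, Or.inr rfl, ?_⟩
    rcases hend with h | h | h <;> rcases hs with h' | h' <;> rw [h, h'] at key ⊢ <;>
      simp [cross, dirOffset] at key ⊢ <;> omega

/-! ### The turning of an arc that ends on the row of its start -/

theorem sum_range_split_at (f : ℕ → ℤ) (m k : ℕ) :
    ∑ i ∈ Finset.range (m + 1 + k), f i =
      ∑ i ∈ Finset.range m, f i + f m + ∑ i ∈ Finset.range k, f (m + 1 + i) := by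
  rw [Finset.sum_range_add, Finset.sum_range_succ]

/-- The total turning of a simple lattice arc between two points of a row is determined modulo
full turns, whose number is bounded by the distance of the points. -/
theorem turning_of_arc (N : ℕ) : ∀ (γ : ℕ → ℤ × ℤ) (x₀ x₁ r : ℤ), x₀ < x₁ →
    γ 0 = (x₀, r) → γ (N + 1) = (x₁, r) →
    (∀ i ≤ N, IsDir (γ (i + 1) - γ i)) →
    (∀ i j, i < j → j ≤ N + 1 → γ i ≠ γ j) →
    (γ (N + 1) - γ N = (0, 1) ∨ γ (N + 1) - γ N = (0, -1) ∨ γ (N + 1) - γ N = (-1, 0)) →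
    ((γ 1 - γ 0 = (0, 1) ∨ γ 1 - γ 0 = (0, -1)) →
      ∃ e j : ℤ, -j ≤ e ∧ e ≤ j ∧ 2 ∣ j - e ∧ 1 ≤ j ∧ j ≤ x₁ - x₀ ∧
      ∑ i ∈ Finset.range N, cross (γ (i + 1) - γ i) (γ (i + 2) - γ (i + 1)) =
        4 * e + dirOffset (γ (N + 1) - γ N) - dirOffset (γ 1 - γ 0)) ∧
    (γ 1 - γ 0 = (1, 0) →
      ∃ e j : ℤ, -j ≤ e ∧ e ≤ j ∧ 2 ∣ j - e ∧ 1 ≤ j ∧ j ≤ x₁ - x₀ - 1 ∧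
      (∑ i ∈ Finset.range N, cross (γ (i + 1) - γ i) (γ (i + 2) - γ (i + 1)) =
        4 * e + dirOffset (γ (N + 1) - γ N) + 1 ∨
      ∑ i ∈ Finset.range N, cross (γ (i + 1) - γ i) (γ (i + 2) - γ (i + 1)) =
        4 * e + dirOffset (γ (N + 1) - γ N) - 3)) := by
  induction N using Nat.strong_induction_on with
  | _ N ih =>
  intro γ x₀ x₁ r hx h0 hN hstep hinj hend
  have tail : ∀ m, ∀ k, N = m + 1 + k → ∀ x, x < x₁ → γ (m + 1) = (x, r) →
      _ := fun m k hk x hxx hm => ih k (by omega) (fun i => γ (m + 1 + i)) x x₁ r hxx hm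
        (by rw [← hN]; congr 1; omega) (fun i hi => hstep (m + 1 + i) (by omega))
        (fun i j hij hj => hinj _ _ (Nat.add_lt_add_left hij (m + 1)) (by omega))
        (by
          have e1 : m + 1 + (k + 1) = N + 1 := by omega
          have e2 : m + 1 + k = N := by omega
          rw [e1, e2]; exact hend)
  have hE : ∀ i ≤ N, ∀ x, γ i = (x, r) → γ (i + 1) - γ i = (1, 0) → γ (i + 1) = (x + 1, r) := by
    intro i _ x h1 h2
    rw [h1] at h2
    rw [sub_eq_iff_eq_add.1 h2]; ext <;> simp [add_comm]
  have hW : ∀ i ≤ N, ∀ x, γ i = (x, r) → γ (i + 1) - γ i = (-1, 0) → γ (i + 1) = (x - 1, r) := by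
    intro i _ x h1 h2
    rw [h1] at h2
    rw [sub_eq_iff_eq_add.1 h2]; ext <;> simp; ring
  refine ⟨fun hs => ?_, fun hs => ?_⟩
  · classical
    -- The cut is made at the leftmost point beyond x₀ of the row visited by the whole arc, not at
    -- the first one in time. Hence the gap is free for the remaining arc too.
    have hex : ∃ k : ℕ, ∃ i ≤ N + 1, γ i = (x₀ + k + 1, r) :=
      ⟨(x₁ - x₀ - 1).toNat, N + 1, le_rfl, by rw [hN]; congr 1; omega⟩
    obtain ⟨i, hi, hγi⟩ := Nat.find_spec hex
    have hmin := fun k (hk : k < Nat.find hex) => Nat.find_min hex hk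
    have hle : x₀ + (Nat.find hex : ℕ) + 1 ≤ x₁ := by
      have := Nat.find_min' hex (m := (x₁ - x₀ - 1).toNat)
        ⟨N + 1, le_rfl, by rw [hN]; congr 1; omega⟩
      omega
    generalize Nat.find hex = q at *
    obtain ⟨x, hxq⟩ : ∃ x, x = x₀ + (q : ℤ) + 1 := ⟨_, rfl⟩
    rw [← hxq] at hγi hle
    have hi0 : i ≠ 0 := by
      rintro rfl
      rw [h0] at hγi
      have := congrArg Prod.fst hγi
      simp at this; omega
    obtain ⟨m, rfl⟩ := Nat.exists_eq_succ_of_ne_zero hi0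
    have hfree : ∀ i ≤ N + 1, ∀ y, x₀ < y → y < x → γ i ≠ (y, r) := by
      intro i hi y h1 h2 h3
      refine hmin (y - x₀ - 1).toNat (by omega) ⟨i, hi, ?_⟩
      rw [h3]; congr 1; omega
    obtain ⟨c1, ε, hε, c2⟩ := turning_of_closing γ m x₀ x r (by omega) h0 hγi
      (fun i hi => hstep i (by omega)) (fun i j hij hj => hinj i j hij (by omega))
      (fun i hi => hfree i (by omega)) hs
    by_cases hmN : m = N
    · subst hmN
      exact ⟨ε, 1, by omega, by omega, by omega, le_rfl, by omega, c2⟩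
    · obtain ⟨k, hk⟩ : ∃ k, N = m + 1 + k := ⟨N - m - 1, by omega⟩
      have hxx : x < x₁ := by
        refine lt_of_le_of_ne hle fun h => ?_
        refine hinj (m + 1) (N + 1) (by omega) le_rfl ?_
        rw [hN, ← h]; exact hγi
      obtain ⟨t1, t2⟩ := tail m k hk x hxx hγi
      have e1 : m + 1 + (k + 1) = N + 1 := by omega
      have e2 : m + 1 + k = N := by omega
      have hsplit := sum_range_split_at
        (fun i => cross (γ (i + 1) - γ i) (γ (i + 2) - γ (i + 1))) m k
      rw [← hk] at hsplit
      simp only [add_zero, e1, e2] at t1 t2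
      simp only [← add_assoc] at t1 t2 hsplit
      rw [hsplit, c2]
      have hne : ∀ d, γ (m + 1 + 1) - γ (m + 1) = -d → γ (m + 1) - γ m ≠ d := by
        intro d h f
        refine hinj m (m + 2) (by omega) (by omega) ?_
        rw [sub_eq_iff_eq_add] at f h
        rw [show m + 2 = m + 1 + 1 from rfl, h, f]; abel
      -- The corner at the cut point cancels the two direction corrections, so the numbers of full
      -- turns simply add.
      have hcv : ∀ d, (d = (0, 1) ∨ d = (0, -1)) → γ (m + 1 + 1) - γ (m + 1) = d →
          dirOffset (γ (m + 1) - γ m) + cross (γ (m + 1) - γ m) d = dirOffset d := by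
        intro d hd h
        have hn := hne (-d) (by rw [h, neg_neg])
        rcases c1 with f | f | f <;> rw [f] at hn ⊢ <;> rcases hd with rfl | rfl <;>
          first | exact absurd rfl hn | rfl
      rcases hstep (m + 1) (by omega) with h | h | h | h
      · obtain ⟨e, j, p1, p2, p3, p4, p5, p6⟩ := t2 h
        have hc : cross (γ (m + 1) - γ m) (1, 0) + dirOffset (γ (m + 1) - γ m) = -1 ∨
            cross (γ (m + 1) - γ m) (1, 0) + dirOffset (γ (m + 1) - γ m) = 3 := by
          rcases c1 with f | f | f
          · rw [f]; left; rfl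
          · rw [f]; right; rfl
          · exact absurd f (hne _ h)
        rw [show γ (m + 2) - γ (m + 1) = (1, 0) from h]
        -- When the arc runs along the row between opposite vertical directions, an extra full turn
        -- appears. It is paid for by the column used up by the eastward run, which the second claim
        -- subtracts from its bound on j.
        rcases hc with hc | hc <;> rcases p6 with p6 | p6 <;> rw [p6]
        · exact ⟨ε + e, j + 1, by omega, by omega, by omega, by omega, by omega, by linarith⟩
        · exact ⟨ε + e - 1, j + 2, by omega, by omega, by omega, by omega, by omega, by linarith⟩
        · exact ⟨ε + e + 1, j + 2, by omega, by omega, by omega, by omega, by omega, by linarith⟩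
        · exact ⟨ε + e, j + 1, by omega, by omega, by omega, by omega, by omega, by linarith⟩
      · obtain ⟨e, j, p1, p2, p3, p4, p5, p6⟩ := t1 (Or.inl h)
        refine ⟨ε + e, j + 1, by omega, by omega, by omega, by omega, by omega, ?_⟩
        have hc := hcv _ (Or.inl rfl) h
        rw [h] at p6
        rw [p6, show γ (m + 2) - γ (m + 1) = (0, 1) from h]
        linarith
      -- A westward step would enter the free gap or return to the start.
      · exfalso
        have h2 := hW (m + 1) (by omega) x hγi h
        rcases eq_or_ne (x - 1) x₀ with h3 | h3
        · exact hinj 0 (m + 1 + 1) (by omega) (by omega) (by rw [h0, h2, h3])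
        · exact hfree _ (by omega) _ (by omega) (by omega) h2
      · obtain ⟨e, j, p1, p2, p3, p4, p5, p6⟩ := t1 (Or.inr h)
        refine ⟨ε + e, j + 1, by omega, by omega, by omega, by omega, by omega, ?_⟩
        have hc := hcv _ (Or.inr rfl) h
        rw [h] at p6
        rw [p6, show γ (m + 2) - γ (m + 1) = (0, -1) from h]
        linarith
  · have h1 := hE 0 (by omega) x₀ h0 hs
    have hN0 : N ≠ 0 := by
      rintro rfl
      rw [zero_add, hs] at hend
      simp at hend
    obtain ⟨k, hk⟩ : ∃ k, N = 0 + 1 + k := ⟨N - 1, by omega⟩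
    have hxx : x₀ + 1 < x₁ := by
      refine lt_of_le_of_ne (by omega) fun h => ?_
      refine hinj 1 (N + 1) (by omega) le_rfl ?_
      rw [hN, ← h]; exact h1
    obtain ⟨t1, t2⟩ := tail 0 k hk _ hxx h1
    have e1 : 0 + 1 + (k + 1) = N + 1 := by omega
    have e2 : 0 + 1 + k = N := by omega
    have hsplit := sum_range_split_at
      (fun i => cross (γ (i + 1) - γ i) (γ (i + 2) - γ (i + 1))) 0 k
    rw [← hk] at hsplit
    simp only [add_zero, e1, e2] at t1 t2
    simp only [← add_assoc, zero_add, Finset.range_zero, Finset.sum_empty] at t1 t2 hsplit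
    rw [hsplit, hs]
    rcases hstep 1 (by omega) with h | h | h | h
    · obtain ⟨e, j, p1, p2, p3, p4, p5, p6⟩ := t2 h
      refine ⟨e, j, p1, p2, p3, p4, by omega, ?_⟩
      rw [show γ 2 - γ 1 = (1, 0) from h]
      simpa [cross] using p6
    · obtain ⟨e, j, p1, p2, p3, p4, p5, p6⟩ := t1 (Or.inl h)
      refine ⟨e, j, p1, p2, p3, p4, by omega, Or.inl ?_⟩
      rw [p6, h]
      simp [cross, dirOffset]; ring
    · exfalso
      have h2 := hW 1 (by omega) (x₀ + 1) h1 h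
      exact hinj 0 2 (by omega) (by omega) (by rw [h0, h2]; simp)
    · obtain ⟨e, j, p1, p2, p3, p4, p5, p6⟩ := t1 (Or.inr h)
      refine ⟨e, j, p1, p2, p3, p4, by omega, Or.inr ?_⟩
      rw [p6, h]
      simp [cross, dirOffset]; ring

/-! ### The lattice path of a realization -/

section

/-- Left turns minus right turns. -/
def net (σ : List Turn) : ℤ := (σ.count L : ℤ) - σ.count R

@[simp] theorem net_nil : net [] = 0 := rfl

@[simp] theorem net_L (σ : List Turn) : net (L :: σ) = net σ + 1 := by
  simp [net]; ring

@[simp] theorem net_R (σ : List Turn) : net (R :: σ) = net σ - 1 := by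
  simp [net]; ring

@[simp] theorem net_append (σ τ : List Turn) : net (σ ++ τ) = net σ + net τ := by
  simp [net]; ring

theorem IsDir.rotate {d : ℤ × ℤ} (h : IsDir d) (t : Turn) : IsDir (t.rotate d) := by
  rcases h with rfl | rfl | rfl | rfl <;> cases t <;> simp [Turn.rotate, IsDir]

@[simp] theorem segDir_zero (σ : List Turn) : segDir σ 0 = east := by simp [segDir]

theorem segDir_succ (σ : List Turn) {i : ℕ} (hi : i < σ.length) :
    segDir σ (i + 1) = σ[i].rotate (segDir σ i) := by
  simp only [segDir]
  rw [List.take_add_one, List.getElem?_eq_getElem hi, List.foldl_append]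
  rfl

theorem isDir_segDir (σ : List Turn) (i : ℕ) : IsDir (segDir σ i) := by
  unfold segDir
  generalize σ.take i = τ
  have : ∀ (τ : List Turn) d, IsDir d → IsDir (τ.foldl (fun d t => t.rotate d) d) := by
    intro τ
    induction τ with
    | nil => exact fun _ h => h
    | cons t τ ih => exact fun d h => ih _ (h.rotate t)
  exact this τ _ (Or.inl rfl)

theorem cross_segDir (σ : List Turn) {i : ℕ} (hi : i < σ.length) :
    cross (segDir σ i) (segDir σ (i + 1)) = net (σ.take (i + 1)) - net (σ.take i) := by
  rw [segDir_succ σ hi, List.take_add_one, List.getElem?_eq_getElem hi]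
  rcases isDir_segDir σ i with h | h | h | h <;> rw [h] <;> cases σ[i] <;>
    simp [cross, Turn.rotate]

/-- The length of the `i`-th segment. -/
def segLen (v : ℕ → ℤ × ℤ) (i : ℕ) : ℕ :=
  ((v (i + 1)).1 - (v i).1).natAbs + ((v (i + 1)).2 - (v i).2).natAbs

theorem segLen_of_step {v : ℕ → ℤ × ℤ} {i k : ℕ} {d : ℤ × ℤ} (hd : IsDir d)
    (h : v (i + 1) = v i + k • d) : segLen v i = k := by
  unfold segLen
  rw [h]
  rcases hd with rfl | rfl | rfl | rfl <;> simp

variable {v : ℕ → ℤ × ℤ} {σ : List Turn}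

theorem Realizes.segLen_pos (h : Realizes v σ) {i : ℕ} (hi : i ≤ σ.length) : 0 < segLen v i := by
  obtain ⟨k, hk, hv⟩ := h.step i hi
  rwa [segLen_of_step (isDir_segDir σ i) hv]

theorem Realizes.next (h : Realizes v σ) {i : ℕ} (hi : i ≤ σ.length) :
    v (i + 1) = v i + segLen v i • segDir σ i := by
  obtain ⟨k, hk, hv⟩ := h.step i hi
  rwa [segLen_of_step (isDir_segDir σ i) hv]

theorem Realizes.mem_side (h : Realizes v σ) {i t : ℕ} (hi : i ≤ σ.length) (ht : t ≤ segLen v i) :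
    toPlane (v i + t • segDir σ i) ∈ side v i := by
  have hl := h.segLen_pos hi
  have hlR : (0 : ℝ) < segLen v i := by exact_mod_cast hl
  rw [side, segment_eq_image']
  refine ⟨(t : ℝ) / segLen v i, ⟨by positivity, ?_⟩, ?_⟩
  · rw [div_le_one hlR]; exact_mod_cast ht
  · rw [h.next hi]
    ext <;> simp [toPlane] <;> field_simp

theorem toPlane_injective : Function.Injective toPlane := by
  rintro ⟨a, b⟩ ⟨c, d⟩ h
  simp only [toPlane, Prod.mk.injEq, Int.cast_inj] at h
  exact Prod.ext h.1 h.2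

theorem Realizes.lattice_disjoint (h : Realizes v σ) {i j s t : ℕ} (hij : i + 1 < j)
    (hj : j ≤ σ.length) (hs : s ≤ segLen v i) (ht : t ≤ segLen v j) :
    v i + s • segDir σ i ≠ v j + t • segDir σ j := by
  intro he
  refine Set.disjoint_left.1 (h.disjoint i j hij hj) (h.mem_side (by omega) hs) ?_
  rw [he]
  exact h.mem_side hj ht

theorem Realizes.lattice_consecutive (h : Realizes v σ) {i s t : ℕ}
    (hi : i < σ.length) (hs : s ≤ segLen v i) (ht : t ≤ segLen v (i + 1))
    (he : v i + s • segDir σ i = v (i + 1) + t • segDir σ (i + 1)) :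
    v i + s • segDir σ i = v (i + 1) := by
  have h1 := h.mem_side (by omega) hs
  have h2 := h.mem_side (by omega) ht
  rw [← he] at h2
  have h3 : toPlane (v i + s • segDir σ i) ∈ side v i ∩ side v (i + 1) := ⟨h1, h2⟩
  rw [h.consecutive i hi] at h3
  exact toPlane_injective h3

theorem smul_dir_injective {d : ℤ × ℤ} (hd : IsDir d) {s t : ℕ} (h : s • d = t • d) : s = t := by
  rcases hd with rfl | rfl | rfl | rfl <;> simpa using h

/-- Arc length up to the `i`-th vertex. -/
def arcLen (v : ℕ → ℤ × ℤ) (i : ℕ) : ℕ := ∑ j ∈ Finset.range i, segLen v j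

theorem arcLen_succ (v : ℕ → ℤ × ℤ) (i : ℕ) : arcLen v (i + 1) = arcLen v i + segLen v i :=
  Finset.sum_range_succ _ _

theorem arcLen_mono (v : ℕ → ℤ × ℤ) : Monotone (arcLen v) :=
  monotone_nat_of_le_succ fun i => by rw [arcLen_succ]; omega

/-- The index of the segment containing the lattice point at arc length `k`. -/
def segIdx (v : ℕ → ℤ × ℤ) (σ : List Turn) (k : ℕ) : ℕ :=
  Nat.findGreatest (fun i => arcLen v i ≤ k) σ.length

/-- The lattice point at arc length `k`. -/
def latticePath (v : ℕ → ℤ × ℤ) (σ : List Turn) (k : ℕ) : ℤ × ℤ :=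
  v (segIdx v σ k) + (k - arcLen v (segIdx v σ k)) • segDir σ (segIdx v σ k)

theorem segIdx_le (k : ℕ) : segIdx v σ k ≤ σ.length := Nat.findGreatest_le _

theorem arcLen_segIdx_le (k : ℕ) : arcLen v (segIdx v σ k) ≤ k :=
  Nat.findGreatest_spec (P := fun i => arcLen v i ≤ k) (m := 0) (by omega) (by simp [arcLen])

theorem segIdx_eq {i k : ℕ} (hi : i ≤ σ.length) (h1 : arcLen v i ≤ k)
    (h2 : i < σ.length → k < arcLen v (i + 1)) : segIdx v σ k = i := by
  refine (Nat.findGreatest_eq_iff).2 ⟨hi, fun _ => h1, fun {j} hj hj' h => ?_⟩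
  have := arcLen_mono v (show i + 1 ≤ j by omega)
  have := h2 (by omega)
  omega

theorem lt_arcLen_segIdx_succ {k : ℕ} (hk : k < arcLen v (σ.length + 1)) :
    k < arcLen v (segIdx v σ k + 1) := by
  rcases Nat.lt_or_ge (segIdx v σ k) σ.length with h | h
  · by_contra h'
    have := Nat.le_findGreatest (P := fun i => arcLen v i ≤ k) (n := σ.length)
      (m := segIdx v σ k + 1) (by omega) (by simpa using h')
    unfold segIdx at *
    omega
  · have := segIdx_le (v := v) (σ := σ) k
    rwa [show segIdx v σ k = σ.length by omega]

theorem Realizes.latticePath_eq (h : Realizes v σ) {i t : ℕ} (hi : i ≤ σ.length)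
    (ht : t ≤ segLen v i) : latticePath v σ (arcLen v i + t) = v i + t • segDir σ i := by
  -- At a bend `segIdx` already names the next segment; only at the endpoint does it stay on the
  -- current one.
  by_cases hc : t = segLen v i ∧ i < σ.length
  · have hp := h.segLen_pos (i := i + 1) (by omega)
    have : segIdx v σ (arcLen v i + t) = i + 1 := segIdx_eq (by omega)
      (by rw [arcLen_succ]; omega) (fun _ => by rw [arcLen_succ, arcLen_succ]; omega)
    rw [latticePath, this, arcLen_succ, h.next hi, hc.1]
    simp
  · have : segIdx v σ (arcLen v i + t) = i := segIdx_eq hi (by omega)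
      (fun _ => by rw [arcLen_succ]; omega)
    rw [latticePath, this]
    simp

theorem exists_arc_position {k : ℕ} (hk : k < arcLen v (σ.length + 1)) :
    ∃ t < segLen v (segIdx v σ k), k = arcLen v (segIdx v σ k) + t := by
  have h1 := arcLen_segIdx_le (v := v) (σ := σ) k
  have h2 := lt_arcLen_segIdx_succ hk
  rw [arcLen_succ] at h2
  exact ⟨k - arcLen v (segIdx v σ k), by omega, by omega⟩

theorem Realizes.latticePath_step (h : Realizes v σ) {k : ℕ}
    (hk : k < arcLen v (σ.length + 1)) :
    latticePath v σ (k + 1) - latticePath v σ k = segDir σ (segIdx v σ k) := by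
  obtain ⟨t, ht, hkt⟩ := exists_arc_position hk
  have hi := segIdx_le (v := v) (σ := σ) k
  generalize segIdx v σ k = i at *
  subst hkt
  rw [add_assoc, h.latticePath_eq hi (by omega), h.latticePath_eq hi (by omega), succ_nsmul]
  abel

theorem Realizes.latticePath_ne (h : Realizes v σ) {j k : ℕ} (hjk : j < k)
    (hk : k ≤ arcLen v (σ.length + 1)) : latticePath v σ j ≠ latticePath v σ k := by
  obtain ⟨s, hs, hjs⟩ := exists_arc_position (v := v) (σ := σ) (k := j) (by omega)
  obtain ⟨i', t, hi', ht, hkt⟩ : ∃ i' t, i' ≤ σ.length ∧ t ≤ segLen v i' ∧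
      k = arcLen v i' + t := by
    rcases hk.lt_or_eq with hk | hk
    · obtain ⟨t, ht, hkt⟩ := exists_arc_position hk
      exact ⟨_, t, segIdx_le _, ht.le, hkt⟩
    · exact ⟨σ.length, segLen v σ.length, le_rfl, le_rfl, by rw [hk, arcLen_succ]⟩
  have hi := segIdx_le (v := v) (σ := σ) j
  generalize segIdx v σ j = i at *
  subst hjs hkt
  rw [h.latticePath_eq hi hs.le, h.latticePath_eq hi' ht]
  intro he
  rcases Nat.lt_trichotomy (i + 1) i' with hlt | heq | hgt
  · exact h.lattice_disjoint hlt hi' hs.le ht he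
  · subst heq
    have h1 := h.lattice_consecutive (by omega) hs.le ht he
    rw [h.next hi, add_right_inj] at h1
    have := smul_dir_injective (isDir_segDir σ i) h1
    omega
  · rcases Nat.lt_or_ge i' i with h2 | h2
    · have := arcLen_mono v (show i' + 1 ≤ i by omega)
      rw [arcLen_succ] at this
      omega
    · obtain rfl : i' = i := by omega
      rw [add_right_inj] at he
      have := smul_dir_injective (isDir_segDir σ i') he
      omega

/-- Written as a difference of net turnings, so that sums along the path telescope; inside a segment
both sides vanish. -/
theorem Realizes.cross_latticePath (h : Realizes v σ) {k : ℕ}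
    (hk : k + 1 < arcLen v (σ.length + 1)) :
    cross (latticePath v σ (k + 1) - latticePath v σ k)
      (latticePath v σ (k + 2) - latticePath v σ (k + 1)) =
      net (σ.take (segIdx v σ (k + 1))) - net (σ.take (segIdx v σ k)) := by
  rw [h.latticePath_step (by omega), h.latticePath_step (k := k + 1) hk]
  obtain ⟨t, ht, hkt⟩ := exists_arc_position (v := v) (σ := σ) (k := k) (by omega)
  have hi := segIdx_le (v := v) (σ := σ) k
  generalize segIdx v σ k = i at *
  subst hkt
  by_cases hc : t + 1 = segLen v i
  · rcases hi.lt_or_eq with hi | hi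
    · have hp := h.segLen_pos (i := i + 1) (by omega)
      have : segIdx v σ (arcLen v i + t + 1) = i + 1 := segIdx_eq (by omega)
        (by rw [arcLen_succ]; omega) (fun _ => by rw [arcLen_succ, arcLen_succ]; omega)
      rw [this, cross_segDir σ hi]
    · subst hi
      rw [arcLen_succ] at hk
      omega
  · have : segIdx v σ (arcLen v i + t + 1) = i := segIdx_eq hi (by omega)
      (fun _ => by rw [arcLen_succ]; omega)
    rw [this]
    simp [cross, mul_comm]

/-- The turning of the part of a realized chain between two lattice points of a common row. -/
theorem Realizes.turning_of_subarc (h : Realizes v σ) {i₀ i₁ t₀ t₁ : ℕ} (hi : i₀ < i₁)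
    (hi₁ : i₁ ≤ σ.length) (ht₀ : t₀ < segLen v i₀) (ht₁ : t₁ < segLen v i₁) {x₀ x₁ r : ℤ}
    (h₀ : v i₀ + t₀ • segDir σ i₀ = (x₀, r)) (h₁ : v i₁ + (t₁ + 1) • segDir σ i₁ = (x₁, r))
    (hx : x₀ < x₁) (hd₀ : segDir σ i₀ = (0, 1) ∨ segDir σ i₀ = (0, -1))
    (hd₁ : segDir σ i₁ = (0, 1) ∨ segDir σ i₁ = (0, -1) ∨ segDir σ i₁ = (-1, 0)) :
    ∃ e j : ℤ, -j ≤ e ∧ e ≤ j ∧ 2 ∣ j - e ∧ 1 ≤ j ∧ j ≤ x₁ - x₀ ∧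
      net (σ.take i₁) - net (σ.take i₀) =
        4 * e + dirOffset (segDir σ i₁) - dirOffset (segDir σ i₀) := by
  set k₀ := arcLen v i₀ + t₀ with hk₀
  set k₁ := arcLen v i₁ + t₁ with hk₁
  have hlt : k₀ < k₁ := by
    have := arcLen_mono v (show i₀ + 1 ≤ i₁ by omega)
    rw [arcLen_succ] at this
    omega
  have hend : k₁ < arcLen v (σ.length + 1) := by
    have := arcLen_mono v (show i₁ + 1 ≤ σ.length + 1 by omega)
    rw [arcLen_succ] at this
    omega
  have x0 : segIdx v σ k₀ = i₀ := segIdx_eq (by omega) (by omega)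
    (fun _ => by rw [arcLen_succ]; omega)
  have x1 : segIdx v σ k₁ = i₁ := segIdx_eq (by omega) (by omega)
    (fun _ => by rw [arcLen_succ]; omega)
  obtain ⟨N, hN⟩ : ∃ N, k₁ = k₀ + N := ⟨k₁ - k₀, by omega⟩
  have d0 : latticePath v σ (k₀ + 1) - latticePath v σ k₀ = segDir σ i₀ := by
    rw [h.latticePath_step (by omega), x0]
  have d1 : latticePath v σ (k₀ + (N + 1)) - latticePath v σ (k₀ + N) = segDir σ i₁ := by
    rw [← add_assoc, ← hN, h.latticePath_step (by omega), x1]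
  have key := (turning_of_arc N (fun k => latticePath v σ (k₀ + k)) x₀ x₁ r hx
    (by rw [← h₀, ← h.latticePath_eq (by omega) ht₀.le]; rfl)
    (by rw [← h₁, ← h.latticePath_eq hi₁ (by omega)]; congr 1; omega)
    (fun i hi => by
      have := h.latticePath_step (k := k₀ + i) (by omega)
      rw [← add_assoc, this]
      exact isDir_segDir _ _)
    (fun i j hij hj => h.latticePath_ne (by omega) (by omega))
    (by rw [d1]; exact hd₁)).1 (by rw [add_zero, d0]; exact hd₀)
  obtain ⟨e, j, p1, p2, p3, p4, p5, p6⟩ := key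
  refine ⟨e, j, p1, p2, p3, p4, p5, ?_⟩
  simp only [add_zero] at p6
  rw [d0, d1] at p6
  rw [← p6, ← x0, ← x1, hN]
  have := Finset.sum_range_sub (fun k => net (σ.take (segIdx v σ (k₀ + k)))) N
  simp only [add_zero] at this
  rw [← this]
  refine Finset.sum_congr rfl fun k hk => ?_
  rw [Finset.mem_range] at hk
  exact (h.cross_latticePath (k := k₀ + k) (by omega)).symm

/-! ### Staircases at both ends -/

/-- The lattice point `p` lies on the `i`-th segment. -/
def OnSeg (v : ℕ → ℤ × ℤ) (σ : List Turn) (i : ℕ) (p : ℤ × ℤ) : Prop :=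
  ∃ t ≤ segLen v i, p = v i + t • segDir σ i

theorem Realizes.not_onSeg (h : Realizes v σ) {i j : ℕ} (hij : i + 1 < j) (hj : j ≤ σ.length)
    {p : ℤ × ℤ} (h1 : OnSeg v σ i p) (h2 : OnSeg v σ j p) : False := by
  obtain ⟨s, hs, rfl⟩ := h1
  obtain ⟨t, ht, he⟩ := h2
  exact h.lattice_disjoint hij hj hs ht he

theorem Realizes.east_seg (h : Realizes v σ) {i : ℕ} (hi : i ≤ σ.length)
    (hd : segDir σ i = (1, 0)) :
    (v (i + 1)).1 = (v i).1 + segLen v i ∧ (v (i + 1)).2 = (v i).2 := by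
  rw [h.next hi, hd]; simp

theorem Realizes.vert_seg (h : Realizes v σ) {i : ℕ} (hi : i ≤ σ.length) {s : ℤ}
    (hd : segDir σ i = (0, s)) :
    (v (i + 1)).1 = (v i).1 ∧ (v (i + 1)).2 = (v i).2 + segLen v i * s := by
  rw [h.next hi, hd]; simp

theorem Realizes.onSeg_east (h : Realizes v σ) {i : ℕ} (hi : i ≤ σ.length)
    (hd : segDir σ i = (1, 0)) {x : ℤ} (h1 : (v i).1 ≤ x) (h2 : x ≤ (v (i + 1)).1) :
    OnSeg v σ i (x, (v i).2) := by
  have := (h.east_seg hi hd).1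
  refine ⟨(x - (v i).1).toNat, by omega, ?_⟩
  rw [hd]
  ext <;> simp
  omega

theorem Realizes.onSeg_vert (h : Realizes v σ) {i : ℕ} (hi : i ≤ σ.length) {s : ℤ}
    (hs : s = 1 ∨ s = -1) (hd : segDir σ i = (0, s)) {y : ℤ} (h1 : s * (v i).2 ≤ s * y)
    (h2 : s * y ≤ s * (v (i + 1)).2) : OnSeg v σ i ((v i).1, y) := by
  have := (h.vert_seg hi hd).2
  refine ⟨(s * y - s * (v i).2).toNat, ?_, ?_⟩
  · rcases hs with rfl | rfl <;> omega
  · rw [hd]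
    rcases hs with rfl | rfl <;> ext <;> simp <;> omega

/-- Two staircases, one descending from the origin and one descending from a later point of the
same row, are separated by as many columns as they have vertical segments, and by the turning of
the part of the chain between them. -/
theorem Realizes.staircase_bound (h : Realizes v σ) {s : ℤ} (hs : s = 1 ∨ s = -1) {m N : ℕ}
    (hm : 0 < m) (hN : N ≤ σ.length)
    (hO : ∀ i < m, 2 * i + 1 ≤ σ.length ∧ segDir σ (2 * i) = (1, 0) ∧
      segDir σ (2 * i + 1) = (0, s))
    (hP : ∀ j < m, 2 * j ≤ N ∧ segDir σ (N - 2 * j) = (0, -s))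
    (hP' : ∀ j, j + 1 < m → segDir σ (N - 2 * j - 1) = (1, 0))
    (hrow : (v (N + 1)).2 = 0) (hcol : (v 1).1 < (v (N + 1)).1) :
    ∃ e j : ℤ, -j ≤ e ∧ e ≤ j ∧ 2 ∣ j - e ∧ 1 ≤ j ∧ m + j ≤ (v (N + 1)).1 ∧
      net (σ.take N) - net (σ.take 1) = 4 * e + 2 * s := by
  have hv0 : v 0 = (0, 0) := h.start
  have ns : ((0 : ℤ), s) ≠ (0, -s) := by rcases hs with rfl | rfl <;> decide
  have ns' : ((0 : ℤ), -s) ≠ (0, s) := ns.symm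
  have nE : ((1 : ℤ), (0 : ℤ)) ≠ (0, -s) := by simp
  have nE' : ((1 : ℤ), (0 : ℤ)) ≠ (0, s) := by simp
  have hs' : -s = 1 ∨ -s = -1 := by rcases hs with rfl | rfl <;> simp
  have ss : s * s = 1 := by rcases hs with rfl | rfl <;> rfl
  -- the columns and depths of the descending staircase from the origin
  have oE : ∀ i < m, (v (2 * i + 1)).2 = (v (2 * i)).2 ∧ (v (2 * i)).1 < (v (2 * i + 1)).1 := by
    intro i hi
    have a := h.east_seg (i := 2 * i) (by have := hO i hi; omega) (hO i hi).2.1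
    have b := h.segLen_pos (i := 2 * i) (by have := hO i hi; omega)
    omega
  have oV : ∀ i < m, (v (2 * i + 2)).1 = (v (2 * i + 1)).1 ∧
      s * (v (2 * i + 1)).2 < s * (v (2 * i + 2)).2 := by
    intro i hi
    have a := h.vert_seg (i := 2 * i + 1) (by have := hO i hi; omega) (hO i hi).2.2
    have b := h.segLen_pos (i := 2 * i + 1) (by have := hO i hi; omega)
    refine ⟨a.1, ?_⟩
    rw [show 2 * i + 2 = 2 * i + 1 + 1 from rfl, a.2]
    rcases hs with rfl | rfl <;> omega
  have oX : ∀ i < m, (i : ℤ) + 1 ≤ (v (2 * i + 1)).1 := by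
    intro i
    induction i with
    | zero => intro hi; have := (oE 0 hi).2; simp [hv0] at this ⊢; omega
    | succ i ih =>
      intro hi
      have a := ih (by omega)
      have b := (oE (i + 1) hi).2
      have c := (oV i (by omega)).1
      rw [show 2 * (i + 1) = 2 * i + 2 by ring] at b ⊢
      push_cast
      omega
  have oNet : ∀ i < m, net (σ.take (2 * i + 1)) = net (σ.take 1) := by
    intro i
    induction i with
    | zero => intro _; rfl
    | succ i ih =>
      intro hi
      have a := hO i (by omega)
      have b := hO (i + 1) hi
      have c1 := cross_segDir σ (i := 2 * i + 1) (by omega)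
      have c2 := cross_segDir σ (i := 2 * i + 1 + 1) (by omega)
      rw [show 2 * (i + 1) = 2 * i + 1 + 1 by ring] at b ⊢
      rw [a.2.2, b.2.1] at c1
      rw [b.2.1, b.2.2] at c2
      simp [cross] at c1 c2
      have := ih (by omega)
      omega
  -- the same for the staircase from the endpoint
  have pV : ∀ j < m, (v (N - 2 * j + 1)).1 = (v (N - 2 * j)).1 ∧
      s * (v (N - 2 * j + 1)).2 < s * (v (N - 2 * j)).2 := by
    intro j hj
    have a := h.vert_seg (i := N - 2 * j) (by omega) (hP j hj).2
    have b := h.segLen_pos (i := N - 2 * j) (by omega)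
    refine ⟨a.1, ?_⟩
    rw [a.2]
    rcases hs with rfl | rfl <;> omega
  have pI : ∀ j, j + 1 < m → N - 2 * j - 1 + 1 = N - 2 * j ∧
      N - 2 * (j + 1) + 1 = N - 2 * j - 1 := by
    intro j hj
    have := (hP (j + 1) hj).1
    omega
  have pE : ∀ j, j + 1 < m → (v (N - 2 * j)).2 = (v (N - 2 * (j + 1) + 1)).2 ∧
      (v (N - 2 * (j + 1) + 1)).1 < (v (N - 2 * j)).1 := by
    intro j hj
    have a := h.east_seg (i := N - 2 * j - 1) (by omega) (hP' j hj)
    have b := h.segLen_pos (i := N - 2 * j - 1) (by omega)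
    rw [(pI j hj).1] at a
    rw [(pI j hj).2]
    omega
  have pX : ∀ j < m, (v (N - 2 * j + 1)).1 + j ≤ (v (N + 1)).1 := by
    intro j
    induction j with
    | zero => intro _; simp
    | succ j ih =>
      intro hj
      have a := ih (by omega)
      have b := (pE j hj).2
      have c := (pV j (by omega)).1
      push_cast
      omega
  have pNet : ∀ j < m, net (σ.take (N - 2 * j)) = net (σ.take N) := by
    intro j
    induction j with
    | zero => intro _; rfl
    | succ j ih =>
      intro hj
      have i1 := pI j hj
      have c1 := cross_segDir σ (i := N - 2 * j - 1) (by omega)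
      have c2 := cross_segDir σ (i := N - 2 * (j + 1)) (by omega)
      rw [i1.1, hP' j hj, (hP j (by omega)).2] at c1
      rw [i1.2, (hP (j + 1) hj).2, hP' j hj] at c2
      simp [cross] at c1 c2
      have := ih (by omega)
      omega
  -- going down both staircases simultaneously
  have main : ∀ q < m, ∃ i j : ℕ, ∃ y : ℤ, i < m ∧ j < m ∧ q ≤ i + j ∧
      s * (v (2 * i + 1)).2 ≤ y ∧ y < s * (v (2 * i + 2)).2 ∧
      s * (v (N - 2 * j + 1)).2 ≤ y ∧ y < s * (v (N - 2 * j)).2 ∧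
      (v (2 * i + 1)).1 < (v (N - 2 * j + 1)).1 ∧ 2 * i + 1 < N - 2 * j := by
    intro q
    induction q with
    | zero =>
      intro _
      have e1 := oE 0 hm
      have e2 := oV 0 hm
      have e3 := pV 0 hm
      simp only [mul_zero, zero_add, hv0, Nat.sub_zero, hrow] at e1 e2 e3
      refine ⟨0, 0, 0, hm, hm, le_rfl, ?_⟩
      simp only [mul_zero, zero_add, Nat.sub_zero, hrow, e1.1]
      rw [e1.1, mul_zero] at e2
      refine ⟨le_rfl, e2.2, le_rfl, by omega, hcol, ?_⟩
      have a := (hO 0 hm).2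
      have b := (hP 0 hm).2
      simp only [mul_zero, zero_add, Nat.sub_zero] at a b
      have : N ≠ 0 := by rintro rfl; exact nE (a.1.symm.trans b)
      have : N ≠ 1 := by rintro rfl; exact ns (a.2.symm.trans b)
      omega
    | succ q ih =>
      intro hq
      obtain ⟨i, j, y, hi, hj, hij, y1, y2, y3, y4, hx, hlt⟩ := ih (by omega)
      -- The invariant is a level y, measured in direction s, that meets the i-th column of the
      -- first staircase and the j-th of the second, in left-to-right order. If i + j = q, both
      -- staircases still have a next step.
      by_cases hge : q + 1 ≤ i + j
      · exact ⟨i, j, y, hi, hj, hge, y1, y2, y3, y4, hx, hlt⟩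
      have hi' : i + 1 < m := by omega
      have hj' : j + 1 < m := by omega
      have oi := hO (i + 1) hi'
      rw [show 2 * (i + 1) = 2 * i + 2 by ring] at oi
      have oEi := oE (i + 1) hi'
      have oVi := oV (i + 1) hi'
      rw [show 2 * (i + 1) = 2 * i + 2 by ring] at oEi oVi
      have lt1 : 2 * i + 3 < N - 2 * j := by
        have a1 : 2 * i + 2 ≠ N - 2 * j := fun e => nE (by rw [← oi.2.1, e, (hP j hj).2])
        have a2 : 2 * i + 3 ≠ N - 2 * j := fun e => ns (by rw [← oi.2.2, ← (hP j hj).2, ← e])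
        omega
      have lt2 : 2 * i + 1 < N - 2 * (j + 1) := by
        have a1 : 2 * i + 1 ≠ N - 2 * j - 1 := fun e => nE' (by
          rw [← (hO i hi).2.2, e, hP' j hj'])
        have a2 : 2 * i + 1 ≠ N - 2 * (j + 1) := fun e => ns (by
          rw [← (hO i hi).2.2, e, (hP (j + 1) hj').2])
        omega
      have pEj := pE j hj'
      have pVj := pV j hj
      have pVj' := pV (j + 1) hj'
      have oVi' := oV i hi
      have sE := fun x hx1 hx2 => h.onSeg_east (i := 2 * i + 2) (by omega) oi.2.1 (x := x) hx1 hx2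
      have sE' := fun x hx1 hx2 => h.onSeg_east (i := N - 2 * j - 1) (by omega) (hP' j hj')
        (x := x) hx1 hx2
      rw [(pI j hj').1, ← (pI j hj').2] at sE'
      -- Move to the level where the first of the two vertical segments is used up, advancing that
      -- staircase, or both in a tie. If the columns lost their order, the horizontal step just
      -- taken would hit the other staircase.
      rcases lt_trichotomy (s * (v (2 * i + 2)).2) (s * (v (N - 2 * j)).2) with hc | hc | hc
      · refine ⟨i + 1, j, s * (v (2 * i + 2)).2, hi', hj, by omega, ?_⟩
        rw [show 2 * (i + 1) = 2 * i + 2 by ring]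
        refine ⟨by rw [oEi.1], by rw [← oEi.1]; exact oVi.2, by omega, hc, ?_, by omega⟩
        by_contra hcon
        have q1 := sE (v (N - 2 * j)).1 (by omega) (by omega)
        have q2 := h.onSeg_vert (i := N - 2 * j) (by omega) (s := -s) hs' (hP j hj).2
          (y := (v (2 * i + 2)).2) (by linarith) (by linarith)
        exact h.not_onSeg (by omega) (by omega) q1 q2
      · have hyy : (v (2 * i + 2)).2 = (v (N - 2 * j)).2 := by
          rcases hs with rfl | rfl <;> omega
        have lt3 : 2 * i + 3 < N - 2 * (j + 1) := by
          have a1 : 2 * i + 3 ≠ N - 2 * j - 1 := fun e => nE' (by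
            rw [← oi.2.2, ← hP' j hj', ← e])
          have a2 : 2 * i + 3 ≠ N - 2 * (j + 1) := fun e => ns (by
            rw [← oi.2.2, ← (hP (j + 1) hj').2, ← e])
          omega
        refine ⟨i + 1, j + 1, s * (v (2 * i + 2)).2, hi', hj', by omega, ?_⟩
        rw [show 2 * (i + 1) = 2 * i + 2 by ring]
        refine ⟨by rw [oEi.1], by rw [← oEi.1]; exact oVi.2, by rw [hc, pEj.1], ?_, ?_, lt3⟩
        · rw [hc, pEj.1]; exact pVj'.2
        · by_contra hcon
          have q1 := sE (max (v (2 * i + 2)).1 (v (N - 2 * (j + 1) + 1)).1) (by omega) (by omega)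
          have q2 := sE' (max (v (2 * i + 2)).1 (v (N - 2 * (j + 1) + 1)).1) (by omega) (by omega)
          rw [hyy, pEj.1] at q1
          exact h.not_onSeg (by omega) (by omega) q1 q2
      · refine ⟨i, j + 1, s * (v (N - 2 * j)).2, hi, hj', by omega, by omega, hc,
          by rw [pEj.1], by rw [pEj.1]; exact pVj'.2, ?_, lt2⟩
        by_contra hcon
        have q1 := sE' (v (2 * i + 1)).1 (by omega) (by omega)
        have q2 := h.onSeg_vert (i := 2 * i + 1) (by omega) (s := s) hs (hO i hi).2.2
          (y := (v (N - 2 * j)).2) (by linarith)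
          (by rw [show 2 * i + 1 + 1 = 2 * i + 2 from rfl]; linarith)
        rw [pEj.1] at q2
        exact h.not_onSeg (by omega) (by omega) q2 q1
  -- The left column is at least i + 1 and the right one at most the end column minus j. With i + j
  -- ≥ m - 1 their distance has dropped by at least m.
  obtain ⟨i, j, y, hi, hj, hij, y1, y2, y3, y4, hx, hlt⟩ := main (m - 1) (by omega)
  have a := h.vert_seg (i := 2 * i + 1) (by omega) (hO i hi).2.2
  have b := h.vert_seg (i := N - 2 * j) (by omega) (hP j hj).2
  have hsa : s * (v (2 * i + 2)).2 = s * (v (2 * i + 1)).2 + segLen v (2 * i + 1) := by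
    rw [show 2 * i + 2 = 2 * i + 1 + 1 from rfl, a.2]; linear_combination (segLen v (2*i+1) : ℤ) * ss
  have hsb : s * (v (N - 2 * j + 1)).2 = s * (v (N - 2 * j)).2 - segLen v (N - 2 * j) := by
    rw [b.2]; linear_combination (-segLen v (N - 2 * j) : ℤ) * ss
  obtain ⟨e, k, p1, p2, p3, p4, p5, p6⟩ := h.turning_of_subarc (i₀ := 2 * i + 1)
    (i₁ := N - 2 * j) (t₀ := (y - s * (v (2 * i + 1)).2).toNat)
    (t₁ := (s * (v (N - 2 * j)).2 - y - 1).toNat) (x₀ := (v (2 * i + 1)).1)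
    (x₁ := (v (N - 2 * j + 1)).1) (r := s * y) hlt (by omega) (by omega) (by omega)
    (by
      rw [(hO i hi).2.2]
      ext
      · simp
      · rcases hs with rfl | rfl <;> simp <;> omega)
    (by
      rw [(hP j hj).2, b.1]
      ext
      · simp
      · rcases hs with rfl | rfl <;> simp <;> omega)
    hx
    (by rw [(hO i hi).2.2]; rcases hs with rfl | rfl <;> simp)
    (by rw [(hP j hj).2]; rcases hs with rfl | rfl <;> simp)
  have x1 := oX i hi
  have x2 := pX j hj
  refine ⟨e, k, p1, p2, p3, p4, by omega, ?_⟩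
  rw [oNet i hi, pNet j hj, (hO i hi).2.2, (hP j hj).2] at p6
  rw [p6]
  rcases hs with rfl | rfl <;> simp [dirOffset]
  ring

/-! ### Directions and staircase counts -/

theorem segDir_eq_of_net (σ : List Turn) (i : ℕ) :
    (net (σ.take i) % 4 = 0 ∧ segDir σ i = (1, 0)) ∨ (net (σ.take i) % 4 = 1 ∧ segDir σ i = (0, 1)) ∨
    (net (σ.take i) % 4 = 2 ∧ segDir σ i = (-1, 0)) ∨
    (net (σ.take i) % 4 = 3 ∧ segDir σ i = (0, -1)) := by
  unfold segDir
  generalize σ.take i = τ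
  induction τ using List.reverseRecOn with
  | nil => simp [east]
  | append_singleton τ t ih =>
    rw [List.foldl_append, net_append]
    simp only [List.foldl_cons, List.foldl_nil]
    rcases ih with ⟨h1, h2⟩ | ⟨h1, h2⟩ | ⟨h1, h2⟩ | ⟨h1, h2⟩ <;> rw [h2] <;> cases t <;>
      simp [Turn.rotate] <;> omega

theorem net_take_length (σ : List Turn) : net (σ.take σ.length) = net σ := by simp

/-- Consecutive directions are perpendicular unit vectors. -/
def Perp (d e : ℤ × ℤ) : Prop := IsDir e ∧ d.1 * e.1 + d.2 * e.2 = 0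

theorem perp_segDir (σ : List Turn) {i : ℕ} (hi : i < σ.length) :
    Perp (segDir σ i) (segDir σ (i + 1)) := by
  refine ⟨isDir_segDir _ _, ?_⟩
  rw [segDir_succ σ hi]
  rcases isDir_segDir σ i with h | h | h | h <;> rw [h] <;> cases σ[i] <;> simp [Turn.rotate]

theorem perp_segDir' (σ : List Turn) {i : ℕ} (hi : i < σ.length) :
    Perp (segDir σ (i + 1)) (segDir σ i) := by
  obtain ⟨-, h⟩ := perp_segDir σ hi
  exact ⟨isDir_segDir _ _, by linarith⟩

theorem length_segDirs (σ : List Turn) : (segDirs σ).length = σ.length + 1 := by simp [segDirs]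

theorem segDirs_getElem? (σ : List Turn) {i : ℕ} (hi : i ≤ σ.length) :
    (segDirs σ)[i]? = some (segDir σ i) := by
  simp [segDirs, List.getElem?_range (show i < σ.length + 1 by omega)]

theorem segDirs_reverse_getElem? (σ : List Turn) {i : ℕ} (hi : i ≤ σ.length) :
    (segDirs σ).reverse[i]? = some (segDir σ (σ.length - i)) := by
  rw [List.getElem?_reverse (by rw [length_segDirs]; omega), length_segDirs,
    ← segDirs_getElem? σ (by omega)]
  congr 1

theorem lt_of_segDirs_getElem? {σ : List Turn} {i : ℕ} {d : ℤ × ℤ}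
    (h : (segDirs σ)[i]? = some d) : i ≤ σ.length ∧ segDir σ i = d := by
  have h1 := (List.getElem?_eq_some_iff.1 h).1
  rw [length_segDirs] at h1
  rw [segDirs_getElem? σ (by omega)] at h
  exact ⟨by omega, by simpa using h⟩

theorem lt_of_segDirs_reverse_getElem? {σ : List Turn} {i : ℕ} {d : ℤ × ℤ}
    (h : (segDirs σ).reverse[i]? = some d) : i ≤ σ.length ∧ segDir σ (σ.length - i) = d := by
  have h1 := (List.getElem?_eq_some_iff.1 h).1
  rw [List.length_reverse, length_segDirs] at h1
  rw [segDirs_reverse_getElem? σ (by omega)] at h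
  exact ⟨by omega, by simpa using h⟩

theorem isChain_segDirs (σ : List Turn) : (segDirs σ).IsChain Perp := by
  rw [List.isChain_iff_getElem]
  intro i hi
  rw [length_segDirs] at hi
  have := perp_segDir σ (i := i) (by omega)
  simpa [segDirs] using this

theorem isChain_segDirs_reverse (σ : List Turn) : (segDirs σ).reverse.IsChain Perp := by
  rw [List.isChain_reverse, List.isChain_iff_getElem]
  intro i hi
  rw [length_segDirs] at hi
  have := perp_segDir' σ (i := i) (by omega)
  simpa [segDirs] using this

theorem staircaseCount_cons_self {z₁ z₂ : ℤ × ℤ} (h : z₁ = (1, 0)) (h' : z₂ = (0, 1) ∨ z₂ = (0, -1))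
    (l : List (ℤ × ℤ)) : staircaseCount z₁ z₂ (z₁ :: l) = staircaseCount z₁ z₂ l := by
  subst h
  rcases h' with rfl | rfl <;> simp [staircaseCount]

theorem staircaseCount_cons_other {z₁ z₂ : ℤ × ℤ} (h : z₁ = (1, 0))
    (h' : z₂ = (0, 1) ∨ z₂ = (0, -1)) (l : List (ℤ × ℤ)) :
    staircaseCount z₁ z₂ (z₂ :: l) = staircaseCount z₁ z₂ l + 1 := by
  subst h
  rcases h' with rfl | rfl <;> simp [staircaseCount]

theorem staircaseCount_cons_neg {z₁ z₂ d : ℤ × ℤ} (h : d = -z₁ ∨ d = -z₂) (l : List (ℤ × ℤ)) :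
    staircaseCount z₁ z₂ (d :: l) = 0 := by
  unfold staircaseCount
  rw [List.takeWhile_cons_of_neg]
  · rfl
  · rcases h with rfl | rfl <;> simp

/-- Neighbouring segments are perpendicular and the opposite directions end the staircase, so its
two directions must alternate. -/
theorem staircase_alternates {z₁ z₂ : ℤ × ℤ} (h : z₁ = (1, 0)) (h' : z₂ = (0, 1) ∨ z₂ = (0, -1))
    (m : ℕ) : ∀ l : List (ℤ × ℤ), l.IsChain Perp → l.head? = some z₁ →
    m ≤ staircaseCount z₁ z₂ l → ∀ i < m, l[2 * i]? = some z₁ ∧ l[2 * i + 1]? = some z₂ := by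
  have next : ∀ d, Perp z₁ d → d = z₂ ∨ d = -z₁ ∨ d = -z₂ := by
    rintro d ⟨h1, h2⟩
    subst h
    rcases h' with rfl | rfl <;> rcases h1 with rfl | rfl | rfl | rfl <;> simp at h2 ⊢
  have next' : ∀ d, Perp z₂ d → d = z₁ ∨ d = -z₁ ∨ d = -z₂ := by
    rintro d ⟨h1, h2⟩
    subst h
    rcases h' with rfl | rfl <;> rcases h1 with rfl | rfl | rfl | rfl <;> simp at h2 ⊢
  induction m with
  | zero => intro _ _ _ _ i hi; omega
  | succ m ih =>
    intro l hl hh hm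
    match l, hl, hh, hm with
    | [], _, hh, _ => simp at hh
    | [d], _, hh, hm =>
      obtain rfl : d = z₁ := by simpa using hh
      rw [staircaseCount_cons_self h h'] at hm
      simp [staircaseCount] at hm
    | d :: e :: l, hl, hh, hm =>
      obtain rfl : d = z₁ := by simpa using hh
      rw [staircaseCount_cons_self h h'] at hm
      rw [List.isChain_cons_cons] at hl
      rcases next e hl.1 with rfl | he
      · rw [staircaseCount_cons_other h h'] at hm
        intro i hi
        rcases Nat.eq_zero_or_pos i with rfl | hi0
        · simp
        · obtain ⟨k, rfl⟩ : ∃ k, i = k + 1 := ⟨i - 1, by omega⟩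
          match l, hl, hm with
          | [], _, hm => simp [staircaseCount] at hm; omega
          | f :: l, hl, hm =>
            rw [List.isChain_cons_cons] at hl
            rcases next' f hl.2.1 with rfl | hf
            · exact ih (f :: l) hl.2.2 rfl (by omega) k (by omega)
            · rw [staircaseCount_cons_neg hf] at hm; omega
      · rw [staircaseCount_cons_neg he] at hm; omega

theorem mO_spec {s : ℤ} (hs : s = 1 ∨ s = -1) {m : ℕ} (hm : m ≤ mO east (0, s) σ) :
    ∀ i < m, 2 * i + 1 ≤ σ.length ∧ segDir σ (2 * i) = (1, 0) ∧ segDir σ (2 * i + 1) = (0, s) := by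
  intro i hi
  have hh : (segDirs σ).head? = some east := by
    rw [List.head?_eq_getElem?, segDirs_getElem? σ (Nat.zero_le _), segDir_zero]
  obtain ⟨h1, h2⟩ := staircase_alternates rfl (by rcases hs with rfl | rfl <;> simp) m (segDirs σ)
    (isChain_segDirs σ) hh hm i hi
  have h1 := lt_of_segDirs_getElem? h1
  have h2 := lt_of_segDirs_getElem? h2
  exact ⟨h2.1, h1.2, h2.2⟩

theorem mP_spec_east {s : ℤ} (hs : s = 1 ∨ s = -1) {m : ℕ} (hm : m ≤ mP east (0, s) σ)
    (hlast : segDir σ σ.length = (1, 0)) :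
    ∀ i < m, 2 * i + 1 ≤ σ.length ∧ segDir σ (σ.length - 2 * i) = (1, 0) ∧
      segDir σ (σ.length - (2 * i + 1)) = (0, s) := by
  intro i hi
  have hh : (segDirs σ).reverse.head? = some east := by
    rw [List.head?_eq_getElem?, segDirs_reverse_getElem? σ (Nat.zero_le _), Nat.sub_zero, hlast]
    rfl
  obtain ⟨h1, h2⟩ := staircase_alternates rfl (by rcases hs with rfl | rfl <;> simp) m
    (segDirs σ).reverse (isChain_segDirs_reverse σ) hh hm i hi
  have h1 := lt_of_segDirs_reverse_getElem? h1
  have h2 := lt_of_segDirs_reverse_getElem? h2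
  exact ⟨h2.1, h1.2, h2.2⟩

/-- A staircase beginning with a vertical segment has only m - 1 guaranteed east segments between
its m vertical ones. -/
theorem mP_spec_vert {s : ℤ} (hs : s = 1 ∨ s = -1) {m : ℕ} (hm : m ≤ mP east (0, s) σ)
    (hlast : segDir σ σ.length = (0, s)) :
    (∀ i < m, 2 * i ≤ σ.length ∧ segDir σ (σ.length - 2 * i) = (0, s)) ∧
    ∀ i, i + 1 < m → segDir σ (σ.length - 2 * i - 1) = (1, 0) := by
  have hh : (segDirs σ).reverse[0]? = some (0, s) := by
    rw [segDirs_reverse_getElem? σ (Nat.zero_le _), Nat.sub_zero, hlast]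
  have hs' : ((0 : ℤ), s) = (0, 1) ∨ ((0 : ℤ), s) = (0, -1) := by rcases hs with rfl | rfl <;> simp
  have hE : east = (1, 0) := rfl
  have hc := isChain_segDirs_reverse σ
  have key : ∀ i, i + 1 < m → (segDirs σ).reverse[2 * i + 1]? = some east ∧
      (segDirs σ).reverse[2 * i + 2]? = some (0, s) := by
    unfold mP at hm
    generalize (segDirs σ).reverse = l at *
    match l, hh, hc, hm with
    | d :: l, hh, hc, hm =>
      obtain rfl : d = (0, s) := by simpa using hh
      rw [staircaseCount_cons_other hE hs'] at hm
      match l, hc, hm with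
      | [], _, hm => simp [staircaseCount] at hm; intro i hi; omega
      | e :: l, hc, hm =>
        rw [List.isChain_cons_cons] at hc
        have : e = east ∨ e = -east ∨ e = -(0, s) := by
          obtain ⟨h1, h2⟩ := hc.1
          rcases hs with rfl | rfl <;> rcases h1 with rfl | rfl | rfl | rfl <;> simp [east] at h2 ⊢
        rcases this with rfl | he
        · intro i hi
          exact staircase_alternates hE hs' (m - 1) (east :: l) hc.2 rfl (by omega) i (by omega)
        · rw [staircaseCount_cons_neg he] at hm
          intro i hi; omega
  constructor
  · intro i hi
    rcases Nat.eq_zero_or_pos i with rfl | hi0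
    · simpa using hlast
    · obtain ⟨k, rfl⟩ : ∃ k, i = k + 1 := ⟨i - 1, by omega⟩
      exact lt_of_segDirs_reverse_getElem? (key k hi).2
  · intro i hi
    exact (lt_of_segDirs_reverse_getElem? (key i hi).1).2

/-! ### Lower bounds -/

theorem segDir_one_vertical (h : 0 < σ.length) :
    segDir σ 1 = (0, 1) ∨ segDir σ 1 = (0, -1) := by
  rw [segDir_succ σ h, segDir_zero]
  cases σ[0] <;> simp [Turn.rotate, east]

theorem Realizes.onSeg_end (h : Realizes v σ) {i : ℕ} (hi : i ≤ σ.length) :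
    OnSeg v σ i (v (i + 1)) := ⟨segLen v i, le_rfl, h.next hi⟩

theorem Realizes.one_lt_length (h : Realizes v σ) (hσ : 0 < σ.length)
    (hrow : (v (σ.length + 1)).2 = 0) : 1 < σ.length := by
  by_contra hc
  have h1 : σ.length = 1 := by omega
  have e0 := h.east_seg (i := 0) (by omega) (segDir_zero σ)
  have e1 : ∃ s, (s = 1 ∨ s = -1) ∧ segDir σ 1 = (0, s) := by
    rcases segDir_one_vertical hσ with e | e
    · exact ⟨1, by simp, e⟩
    · exact ⟨-1, by simp, e⟩
  obtain ⟨s, hs, e1⟩ := e1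
  have e2 := h.vert_seg (i := 1) (by omega) e1
  have l1 := h.segLen_pos (i := 1) (by omega)
  rw [h1] at hrow
  simp only [zero_add, h.start] at e0
  rw [e0.2, show v (1 + 1) = v 2 from rfl] at e2
  rw [show v (1 + 1) = v 2 from rfl] at hrow
  rcases hs with rfl | rfl <;> omega

theorem Realizes.first_lt (h : Realizes v σ) (hσ : 0 < σ.length)
    {a : ℤ} (ha : 0 < a) (hend : v (σ.length + 1) = (a, 0)) : 1 ≤ (v 1).1 ∧ (v 1).1 < a := by
  have hn := h.one_lt_length hσ (by rw [hend])
  have e0 := h.east_seg (i := 0) (by omega) (segDir_zero σ)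
  have l0 := h.segLen_pos (i := 0) (by omega)
  simp only [zero_add, h.start] at e0
  refine ⟨by omega, ?_⟩
  by_contra hc
  have q1 := h.onSeg_east (i := 0) (by omega) (segDir_zero σ) (x := a)
    (by rw [h.start]; exact ha.le) (by simpa using hc)
  have q2 := h.onSeg_end (i := σ.length) le_rfl
  rw [hend] at q2
  rw [h.start] at q1
  exact h.not_onSeg (by omega) le_rfl q1 q2

/-- The first and last segments both lie on the x-axis and are disjoint, so the first bend is left
of the last bend, which replaces the endpoint in the turning argument. -/
theorem Realizes.last_east (h : Realizes v σ) (hσ : 0 < σ.length)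
    {a : ℤ} (ha : 0 < a) (hend : v (σ.length + 1) = (a, 0))
    (hlast : segDir σ σ.length = (1, 0)) :
    ∃ N, σ.length = N + 1 ∧ 1 < N ∧ (v (N + 1)).2 = 0 ∧ (v 1).1 < (v (N + 1)).1 ∧
      (v (N + 1)).1 + 1 ≤ a ∧
      (segDir σ N = (0, 1) ∨ segDir σ N = (0, -1)) := by
  have hn := h.one_lt_length hσ (by rw [hend])
  obtain ⟨N, hN⟩ : ∃ N, σ.length = N + 1 := ⟨σ.length - 1, by omega⟩
  have e1 := h.east_seg le_rfl hlast
  have l1 := h.segLen_pos (i := σ.length) le_rfl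
  have e0 := h.east_seg (i := 0) (by omega) (segDir_zero σ)
  simp only [zero_add, h.start] at e0
  rw [hend] at e1
  have hlt : (v 1).1 < (v (N + 1)).1 := by
    by_contra hc
    have q1 := h.onSeg_east (i := 0) (by omega) (segDir_zero σ)
      (x := max 0 (v (N + 1)).1) (by rw [h.start]; exact le_max_left _ _)
      (by rw [zero_add]; omega)
    have q2 := h.onSeg_east le_rfl hlast (x := max 0 (v (N + 1)).1)
      (by rw [hN]; omega) (by rw [hend]; rw [hN] at e1; simp only at e1 ⊢; omega)
    rw [h.start] at q1
    rw [← e1.2] at q2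
    exact h.not_onSeg (by omega) le_rfl q1 q2
  have hdir : segDir σ N = (0, 1) ∨ segDir σ N = (0, -1) := by
    obtain ⟨h1, h2⟩ := perp_segDir' σ (i := N) (by omega)
    rw [← hN, hlast] at h2
    rcases h1 with h1 | h1 | h1 | h1 <;> rw [h1] at h2 <;> simp at h2
    · exact Or.inl h1
    · exact Or.inr h1
  rw [hN] at e1
  refine ⟨N, hN, ?_, e1.2.symm, hlt, ?_, hdir⟩
  · by_contra hc
    have hN1 : N = 1 := by omega
    subst hN1
    have e2 : ∃ s, (s = 1 ∨ s = -1) ∧ segDir σ 1 = (0, s) := by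
      rcases segDir_one_vertical hσ with e | e
      · exact ⟨1, by simp, e⟩
      · exact ⟨-1, by simp, e⟩
    obtain ⟨s, hs, e2⟩ := e2
    have e3 := h.vert_seg (i := 1) (by omega) e2
    omega
  · simp only at e1
    rw [hN] at l1
    omega

/-- The arc starts at the first bend, at abscissa at least 1; hence the additional unit. -/
theorem Realizes.bound_of_last_not_east (h : Realizes v σ) (hσ : 0 < σ.length)
    {a : ℤ} (ha : 0 < a) (hend : v (σ.length + 1) = (a, 0))
    (hlast : segDir σ σ.length ≠ (1, 0)) :
    ∃ e j : ℤ, -j ≤ e ∧ e ≤ j ∧ 2 ∣ j - e ∧ 1 ≤ j ∧ j + 1 ≤ a ∧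
      net σ - net (σ.take 1) =
        4 * e + dirOffset (segDir σ σ.length) - dirOffset (segDir σ 1) := by
  have hn := h.one_lt_length hσ (by rw [hend])
  obtain ⟨f1, f2⟩ := h.first_lt hσ ha hend
  have e0 := h.east_seg (i := 0) (by omega) (segDir_zero σ)
  simp only [zero_add, h.start] at e0
  have l1 := h.segLen_pos (i := 1) hn.le
  have ln := h.segLen_pos (i := σ.length) le_rfl
  obtain ⟨e, j, p1, p2, p3, p4, p5, p6⟩ := h.turning_of_subarc (i₀ := 1) (i₁ := σ.length)
    (t₀ := 0) (t₁ := segLen v σ.length - 1) (x₀ := (v 1).1) (x₁ := a) (r := 0) hn le_rfl l1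
    (by omega) (by ext <;> simp [e0.2])
    (by rw [← hend, h.next le_rfl]; congr 2; omega) f2 (segDir_one_vertical hσ)
    (by
      rcases isDir_segDir σ σ.length with h | h | h | h
      · exact absurd h hlast
      · exact Or.inl h
      · exact Or.inr (Or.inr h)
      · exact Or.inr (Or.inl h))
  rw [net_take_length] at p6
  exact ⟨e, j, p1, p2, p3, p4, by omega, p6⟩

theorem Realizes.bound_of_last_east (h : Realizes v σ) (hσ : 0 < σ.length)
    {a : ℤ} (ha : 0 < a) (hend : v (σ.length + 1) = (a, 0))
    (hlast : segDir σ σ.length = (1, 0)) :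
    ∃ N, σ.length = N + 1 ∧ (segDir σ N = (0, 1) ∨ segDir σ N = (0, -1)) ∧
    ∃ e j : ℤ, -j ≤ e ∧ e ≤ j ∧ 2 ∣ j - e ∧ 1 ≤ j ∧ j + 2 ≤ a ∧
      net (σ.take N) - net (σ.take 1) =
        4 * e + dirOffset (segDir σ N) - dirOffset (segDir σ 1) := by
  obtain ⟨N, hN, hN1, hr, hlt, hz, hdir⟩ := h.last_east hσ ha hend hlast
  obtain ⟨f1, f2⟩ := h.first_lt hσ ha hend
  have e0 := h.east_seg (i := 0) (by omega) (segDir_zero σ)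
  simp only [zero_add, h.start] at e0
  have l1 := h.segLen_pos (i := 1) (by omega)
  have ln := h.segLen_pos (i := N) (by omega)
  obtain ⟨e, j, p1, p2, p3, p4, p5, p6⟩ := h.turning_of_subarc (i₀ := 1) (i₁ := N)
    (t₀ := 0) (t₁ := segLen v N - 1) (x₀ := (v 1).1) (x₁ := (v (N + 1)).1) (r := 0) hN1
    (by omega) l1 (by omega) (by ext <;> simp [e0.2])
    (by
      rw [show segLen v N - 1 + 1 = segLen v N by omega, ← h.next (by omega)]
      exact Prod.ext rfl hr) hlt (segDir_one_vertical hσ)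
    (hdir.imp id Or.inl)
  exact ⟨N, hN, hdir, e, j, p1, p2, p3, p4, by omega, p6⟩

theorem Realizes.staircase_bound_of_last_vertical (h : Realizes v σ) {s : ℤ}
    (hs : s = 1 ∨ s = -1) {a : ℤ} (ha : 0 < a) (hend : v (σ.length + 1) = (a, 0))
    (hlast : segDir σ σ.length = (0, -s)) {m : ℕ} (hm : 0 < m) (hO : m ≤ mO east (0, s) σ)
    (hP : m ≤ mP east (0, -s) σ) :
    ∃ e j : ℤ, -j ≤ e ∧ e ≤ j ∧ 2 ∣ j - e ∧ 1 ≤ j ∧ m + j ≤ a ∧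
      net σ - net (σ.take 1) = 4 * e + 2 * s := by
  have hO := mO_spec hs hO
  have hP := mP_spec_vert (by rcases hs with rfl | rfl <;> simp) hP hlast
  have hσ : 0 < σ.length := by have := (hO 0 hm).1; omega
  have := h.staircase_bound hs hm le_rfl hO hP.1 hP.2 (by rw [hend])
    (by rw [hend]; exact (h.first_lt hσ ha hend).2)
  rw [hend, net_take_length] at this
  exact this

/-- The final eastward segment costs one unit, and the turn into it, from (0, -s), contributes s to
the net turning. -/
theorem Realizes.staircase_bound_of_last_east (h : Realizes v σ) {s : ℤ}
    (hs : s = 1 ∨ s = -1) {a : ℤ} (ha : 0 < a) (hend : v (σ.length + 1) = (a, 0))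
    (hlast : segDir σ σ.length = (1, 0)) {m : ℕ} (hm : 0 < m) (hO : m ≤ mO east (0, s) σ)
    (hP : m ≤ mP east (0, -s) σ) :
    ∃ e j : ℤ, -j ≤ e ∧ e ≤ j ∧ 2 ∣ j - e ∧ 1 ≤ j ∧ m + j + 1 ≤ a ∧
      net σ - s - net (σ.take 1) = 4 * e + 2 * s := by
  have hO := mO_spec hs hO
  have hP := mP_spec_east (by rcases hs with rfl | rfl <;> simp) hP hlast
  have hσ : 0 < σ.length := by have := (hO 0 hm).1; omega
  obtain ⟨N, hN, hN1, hr, hlt, hz, hdir⟩ := h.last_east hσ ha hend hlast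
  obtain ⟨e, j, p1, p2, p3, p4, p5, p6⟩ := h.staircase_bound hs hm (N := N) (by omega) hO
    (fun j hj => by
      obtain ⟨h1, -, h2⟩ := hP j hj
      refine ⟨by omega, ?_⟩
      rw [← h2]; congr 1; omega)
    (fun j hj => by
      obtain ⟨h1, h2, -⟩ := hP (j + 1) hj
      rw [← h2]; congr 1; omega) hr hlt
  refine ⟨e, j, p1, p2, p3, p4, by omega, ?_⟩
  have c := cross_segDir σ (i := N) (by omega)
  have hN' := (hP 0 hm).2.2
  rw [hN, show N + 1 - (2 * 0 + 1) = N by omega] at hN'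
  rw [← hN, hlast, hN', net_take_length] at c
  simp [cross] at c
  omega

theorem net_take_one_of_head {t : Turn} (h : σ.head? = some t) :
    0 < σ.length ∧ (t = L → net (σ.take 1) = 1 ∧ segDir σ 1 = (0, 1)) ∧
      (t = R → net (σ.take 1) = -1 ∧ segDir σ 1 = (0, -1)) := by
  cases σ with
  | nil => simp at h
  | cons u σ =>
    obtain rfl : u = t := by simpa using h
    refine ⟨by simp, ?_, ?_⟩ <;> rintro rfl <;> simp [segDir, Turn.rotate, east]

/-- The lower bounds for the abscissa of a reachable point of the positive `x`-axis. -/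
theorem Realizes.lower_bounds (h : Realizes v σ) {a : ℤ} (ha : 0 < a)
    (hend : v (σ.length + 1) = (a, 0)) :
    (net σ % 4 = 1 →
      (σ.head? = some R → min (mO east south σ : ℤ) (mP east north σ) + (net σ + 2) / 4 + 1 ≤ a) ∧
      (σ.head? = some L → 0 ≤ net σ → |(net σ + 2) / 4 - 1| + 2 ≤ a)) ∧
    (net σ % 4 = 3 →
      (σ.head? = some L → 0 ≤ net σ →
        min (mO east north σ : ℤ) (mP east south σ) + |(net σ + 2) / 4 - 2| + 1 ≤ a) ∧
      (σ.head? = some R → (net σ + 2) / 4 + 1 ≤ a)) ∧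
    (net σ % 4 = 2 →
      (σ.head? = some L → 0 ≤ net σ → |(net σ + 2) / 4 - 2| + 2 ≤ a) ∧
      (σ.head? = some R → (net σ + 2) / 4 + 1 ≤ a)) ∧
    (net σ % 4 = 0 →
      (8 ≤ net σ → σ.head? = some L →
        min (min (mO east north σ : ℤ) (mP east south σ)) 2 + (net σ + 2) / 4 ≤ a) ∧
      (8 ≤ net σ → σ.head? = some R → (net σ + 2) / 4 + 2 ≤ a) ∧
      (net σ = 0 → σ.head? = some L →
        min (min (mO east north σ : ℤ) (mP east south σ)) 2 + 2 ≤ a) ∧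
      (net σ = 0 → σ.head? = some R →
        min (min (mO east south σ : ℤ) (mP east north σ)) 2 + 2 ≤ a) ∧
      (net σ = 4 → 3 ≤ a)) := by
  have hdir := segDir_eq_of_net σ σ.length
  rw [net_take_length] at hdir
  have basic := fun hσ hne => h.bound_of_last_not_east hσ ha hend hne
  have basicE := fun hσ hE => h.bound_of_last_east hσ ha hend hE
  refine ⟨fun hT => ?_, fun hT => ?_, fun hT => ?_, fun hT => ?_⟩
  · have hl : segDir σ σ.length = (0, 1) := by
      rcases hdir with h | h | h | h
      · omega
      · exact h.2
      · omega
      · omega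
    refine ⟨fun hh => ?_, fun hh h0 => ?_⟩
    · obtain ⟨hσ, -, h1⟩ := net_take_one_of_head hh
      obtain ⟨h1, h2⟩ := h1 rfl
      obtain ⟨e, j, p1, p2, p3, p4, p5, p6⟩ := basic hσ (by rw [hl]; simp)
      rw [hl, h2, h1] at p6
      simp [dirOffset] at p6
      rcases Nat.eq_zero_or_pos (min (mO east south σ) (mP east north σ)) with hm | hm
      · omega
      · obtain ⟨e, j, q1, q2, q3, q4, q5, q6⟩ := h.staircase_bound_of_last_vertical (s := -1)
          (Or.inr rfl) ha hend (by simpa using hl) hm (min_le_left _ _)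
          (min_le_right (mO east south σ) (mP east north σ))
        push_cast at q5
        omega
    · obtain ⟨hσ, h1, -⟩ := net_take_one_of_head hh
      obtain ⟨h1, h2⟩ := h1 rfl
      obtain ⟨e, j, p1, p2, p3, p4, p5, p6⟩ := basic hσ (by rw [hl]; simp)
      rw [hl, h2, h1] at p6
      simp [dirOffset] at p6
      -- Here net σ = 4e + 1. For e = 0, parity together with j ≥ 1 gives j ≥ 2, matching the
      -- absolute value.
      rw [abs_eq_max_neg]
      omega
  · have hl : segDir σ σ.length = (0, -1) := by
      rcases hdir with h | h | h | h
      · omega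
      · omega
      · omega
      · exact h.2
    refine ⟨fun hh h0 => ?_, fun hh => ?_⟩
    · obtain ⟨hσ, h1, -⟩ := net_take_one_of_head hh
      obtain ⟨h1, h2⟩ := h1 rfl
      obtain ⟨e, j, p1, p2, p3, p4, p5, p6⟩ := basic hσ (by rw [hl]; simp)
      rw [hl, h2, h1] at p6
      simp [dirOffset] at p6
      rw [abs_eq_max_neg]
      rcases Nat.eq_zero_or_pos (min (mO east north σ) (mP east south σ)) with hm | hm
      · omega
      · obtain ⟨e, j, q1, q2, q3, q4, q5, q6⟩ := h.staircase_bound_of_last_vertical (s := 1)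
          (Or.inl rfl) ha hend hl hm (min_le_left _ _)
          (min_le_right (mO east north σ) (mP east south σ))
        push_cast at q5
        omega
    · obtain ⟨hσ, -, h1⟩ := net_take_one_of_head hh
      obtain ⟨h1, h2⟩ := h1 rfl
      obtain ⟨e, j, p1, p2, p3, p4, p5, p6⟩ := basic hσ (by rw [hl]; simp)
      rw [hl, h2, h1] at p6
      simp [dirOffset] at p6
      omega
  · have hl : segDir σ σ.length = (-1, 0) := by
      rcases hdir with h | h | h | h
      · omega
      · omega
      · exact h.2
      · omega
    refine ⟨fun hh h0 => ?_, fun hh => ?_⟩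
    · obtain ⟨hσ, h1, -⟩ := net_take_one_of_head hh
      obtain ⟨h1, h2⟩ := h1 rfl
      obtain ⟨e, j, p1, p2, p3, p4, p5, p6⟩ := basic hσ (by rw [hl]; simp)
      rw [hl, h2, h1] at p6
      simp [dirOffset] at p6
      rw [abs_eq_max_neg]
      omega
    · obtain ⟨hσ, -, h1⟩ := net_take_one_of_head hh
      obtain ⟨h1, h2⟩ := h1 rfl
      obtain ⟨e, j, p1, p2, p3, p4, p5, p6⟩ := basic hσ (by rw [hl]; simp)
      rw [hl, h2, h1] at p6
      simp [dirOffset] at p6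
      omega
  · have hl : segDir σ σ.length = (1, 0) := by
      rcases hdir with h | h | h | h
      · exact h.2
      · omega
      · omega
      · omega
    -- The two values correspond to a penultimate segment heading north or south; a nonempty pair of
    -- staircases selects the one in `stairL`.
    have headL : σ.head? = some L →
        ∃ e j : ℤ, -j ≤ e ∧ e ≤ j ∧ 2 ∣ j - e ∧ 1 ≤ j ∧ j + 2 ≤ a ∧
          (net σ = 4 * e ∨ net σ = 4 * e + 4) := by
      intro hh
      obtain ⟨hσ, h1, -⟩ := net_take_one_of_head hh
      obtain ⟨h1, h2⟩ := h1 rfl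
      obtain ⟨N, hN, hd, e, j, p1, p2, p3, p4, p5, p6⟩ := basicE hσ hl
      refine ⟨e, j, p1, p2, p3, p4, p5, ?_⟩
      have c := cross_segDir σ (i := N) (by omega)
      rw [← hN, hl, net_take_length] at c
      rw [h2, h1] at p6
      rcases hd with hd | hd <;> rw [hd] at p6 c <;> simp [dirOffset, cross] at p6 c <;> omega
    have headR : σ.head? = some R →
        ∃ e j : ℤ, -j ≤ e ∧ e ≤ j ∧ 2 ∣ j - e ∧ 1 ≤ j ∧ j + 2 ≤ a ∧
          (net σ = 4 * e ∨ net σ = 4 * e - 4) := by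
      intro hh
      obtain ⟨hσ, -, h1⟩ := net_take_one_of_head hh
      obtain ⟨h1, h2⟩ := h1 rfl
      obtain ⟨N, hN, hd, e, j, p1, p2, p3, p4, p5, p6⟩ := basicE hσ hl
      refine ⟨e, j, p1, p2, p3, p4, p5, ?_⟩
      have c := cross_segDir σ (i := N) (by omega)
      rw [← hN, hl, net_take_length] at c
      rw [h2, h1] at p6
      rcases hd with hd | hd <;> rw [hd] at p6 c <;> simp [dirOffset, cross] at p6 c <;> omega
    have stairL : σ.head? = some L → 0 < min (mO east north σ) (mP east south σ) →
        ∃ e j : ℤ, -j ≤ e ∧ e ≤ j ∧ 2 ∣ j - e ∧ 1 ≤ j ∧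
          min (mO east north σ : ℤ) (mP east south σ) + j + 1 ≤ a ∧ net σ = 4 * e + 4 := by
      intro hh hm
      obtain ⟨hσ, h1, -⟩ := net_take_one_of_head hh
      obtain ⟨e, j, q1, q2, q3, q4, q5, q6⟩ := h.staircase_bound_of_last_east (s := 1)
        (Or.inl rfl) ha hend hl hm (min_le_left _ _)
        (min_le_right (mO east north σ) (mP east south σ))
      push_cast at q5
      exact ⟨e, j, q1, q2, q3, q4, q5, by have := (h1 rfl).1; omega⟩
    have stairR : σ.head? = some R → 0 < min (mO east south σ) (mP east north σ) →
        ∃ e j : ℤ, -j ≤ e ∧ e ≤ j ∧ 2 ∣ j - e ∧ 1 ≤ j ∧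
          min (mO east south σ : ℤ) (mP east north σ) + j + 1 ≤ a ∧ net σ = 4 * e - 4 := by
      intro hh hm
      obtain ⟨hσ, -, h1⟩ := net_take_one_of_head hh
      obtain ⟨e, j, q1, q2, q3, q4, q5, q6⟩ := h.staircase_bound_of_last_east (s := -1)
        (Or.inr rfl) ha hend hl hm (min_le_left _ _)
        (min_le_right (mO east south σ) (mP east north σ))
      push_cast at q5
      exact ⟨e, j, q1, q2, q3, q4, q5, by have := (h1 rfl).1; omega⟩
    refine ⟨fun h8 hh => ?_, fun h8 hh => ?_, fun h0 hh => ?_, fun h0 hh => ?_, fun h4 => ?_⟩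
    · obtain ⟨e, j, p1, p2, p3, p4, p5, p6⟩ := headL hh
      rcases Nat.eq_zero_or_pos (min (mO east north σ) (mP east south σ)) with hm | hm
      · omega
      · obtain ⟨e, j, p1, p2, p3, p4, p5, p6⟩ := stairL hh hm
        omega
    · obtain ⟨e, j, p1, p2, p3, p4, p5, p6⟩ := headR hh
      omega
    · obtain ⟨e, j, p1, p2, p3, p4, p5, p6⟩ := headL hh
      rcases Nat.eq_zero_or_pos (min (mO east north σ) (mP east south σ)) with hm | hm
      · omega
      · obtain ⟨e, j, p1, p2, p3, p4, p5, p6⟩ := stairL hh hm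
        omega
    · obtain ⟨e, j, p1, p2, p3, p4, p5, p6⟩ := headR hh
      rcases Nat.eq_zero_or_pos (min (mO east south σ) (mP east north σ)) with hm | hm
      · omega
      · obtain ⟨e, j, p1, p2, p3, p4, p5, p6⟩ := stairR hh hm
        omega
    · rcases hhead : σ.head? with _ | t
      · have : σ = [] := by simpa using hhead
        subst this
        simp at h4
      · cases t
        · obtain ⟨e, j, p1, p2, p3, p4, p5, p6⟩ := headL hhead
          omega
        · obtain ⟨e, j, p1, p2, p3, p4, p5, p6⟩ := headR hhead
          omega

end

/-! ### Unit-step walks and realizations -/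

/-- `Walk σ d q q' pts`: a lattice path of unit steps starts at `q` in direction `d`, makes the
turns `σ`, ends at `q'`, and visits the points `pts` after its starting point. -/
inductive Walk : List Turn → ℤ × ℤ → ℤ × ℤ → ℤ × ℤ → List (ℤ × ℤ) → Prop
  | one (d q : ℤ × ℤ) : Walk [] d q (q + d) [q + d]
  | straight {σ : List Turn} {d q q' : ℤ × ℤ} {pts : List (ℤ × ℤ)} :
      Walk σ d (q + d) q' pts → Walk σ d q q' ((q + d) :: pts)
  | turn {σ : List Turn} {d q q' : ℤ × ℤ} {pts : List (ℤ × ℤ)} (t : Turn) :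
      Walk σ (t.rotate d) (q + d) q' pts → Walk (t :: σ) d q q' ((q + d) :: pts)

/-- The direction reached from direction `d` after the turns `σ`. -/
def dirAfter (σ : List Turn) (d : ℤ × ℤ) : ℤ × ℤ := σ.foldl (fun d t => t.rotate d) d

theorem Walk.append {σ τ : List Turn} {d q q₁ q₂ : ℤ × ℤ} {pts pts' : List (ℤ × ℤ)}
    (h : Walk σ d q q₁ pts) (h' : Walk τ (dirAfter σ d) q₁ q₂ pts') :
    Walk (σ ++ τ) d q q₂ (pts ++ pts') := by
  induction h with
  | one d q => exact Walk.straight h'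
  | straight _ ih => exact Walk.straight (ih h')
  | turn t _ ih => exact Walk.turn t (ih h')

theorem Walk.append_turn {σ τ : List Turn} {d q q₁ q₂ : ℤ × ℤ} {pts pts' : List (ℤ × ℤ)}
    (h : Walk σ d q q₁ pts) (t : Turn) (h' : Walk τ (t.rotate (dirAfter σ d)) q₁ q₂ pts') :
    Walk (σ ++ t :: τ) d q q₂ (pts ++ pts') := by
  induction h with
  | one d q => exact Walk.turn t h'
  | straight _ ih => exact Walk.straight (ih h')
  | turn u _ ih => exact Walk.turn u (ih h')

theorem Walk.map {σ : List Turn} {d q q' : ℤ × ℤ} {pts : List (ℤ × ℤ)} (h : Walk σ d q q' pts)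
    (f A : ℤ × ℤ → ℤ × ℤ) (τ : Turn → Turn) (hf : ∀ q d, f (q + d) = f q + A d)
    (hA : ∀ t d, A (Turn.rotate t d) = (τ t).rotate (A d)) :
    Walk (σ.map τ) (A d) (f q) (f q') (pts.map f) := by
  induction h with
  | one d q =>
    simp only [List.map_cons, List.map_nil, hf]
    exact Walk.one _ _
  | straight _ ih =>
    simp only [List.map_cons, hf] at ih ⊢
    exact Walk.straight ih
  | turn t _ ih =>
    simp only [List.map_cons, hf, hA] at ih ⊢
    exact Walk.turn _ ih

/-- Runs of straight steps are merged into segments. The last clause, that later segments avoid the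
starting point, strengthens the induction: prepending a turn makes that point the first bend, which
all but the next segment must avoid. -/
theorem Walk.exists_vertices {σ : List Turn} {d q q' : ℤ × ℤ} {pts : List (ℤ × ℤ)}
    (h : Walk σ d q q' pts) (hn : (q :: pts).Nodup) :
    ∃ (v : ℕ → ℤ × ℤ) (k : ℕ → ℕ), v 0 = q ∧ v (σ.length + 1) = q' ∧
      (∀ i ≤ σ.length, 0 < k i ∧ v (i + 1) = v i + k i • dirAfter (σ.take i) d) ∧
      (∀ i ≤ σ.length, ∀ t ≤ k i, v i + t • dirAfter (σ.take i) d ∈ q :: pts) ∧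
      (∀ i j, i + 1 < j → j ≤ σ.length → ∀ s ≤ k i, ∀ t ≤ k j,
        v i + s • dirAfter (σ.take i) d ≠ v j + t • dirAfter (σ.take j) d) ∧
      (∀ j, 0 < j → j ≤ σ.length → ∀ t ≤ k j, v j + t • dirAfter (σ.take j) d ≠ q) := by
  induction h with
  | one d q =>
    refine ⟨fun i => if i = 0 then q else q + d, fun _ => 1, rfl, rfl, ?_, ?_, ?_, ?_⟩
    · intro i hi
      obtain rfl : i = 0 := by simpa using hi
      simp [dirAfter]
    · intro i hi t ht
      obtain rfl : i = 0 := by simpa using hi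
      rcases Nat.le_one_iff_eq_zero_or_eq_one.1 ht with rfl | rfl <;> simp [dirAfter]
    · intro i j hij hj
      simp at hj
      omega
    · intro j hj hj'
      simp at hj'
      omega
  | @straight σ d q q' pts _ ih =>
    rw [List.nodup_cons] at hn
    obtain ⟨v, k, h0, h1, h2, h3, h4, h5⟩ := ih hn.2
    have pt : ∀ i ≤ σ.length, ∀ t ≤ (if i = 0 then k 0 + 1 else k i),
        ((if i = 0 then q else v i) + t • dirAfter (σ.take i) d = q ∧ i = 0) ∨
        ∃ s ≤ k i, (if i = 0 then q else v i) + t • dirAfter (σ.take i) d =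
          v i + s • dirAfter (σ.take i) d := by
      intro i hi t ht
      rcases Nat.eq_zero_or_pos i with rfl | hi0
      · rcases Nat.eq_zero_or_pos t with rfl | ht0
        · simp
        · refine Or.inr ⟨t - 1, by simp at ht; omega, ?_⟩
          obtain ⟨s, rfl⟩ : ∃ s, t = s + 1 := ⟨t - 1, by omega⟩
          simp only [if_true, h0, Nat.add_sub_cancel, succ_nsmul, dirAfter, List.take_zero, List.foldl_nil]
          rw [add_assoc, add_comm d]
      · simp only [hi0.ne', if_false] at ht ⊢
        exact Or.inr ⟨t, ht, rfl⟩
    refine ⟨fun i => if i = 0 then q else v i, fun i => if i = 0 then k 0 + 1 else k i,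
      rfl, by simpa using h1, ?_, ?_, ?_, ?_⟩
    · intro i hi
      rcases Nat.eq_zero_or_pos i with rfl | hi0
      · have := h2 0 hi
        simp only [zero_add, h0, dirAfter, List.take_zero, List.foldl_nil] at this
        simp only [dirAfter, zero_add, one_ne_zero, if_true, if_false, this, List.take_zero,
          List.foldl_nil]
        refine ⟨by omega, ?_⟩
        rw [succ_nsmul]; abel
      · simpa [hi0.ne'] using h2 i hi
    · intro i hi t ht
      rcases pt i hi t ht with h | ⟨s, hs, h⟩
      · rw [h.1]; simp
      · rw [h]; exact List.mem_cons_of_mem _ (h3 i hi s hs)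
    · intro i j hij hj s hs t ht he
      rcases pt j hj t ht with h | ⟨t', ht', h⟩
      · omega
      · rw [h] at he
        rcases pt i (by omega) s hs with h' | ⟨s', hs', h'⟩
        · rw [h'.1] at he
          exact hn.1 (he ▸ h3 j hj t' ht')
        · rw [h'] at he
          exact h4 i j hij hj s' hs' t' ht' he
    · intro j hj0 hj t ht he
      rcases pt j hj t ht with h | ⟨t', ht', h⟩
      · omega
      · rw [h] at he
        exact hn.1 (he ▸ h3 j hj t' ht')
  | @turn σ d q q' pts u _ ih =>
    rw [List.nodup_cons] at hn
    obtain ⟨v, k, h0, h1, h2, h3, h4, h5⟩ := ih hn.2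
    have hd : ∀ i, dirAfter ((u :: σ).take (i + 1)) d = dirAfter (σ.take i) (u.rotate d) :=
      fun i => by simp [dirAfter]
    have hd0 : dirAfter ((u :: σ).take 0) d = d := rfl
    refine ⟨fun i => if i = 0 then q else v (i - 1), fun i => if i = 0 then 1 else k (i - 1),
      rfl, by simpa using h1, ?_, ?_, ?_, ?_⟩
    · intro i hi
      cases i with
      | zero =>
        rw [hd0]
        simp [h0]
      | succ i => rw [hd]; simpa using h2 i (by simpa using hi)
    · intro i hi t ht
      cases i with
      | zero =>
        rw [hd0]
        rcases Nat.le_one_iff_eq_zero_or_eq_one.1 ht with rfl | rfl <;> simp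
      | succ i =>
        rw [hd]
        exact List.mem_cons_of_mem _ (h3 i (by simpa using hi) t (by simpa using ht))
    · intro i j hij hj s hs t ht
      obtain ⟨j, rfl⟩ : ∃ j', j = j' + 1 := ⟨j - 1, by omega⟩
      have hj' : j ≤ σ.length := by simpa using hj
      have ht' : t ≤ k j := by simpa using ht
      rw [hd]
      cases i with
      | zero =>
        rw [hd0]
        intro he
        simp only [Nat.add_eq_zero_iff, one_ne_zero, and_false, if_false, if_true,
          Nat.add_sub_cancel] at he
        rcases Nat.le_one_iff_eq_zero_or_eq_one.1 hs with rfl | rfl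
        · rw [zero_smul, add_zero] at he
          exact hn.1 (he ▸ h3 j hj' t ht')
        · rw [one_smul] at he
          obtain ⟨j, rfl⟩ : ∃ j', j = j' + 1 := ⟨j - 1, by omega⟩
          rcases Nat.eq_zero_or_pos j with rfl | hj0
          · exact h5 1 one_pos hj' t ht' he.symm
          · refine h4 0 (j + 1) (by omega) hj' 0 (by omega) t ht' ?_
            rw [h0, zero_smul, add_zero, he]
      | succ i =>
        rw [hd]
        simpa using h4 i j (by omega) hj' s (by simpa using hs) t ht'
    · intro j hj0 hj t ht he
      obtain ⟨j, rfl⟩ : ∃ j', j = j' + 1 := ⟨j - 1, by omega⟩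
      rw [hd] at he
      exact hn.1 (he ▸ h3 j (by simpa using hj) t (by simpa using ht))

theorem onSeg_of_box {p q d x : ℤ × ℤ} {k : ℕ} (hd : IsDir d) (hq : q = p + k • d)
    (h1 : min p.1 q.1 ≤ x.1) (h2 : x.1 ≤ max p.1 q.1) (h3 : min p.2 q.2 ≤ x.2)
    (h4 : x.2 ≤ max p.2 q.2) : ∃ t ≤ k, x = p + t • d := by
  subst hq
  obtain ⟨a, b⟩ := p
  obtain ⟨c, e⟩ := x
  rcases hd with rfl | rfl | rfl | rfl <;> simp at h1 h2 h3 h4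
  · exact ⟨(c - a).toNat, by omega, by simp; omega⟩
  · exact ⟨(e - b).toNat, by omega, by simp; omega⟩
  · exact ⟨(a - c).toNat, by omega, by simp; omega⟩
  · exact ⟨(b - e).toNat, by omega, by simp; omega⟩

theorem mem_box_of_mem_side {v : ℕ → ℤ × ℤ} {i : ℕ} {x : ℝ × ℝ} (hx : x ∈ side v i) :
    ((min (v i).1 (v (i + 1)).1 : ℤ) : ℝ) ≤ x.1 ∧ x.1 ≤ ((max (v i).1 (v (i + 1)).1 : ℤ) : ℝ) ∧
    ((min (v i).2 (v (i + 1)).2 : ℤ) : ℝ) ≤ x.2 ∧ x.2 ≤ ((max (v i).2 (v (i + 1)).2 : ℤ) : ℝ) := by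
  obtain ⟨a, b, ha, hb, hab, rfl⟩ := hx
  obtain rfl : a = 1 - b := by linarith
  have key : ∀ p q : ℝ, min p q ≤ (1 - b) * p + b * q ∧ (1 - b) * p + b * q ≤ max p q := by
    intro p q
    constructor
    · nlinarith [min_le_left p q, min_le_right p q]
    · nlinarith [le_max_left p q, le_max_right p q]
  simp only [toPlane, Int.cast_min, Int.cast_max, Prod.fst_add, Prod.snd_add, Prod.smul_mk,
    smul_eq_mul]
  exact ⟨(key _ _).1, (key _ _).2, (key _ _).1, (key _ _).2⟩

/-- Axis-parallel segments with integral ends are integral boxes; if two of them meet, the lower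
left corner of the intersection is a common lattice point. -/
theorem realizes_of_lattice {v : ℕ → ℤ × ℤ} {σ : List Turn} {k : ℕ → ℕ} (h0 : v 0 = (0, 0))
    (h1 : ∀ i ≤ σ.length, 0 < k i ∧ v (i + 1) = v i + k i • segDir σ i)
    (h2 : ∀ i j, i + 1 < j → j ≤ σ.length → ∀ s ≤ k i, ∀ t ≤ k j,
        v i + s • segDir σ i ≠ v j + t • segDir σ j) : Realizes v σ := by
  refine ⟨h0, fun i hi => ⟨k i, h1 i hi⟩, ?_, ?_⟩
  · intro i hi
    refine Set.Subset.antisymm ?_ ?_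
    · rintro ⟨x, y⟩ ⟨hx, hy⟩
      have hx := mem_box_of_mem_side hx
      have hy := mem_box_of_mem_side hy
      have s1 := (h1 i (by omega)).2
      have s2 := (h1 (i + 1) (by omega)).2
      have hp := (perp_segDir σ hi).2
      simp only [Set.mem_singleton_iff, toPlane, Prod.mk.injEq]
      have v1 : v i = v (i + 1) - k i • segDir σ i := by rw [s1]; abel
      rw [v1] at hx
      rw [s2] at hy
      rcases isDir_segDir σ i with e | e | e | e <;>
        rcases isDir_segDir σ (i + 1) with f | f | f | f <;> rw [e, f] at hp <;>
        simp at hp <;> rw [e] at hx <;> rw [f] at hy <;> simp at hx hy <;>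
        constructor <;> linarith
    · rintro _ rfl
      exact ⟨right_mem_segment ℝ _ _, left_mem_segment ℝ _ _⟩
  · intro i j hij hj
    rw [Set.disjoint_left]
    intro x hx hy
    obtain ⟨a1, a2, a3, a4⟩ := mem_box_of_mem_side hx
    obtain ⟨b1, b2, b3, b4⟩ := mem_box_of_mem_side hy
    have c1 := Int.cast_le.1 (a1.trans b2)
    have c2 := Int.cast_le.1 (b1.trans a2)
    have c3 := Int.cast_le.1 (a3.trans b4)
    have c4 := Int.cast_le.1 (b3.trans a4)
    obtain ⟨s, hs, e1⟩ := onSeg_of_box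
      (x := (max (min (v i).1 (v (i + 1)).1) (min (v j).1 (v (j + 1)).1),
        max (min (v i).2 (v (i + 1)).2) (min (v j).2 (v (j + 1)).2)))
      (isDir_segDir σ i) (h1 i (by omega)).2 (by simp only; omega) (by simp only; omega)
      (by simp only; omega) (by simp only; omega)
    obtain ⟨t, ht, e2⟩ := onSeg_of_box
      (x := (max (min (v i).1 (v (i + 1)).1) (min (v j).1 (v (j + 1)).1),
        max (min (v i).2 (v (i + 1)).2) (min (v j).2 (v (j + 1)).2)))
      (isDir_segDir σ j) (h1 j hj).2 (by simp only; omega) (by simp only; omega)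
      (by simp only; omega) (by simp only; omega)
    exact h2 i j hij hj s hs t ht (e1.symm.trans e2)

theorem mem_posXDistances_of_walk {σ : List Turn} {a : ℕ} {pts : List (ℤ × ℤ)} (ha : 0 < a)
    (h : Walk σ east (0, 0) (a, 0) pts) (hn : ((0, 0) :: pts).Nodup) : a ∈ posXDistances σ := by
  obtain ⟨v, k, h0, h1, h2, -, h4, -⟩ := h.exists_vertices hn
  exact ⟨ha, v, realizes_of_lattice h0 h2 h4, h1⟩

/-! ### Routes -/

theorem dirAfter_append (σ τ : List Turn) (d : ℤ × ℤ) :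
    dirAfter (σ ++ τ) d = dirAfter τ (dirAfter σ d) := List.foldl_append

/-- The lattice points of a closed axis-parallel rectangle. -/
def Rect (a b c e : ℤ) : Set (ℤ × ℤ) := {p | a ≤ p.1 ∧ p.1 ≤ b ∧ c ≤ p.2 ∧ p.2 ≤ e}

theorem mem_Rect {a b c e x y : ℤ} : (x, y) ∈ Rect a b c e ↔ a ≤ x ∧ x ≤ b ∧ c ≤ y ∧ y ≤ e :=
  Iff.rfl

/-- `Route σ d d' q q' S`: a lattice path without repeated points leads from `q` in direction `d`
to `q'` in direction `d'`, makes the turns `σ`, and stays in `S` after its starting point. -/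
def Route (σ : List Turn) (d d' q q' : ℤ × ℤ) (S : Set (ℤ × ℤ)) : Prop :=
  dirAfter σ d = d' ∧ ∃ pts, Walk σ d q q' pts ∧ pts.Nodup ∧ ∀ p ∈ pts, p ∈ S

namespace Route

variable {σ τ : List Turn} {d d₁ d₁' d₂ q q₁ q₂ : ℤ × ℤ} {S S' : Set (ℤ × ℤ)}

/-- Regions are unions of rectangles, so inclusion, and disjointness in `append` and `turn`, are
linear arithmetic left to the default arguments. -/
theorem mono (h : Route σ d d₁ q q₁ S)
    (hS : ∀ x y, (x, y) ∈ S → (x, y) ∈ S' := by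
      intro x y hxy; simp only [mem_Rect, Set.mem_union, Set.mem_ofPred_eq] at hxy ⊢; omega) :
    Route σ d d₁ q q₁ S' := by
  obtain ⟨hd, pts, h1, h2, h3⟩ := h
  exact ⟨hd, pts, h1, h2, fun p hp => hS _ _ (h3 p hp)⟩

theorem append (h : Route σ d d₁ q q₁ S) (h' : Route τ d₁ d₂ q₁ q₂ S')
    (hS : ∀ x y, (x, y) ∈ S → (x, y) ∈ S' → False := by
      intro x y h₁ h₂; simp only [mem_Rect, Set.mem_union, Set.mem_ofPred_eq] at h₁ h₂; omega) :
    Route (σ ++ τ) d d₂ q q₂ (S ∪ S') := by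
  obtain ⟨rfl, pts, h1, h2, h3⟩ := h
  obtain ⟨rfl, pts', h1', h2', h3'⟩ := h'
  refine ⟨dirAfter_append _ _ _, pts ++ pts', h1.append h1', ?_, ?_⟩
  · rw [List.nodup_append]
    refine ⟨h2, h2', fun p hp p' hp' e => hS p.1 p.2 (h3 p hp) (e ▸ h3' p' hp')⟩
  · intro p hp
    exact (List.mem_append.1 hp).imp (h3 p) (h3' p)

theorem turn (h : Route σ d d₁ q q₁ S) (t : Turn) (h' : Route τ d₁' d₂ q₁ q₂ S')
    (ht : t.rotate d₁ = d₁' := by rfl)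
    (hS : ∀ x y, (x, y) ∈ S → (x, y) ∈ S' → False := by
      intro x y h₁ h₂; simp only [mem_Rect, Set.mem_union, Set.mem_ofPred_eq] at h₁ h₂; omega) :
    Route (σ ++ t :: τ) d d₂ q q₂ (S ∪ S') := by
  obtain ⟨rfl, pts, h1, h2, h3⟩ := h
  subst ht
  obtain ⟨rfl, pts', h1', h2', h3'⟩ := h'
  refine ⟨by rw [dirAfter_append]; rfl, pts ++ pts', h1.append_turn t h1', ?_, ?_⟩
  · rw [List.nodup_append]
    refine ⟨h2, h2', fun p hp p' hp' e => hS p.1 p.2 (h3 p hp) (e ▸ h3' p' hp')⟩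
  · intro p hp
    exact (List.mem_append.1 hp).imp (h3 p) (h3' p)

theorem mem_posXDistances {a : ℕ} (h : Route σ (1, 0) d (0, 0) (a, 0) S) (ha : 0 < a)
    (hS : ((0 : ℤ), (0 : ℤ)) ∉ S := by
      intro h₀; simp only [mem_Rect, Set.mem_union, Set.mem_ofPred_eq] at h₀; omega) : a ∈ posXDistances σ := by
  obtain ⟨-, pts, h1, h2, h3⟩ := h
  exact mem_posXDistances_of_walk ha h1 (List.nodup_cons.2 ⟨fun h => hS (h3 _ h), h2⟩)

theorem straight_of_steps {d : ℤ × ℤ} (k : ℕ) (q : ℤ × ℤ) (hd : IsDir d) :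
    ∃ pts, Walk [] d q (q + (k + 1) • d) pts ∧ pts.Nodup ∧
      ∀ p ∈ pts, ∃ i : ℕ, 1 ≤ i ∧ i ≤ k + 1 ∧ p = q + i • d := by
  induction k generalizing q with
  | zero => exact ⟨[q + d], by simpa using Walk.one d q, by simp, fun p hp => ⟨1, by simpa using hp⟩⟩
  | succ k ih =>
    obtain ⟨pts, h1, h2, h3⟩ := ih (q + d)
    have e : ∀ i : ℕ, q + d + i • d = q + (i + 1) • d := fun i => by
      rw [succ_nsmul, add_assoc, add_comm d]
    refine ⟨(q + d) :: pts, ?_, ?_, ?_⟩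
    · rw [← e]; exact Walk.straight h1
    · refine List.nodup_cons.2 ⟨fun h => ?_, h2⟩
      obtain ⟨i, hi, -, hp⟩ := h3 _ h
      have := left_eq_add.1 hp
      have h0 : i • d = (0 : ℕ) • d := by rw [this, zero_smul]
      have := smul_dir_injective hd h0
      omega
    · intro p hp
      rcases List.mem_cons.1 hp with rfl | hp
      · exact ⟨1, le_rfl, by omega, by rw [one_smul]⟩
      · obtain ⟨i, hi, hi', rfl⟩ := h3 p hp
        exact ⟨i + 1, by omega, by omega, e i⟩

theorem east (x x' y : ℤ) (h : x < x' := by omega) :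
    Route [] (1, 0) (1, 0) (x, y) (x', y) (Rect (x + 1) x' y y) := by
  obtain ⟨pts, h1, h2, h3⟩ := straight_of_steps (x' - x - 1).toNat (x, y) (Or.inl rfl)
  refine ⟨rfl, pts, ?_, h2, fun p hp => ?_⟩
  · convert h1 using 1
    ext <;> simp; omega
  · obtain ⟨i, hi, hi', rfl⟩ := h3 p hp
    simp [Rect]; omega

theorem north (x y y' : ℤ) (h : y < y' := by omega) :
    Route [] (0, 1) (0, 1) (x, y) (x, y') (Rect x x (y + 1) y') := by
  obtain ⟨pts, h1, h2, h3⟩ := straight_of_steps (y' - y - 1).toNat (x, y) (Or.inr (Or.inl rfl))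
  refine ⟨rfl, pts, ?_, h2, fun p hp => ?_⟩
  · convert h1 using 1
    ext <;> simp; omega
  · obtain ⟨i, hi, hi', rfl⟩ := h3 p hp
    simp [Rect]; omega

theorem west (x x' y : ℤ) (h : x' < x := by omega) :
    Route [] (-1, 0) (-1, 0) (x, y) (x', y) (Rect x' (x - 1) y y) := by
  obtain ⟨pts, h1, h2, h3⟩ := straight_of_steps (x - x' - 1).toNat (x, y)
    (Or.inr (Or.inr (Or.inl rfl)))
  refine ⟨rfl, pts, ?_, h2, fun p hp => ?_⟩
  · convert h1 using 1
    ext <;> simp; omega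
  · obtain ⟨i, hi, hi', rfl⟩ := h3 p hp
    simp [Rect]; omega

theorem south (x y y' : ℤ) (h : y' < y := by omega) :
    Route [] (0, -1) (0, -1) (x, y) (x, y') (Rect x x y' (y - 1)) := by
  obtain ⟨pts, h1, h2, h3⟩ := straight_of_steps (y - y' - 1).toNat (x, y)
    (Or.inr (Or.inr (Or.inr rfl)))
  refine ⟨rfl, pts, ?_, h2, fun p hp => ?_⟩
  · convert h1 using 1
    ext <;> simp; omega
  · obtain ⟨i, hi, hi', rfl⟩ := h3 p hp
    simp [Rect]; omega

theorem map (h : Route σ d d₁ q q₁ S) (f A : ℤ × ℤ → ℤ × ℤ) (τ : Turn → Turn)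
    (hf : ∀ q d, f (q + d) = f q + A d) (hi : Function.Injective f)
    (hA : ∀ t d, A (Turn.rotate t d) = (τ t).rotate (A d)) (hS : ∀ p ∈ S, f p ∈ S') :
    Route (σ.map τ) (A d) (A d₁) (f q) (f q₁) S' := by
  obtain ⟨rfl, pts, h1, h2, h3⟩ := h
  refine ⟨?_, _, h1.map f A τ hf hA, h2.map hi, ?_⟩
  · clear h1
    induction σ generalizing d with
    | nil => rfl
    | cons t σ ih =>
      have := ih (d := t.rotate d)
      rw [hA] at this
      exact this
  · intro p hp
    obtain ⟨p', hp', rfl⟩ := List.mem_map.1 hp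
    exact hS _ (h3 _ hp')

variable {a b x₁ x₂ y₁ y₂ x y x' y' : ℤ}

theorem translate (h : Route σ d d₁ (a, b) (x', y') (Rect x₁ x₂ y₁ y₂)) (x y : ℤ) :
    Route σ d d₁ (x + a, y + b) (x + x', y + y') (Rect (x + x₁) (x + x₂) (y + y₁) (y + y₂)) := by
  have := h.map (S' := Rect (x + x₁) (x + x₂) (y + y₁) (y + y₂)) (fun p => (x, y) + p) id id
    (fun q d => by simp [add_assoc]) (add_right_injective _) (fun _ _ => rfl)
    (fun p hp => by simp [Rect] at hp ⊢; omega)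
  simpa using this

theorem rotate (h : Route σ d d₁ (0, 0) (a, b) (Rect x₁ x₂ y₁ y₂)) :
    Route σ (L.rotate d) (L.rotate d₁) (0, 0) (-b, a) (Rect (-y₂) (-y₁) x₁ x₂) := by
  have := h.map (S' := Rect (-y₂) (-y₁) x₁ x₂) (L.rotate) (L.rotate) id
    (fun q d => by simp [Turn.rotate, add_comm])
    (fun p q h => by simp [Turn.rotate] at h; exact Prod.ext h.2 h.1)
    (fun t d => by cases t <;> simp [Turn.rotate])
    (fun p hp => by simp [Rect, Turn.rotate] at hp ⊢; omega)
  simpa [Turn.rotate] using this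

/-- The turn in the opposite sense. -/
def _root_.Turn.mirror : Turn → Turn
  | L => R
  | R => L

theorem reflect (h : Route σ d d₁ (0, 0) (a, b) (Rect x₁ x₂ y₁ y₂)) :
    Route (σ.map mirror) (d.1, -d.2) (d₁.1, -d₁.2) (0, 0) (a, -b) (Rect x₁ x₂ (-y₂) (-y₁)) := by
  have := h.map (S' := Rect x₁ x₂ (-y₂) (-y₁)) (fun p => (p.1, -p.2)) (fun p => (p.1, -p.2)) mirror
    (fun q d => by simp [add_comm])
    (fun p q h => by simp at h; exact Prod.ext h.1 h.2)
    (fun t d => by cases t <;> simp [Turn.rotate, mirror])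
    (fun p hp => by simp [Rect] at hp ⊢; omega)
  simpa using this

theorem fromEast (h : Route σ (1, 0) d₁ (0, 0) (a, b) (Rect x₁ x₂ y₁ y₂))
    (hx : x' = x + a := by omega) (hy : y' = y + b := by omega) :
    Route σ (1, 0) d₁ (x, y) (x', y') (Rect (x + x₁) (x + x₂) (y + y₁) (y + y₂)) := by
  subst hx hy
  simpa using h.translate x y

theorem fromNorth (h : Route σ (1, 0) d₁ (0, 0) (a, b) (Rect x₁ x₂ y₁ y₂))
    (hx : x' = x - b := by omega) (hy : y' = y + a := by omega) :
    Route σ (0, 1) (L.rotate d₁) (x, y) (x', y')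
      (Rect (x - y₂) (x - y₁) (y + x₁) (y + x₂)) := by
  subst hx hy
  simpa [Turn.rotate, sub_eq_add_neg] using h.rotate.translate x y

theorem fromWest (h : Route σ (1, 0) d₁ (0, 0) (a, b) (Rect x₁ x₂ y₁ y₂))
    (hx : x' = x - a := by omega) (hy : y' = y - b := by omega) :
    Route σ (-1, 0) (L.rotate (L.rotate d₁)) (x, y) (x', y')
      (Rect (x - x₂) (x - x₁) (y - y₂) (y - y₁)) := by
  subst hx hy
  simpa [Turn.rotate, sub_eq_add_neg] using h.rotate.rotate.translate x y

theorem fromSouth (h : Route σ (1, 0) d₁ (0, 0) (a, b) (Rect x₁ x₂ y₁ y₂))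
    (hx : x' = x + b := by omega) (hy : y' = y - a := by omega) :
    Route σ (0, -1) (L.rotate (L.rotate (L.rotate d₁))) (x, y) (x', y')
      (Rect (x + y₁) (x + y₂) (y - x₂) (y - x₁)) := by
  subst hx hy
  simpa [Turn.rotate, sub_eq_add_neg] using h.rotate.rotate.rotate.translate x y

end Route

/-! ### Boxes, U-turns and spirals -/

/-- Cut at the first passage of the running net turning from c to c + 1. -/
theorem exists_split_L {w : List Turn} {c : ℤ} (hc : 0 ≤ c) (h : c < net w) :
    ∃ a b, w = a ++ L :: b ∧ net a = c := by
  induction w generalizing c with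
  | nil => simp at h; omega
  | cons t w ih =>
    cases t with
    | L =>
      rw [net_L] at h
      rcases hc.eq_or_lt with rfl | hc
      · exact ⟨[], w, rfl, rfl⟩
      · obtain ⟨a, b, rfl, ha⟩ := ih (c := c - 1) (by omega) (by omega)
        exact ⟨L :: a, b, rfl, by rw [net_L]; omega⟩
    | R =>
      rw [net_R] at h
      obtain ⟨a, b, rfl, ha⟩ := ih (c := c + 1) (by omega) (by omega)
      exact ⟨R :: a, b, rfl, by rw [net_R]; omega⟩

theorem exists_split_R {w : List Turn} {c : ℤ} (hc : 0 ≤ c) (h : net w + c < 0) :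
    ∃ a b, w = a ++ R :: b ∧ net a + c = 0 := by
  induction w generalizing c with
  | nil => simp at h; omega
  | cons t w ih =>
    cases t with
    | R =>
      rw [net_R] at h
      rcases hc.eq_or_lt with rfl | hc
      · exact ⟨[], w, rfl, rfl⟩
      · obtain ⟨a, b, rfl, ha⟩ := ih (c := c - 1) (by omega) (by omega)
        exact ⟨R :: a, b, rfl, by rw [net_R]; omega⟩
    | L =>
      rw [net_L] at h
      obtain ⟨a, b, rfl, ha⟩ := ih (c := c + 1) (by omega) (by omega)
      exact ⟨L :: a, b, rfl, by rw [net_L]; omega⟩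

theorem exists_split {w : List Turn} {c : ℤ} (hc : 0 ≤ c) (h : c ≤ net w) :
    ∃ a b, w = a ++ b ∧ net a = c := by
  rcases h.eq_or_lt with rfl | h
  · exact ⟨w, [], by simp, rfl⟩
  · obtain ⟨a, b, rfl, ha⟩ := exists_split_L hc h
    exact ⟨a, L :: b, rfl, ha⟩

/-- If the passage above c is followed by R, the height is again c with a shorter word left; this
cannot go on forever. -/
theorem exists_split_LL {w : List Turn} {c : ℤ} (hc : 0 ≤ c) (h : c + 2 ≤ net w) :
    ∃ a b, w = a ++ L :: L :: b ∧ net a = c := by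
  obtain ⟨n, hn⟩ : ∃ n, w.length = n := ⟨_, rfl⟩
  induction n using Nat.strong_induction_on generalizing w c with
  | _ n ih =>
    obtain ⟨a, b, rfl, ha⟩ := exists_split_L hc (by omega : c < net w)
    rw [net_append, net_L] at h
    match b with
    | [] => simp at h; omega
    | L :: b => exact ⟨a, b, rfl, ha⟩
    | R :: b =>
      rw [net_R] at h
      obtain ⟨a', b', rfl, ha'⟩ := ih b.length (by subst hn; simp; omega) (w := b) le_rfl
        (by omega) rfl
      exact ⟨a ++ L :: R :: a', b', by simp, by simp; omega⟩

/-- The word `w` fits into a box: from the middle of the left side to the right side. -/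
def Box (w : List Turn) (X H Y : ℤ) : Prop :=
  1 ≤ X ∧ -H ≤ Y ∧ Y ≤ H ∧ Route w (1, 0) (1, 0) (0, 0) (X, Y) (Rect 1 X (-H) H)

theorem Box.cons_L {w₁ w₂ : List Turn} {X₁ H₁ Y₁ X₂ H₂ Y₂ : ℤ} (h₁ : Box w₁ X₁ H₁ Y₁)
    (h₂ : Box w₂ X₂ H₂ Y₂) : ∃ X H Y, Box (L :: (w₁ ++ R :: w₂)) X H Y := by
  obtain ⟨hX₁, hY₁, hY₁', r₁⟩ := h₁
  obtain ⟨hX₂, hY₂, hY₂', r₂⟩ := h₂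
  refine ⟨2 * H₁ + 2 + X₂, X₁ + 1 + H₂, X₁ + 1 + Y₂, by omega, by omega, by omega, ?_⟩
  refine Route.mono (((Route.east 0 (H₁ + 1) 0).turn L
    ((r₁.fromNorth (x' := H₁ + 1 - Y₁) (y' := X₁)).append
    ((Route.north (H₁ + 1 - Y₁) X₁ (X₁ + 1)).turn R
    ((Route.east (H₁ + 1 - Y₁) (2 * H₁ + 2) (X₁ + 1)).append
    (r₂.fromEast (x' := 2 * H₁ + 2 + X₂) (y' := X₁ + 1 + Y₂)))))))

theorem Box.reflect {w : List Turn} {X H Y : ℤ} (h : Box w X H Y) :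
    Box (w.map mirror) X H (-Y) := by
  obtain ⟨hX, hY, hY', r⟩ := h
  exact ⟨hX, by omega, by omega, by simpa using r.reflect⟩

theorem map_mirror_mirror (w : List Turn) : (w.map mirror).map mirror = w := by
  rw [List.map_map]
  exact (List.map_congr_left fun t _ => by cases t <;> rfl).trans (List.map_id w)

theorem net_map_mirror (w : List Turn) : net (w.map mirror) = -net w := by
  induction w with
  | nil => rfl
  | cons t w ih => cases t <;> simp [mirror, ih] <;> ring

/-- A balanced word is L w₁ R w₂ with w₁ and w₂ balanced, or a mirror image of such a word; the
boxes of w₁ and w₂ are placed behind the two bends. -/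
theorem exists_box (w : List Turn) (h : net w = 0) : ∃ X H Y, Box w X H Y := by
  obtain ⟨n, hn⟩ : ∃ n, w.length = n := ⟨_, rfl⟩
  induction n using Nat.strong_induction_on generalizing w with
  | _ n ih =>
    have key : ∀ u : List Turn, u.length + 1 = n → net (L :: u) = 0 →
        ∃ X H Y, Box (L :: u) X H Y := by
      intro u hu hu0
      rw [net_L] at hu0
      obtain ⟨w₁, w₂, rfl, hw₁⟩ := exists_split_R le_rfl (by omega : net u + 0 < 0)
      simp only [net_append, net_R, List.length_append, List.length_cons] at hu0 hu
      obtain ⟨_, _, _, b₁⟩ := ih w₁.length (by omega) w₁ (by omega) rfl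
      obtain ⟨_, _, _, b₂⟩ := ih w₂.length (by omega) w₂ (by omega) rfl
      exact b₁.cons_L b₂
    match w with
    | [] => exact ⟨1, 0, 0, by omega, by omega, by omega, (Route.east 0 1 0).mono⟩
    | L :: u => exact key u (by simpa using hn) h
    | R :: u =>
      obtain ⟨X, H, Y, hb⟩ := key (u.map mirror) (by simpa using hn) (by
        have := net_map_mirror (R :: u)
        rw [h] at this
        simpa [mirror] using this)
      refine ⟨X, H, -Y, ?_⟩
      have := hb.reflect
      rw [List.map_cons, map_mirror_mirror] at this
      exact this

/-- The word `w` makes a U-turn: it can shift by one column and any large number of rows. -/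
def UTurn (w : List Turn) (D : ℤ) : Prop :=
  1 ≤ D ∧ ∀ g, D ≤ g → Route w (1, 0) (-1, 0) (0, 0) (1, g) (Rect 1 D (-D) (g + D))

/-- Write w as w₀ L w₁ L w₂ with balanced parts and attach their boxes to the three sides of a large
U. -/
theorem exists_uTurn (w : List Turn) (h : net w = 2) : ∃ D, UTurn w D := by
  obtain ⟨w₀, w, rfl, h₀⟩ := exists_split_L le_rfl (by omega : 0 < net w)
  rw [net_append, net_L] at h
  obtain ⟨w₁, w₂, rfl, h₁⟩ := exists_split_L le_rfl (by omega : 0 < net w)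
  rw [net_append, net_L] at h
  obtain ⟨X₀, H₀, Y₀, hX₀, hY₀, hY₀', r₀⟩ := exists_box w₀ h₀
  obtain ⟨X₁, H₁, Y₁, hX₁, hY₁, hY₁', r₁⟩ := exists_box w₁ h₁
  obtain ⟨X₂, H₂, Y₂, hX₂, hY₂, hY₂', r₂⟩ := exists_box w₂ (by omega)
  refine ⟨X₀ + 3 * H₁ + X₂ + H₀ + X₁ + 2 * H₂ + 5, by omega, fun g hg => ?_⟩
  exact Route.mono ((r₀.fromEast (x := 0) (y := 0) (x' := X₀) (y' := Y₀)).append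
    ((Route.east X₀ (X₀ + 2 * H₁ + X₂ + 2) Y₀).turn L
    ((r₁.fromNorth (x' := X₀ + 2 * H₁ + X₂ + 2 - Y₁) (y' := Y₀ + X₁)).append
    ((Route.north (X₀ + 2 * H₁ + X₂ + 2 - Y₁) (Y₀ + X₁) (g + Y₂)).turn L
    ((Route.west (X₀ + 2 * H₁ + X₂ + 2 - Y₁) (1 + X₂) (g + Y₂)).append
    (r₂.fromWest (x' := 1) (y' := g)))))))

namespace UTurn

variable {w : List Turn} {D : ℤ}

theorem east (h : UTurn w D) (x y x' y' : ℤ) (hx : x' = x + 1 := by omega)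
    (hy : y + D ≤ y' := by omega) : Route w (1, 0) (-1, 0) (x, y) (x', y')
      (Rect (x + 1) (x + D) (y - D) (y' + D)) :=
  ((h.2 (y' - y) (by omega)).fromEast (x := x) (y := y)).mono

theorem north (h : UTurn w D) (x y x' y' : ℤ) (hx : y' = y + 1 := by omega)
    (hy : x' + D ≤ x := by omega) : Route w (0, 1) (0, -1) (x, y) (x', y')
      (Rect (x' - D) (x + D) (y + 1) (y + D)) :=
  ((h.2 (x - x') (by omega)).fromNorth (x := x) (y := y)).mono

theorem west (h : UTurn w D) (x y x' y' : ℤ) (hx : x' = x - 1 := by omega)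
    (hy : y' + D ≤ y := by omega) : Route w (-1, 0) (1, 0) (x, y) (x', y')
      (Rect (x - D) (x - 1) (y' - D) (y + D)) :=
  ((h.2 (y - y') (by omega)).fromWest (x := x) (y := y)).mono

theorem south (h : UTurn w D) (x y x' y' : ℤ) (hx : y' = y - 1 := by omega)
    (hy : x + D ≤ x' := by omega) : Route w (0, -1) (0, 1) (x, y) (x', y')
      (Rect (x - D) (x' + D) (y - D) (y - 1)) :=
  ((h.2 (x' - x) (by omega)).fromSouth (x := x) (y := y)).mono

end UTurn

/-- The words that consist of `k` blocks `L :: L :: w` with `net w = 2`. -/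
inductive Spiral : List Turn → ℕ → Prop
  | nil : Spiral [] 0
  | cons {w v : List Turn} {k : ℕ} : net w = 2 → Spiral v k → Spiral (L :: L :: (w ++ v)) (k + 1)

/-- After a pair LL at height c, the remainder has net turning 2 plus a multiple of 4, so the same
splitting recurs with c = 2. -/
theorem exists_spiral_suffix (w : List Turn) {c : ℤ} (k : ℕ) (hc : 0 ≤ c)
    (h : net w = c + 4 * k) : ∃ u v, w = u ++ v ∧ net u = c ∧ Spiral v k := by
  induction k generalizing w c with
  | zero => exact ⟨w, [], by simp, by simpa using h, .nil⟩
  | succ k ih =>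
    obtain ⟨a, b, rfl, ha⟩ := exists_split_LL hc (by push_cast at h; omega : c + 2 ≤ net w)
    obtain ⟨u, v, rfl, hu, hv⟩ := ih b (c := 2) (by omega) (by
      simp at h; omega)
    exact ⟨a, _, rfl, ha, .cons hu hv⟩

/-- Each block LLw is one layer around the inner spiral: west above it, down column 1, east below
it, then a U-turn into its entrance. The inner spiral is moved one column east to make room. -/
theorem Spiral.exists_route {v : List Turn} {k : ℕ} (h : Spiral v k) :
    ∃ ρ η : ℤ, 1 ≤ ρ ∧ -ρ ≤ η ∧ η ≤ ρ ∧
      Route v (-1, 0) (-1, 0) (ρ + 1, η) (1 + k, 0) (Rect 1 ρ (-ρ) ρ) := by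
  induction h with
  | nil => exact ⟨1, 0, by omega, by omega, by omega, (Route.west 2 1 0).mono⟩
  | @cons w v k hw _ ih =>
    obtain ⟨ρ, η, hρ, hη, hη', r⟩ := ih
    obtain ⟨D, u⟩ := exists_uTurn w hw
    have hD := u.1
    refine ⟨ρ + 2 * D + 1, ρ + D + 1, by omega, by omega, by omega, ?_⟩
    have r' := r.translate 1 0
    rw [show (1 + (ρ + 1), 0 + η) = (ρ + 2, η) by ext <;> simp; ring,
      show ((1 : ℤ) + (1 + k), (0 : ℤ) + 0) = (1 + ((k + 1 : ℕ) : ℤ), 0) by ext <;> simp; ring] at r'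
    exact Route.mono ((Route.west (ρ + 2 * D + 1 + 1) 1 (ρ + D + 1)).turn L
      ((Route.south 1 (ρ + D + 1) (-(ρ + D + 1))).turn L
      ((Route.east 1 (ρ + 1) (-(ρ + D + 1))).append
      ((u.east (ρ + 1) (-(ρ + D + 1)) (ρ + 2) η).append r'))))

/-! ### Chains of least length -/

/-- The turns of a staircase with `m` steps. -/
def stair : ℕ → List Turn
  | 0 => []
  | m + 1 => R :: L :: stair m

theorem stair_succ (m : ℕ) : stair (m + 1) = stair m ++ [R, L] := by
  induction m with
  | zero => rfl
  | succ m ih =>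
    change R :: L :: stair (m + 1) = (R :: L :: stair m) ++ [R, L]
    rw [ih]
    rfl

@[simp] theorem net_stair (m : ℕ) : net (stair m) = 0 := by
  induction m with
  | zero => rfl
  | succ m ih => simp [stair, ih]

theorem segDir_append_left (σ τ : List Turn) {i : ℕ} (hi : i ≤ σ.length) :
    segDir (σ ++ τ) i = segDir σ i := by
  rw [segDir, segDir, List.take_append_of_le_length hi]

theorem segDirs_append_singleton (σ : List Turn) (t : Turn) :
    segDirs (σ ++ [t]) = segDirs σ ++ [segDir (σ ++ [t]) (σ.length + 1)] := by
  rw [segDirs, List.length_append, List.length_singleton, List.range_succ, List.map_append]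
  congr 1
  refine List.map_congr_left fun i hi => segDir_append_left _ _ ?_
  have := List.mem_range.1 hi
  omega

theorem segDirs_R_L (σ : List Turn) : segDirs (R :: L :: σ) = east :: south :: segDirs σ := by
  simp only [segDirs, List.length_cons, List.range_succ_eq_map, List.map_cons, List.map_map]
  rfl

theorem segDirs_R (σ : List Turn) : ∃ l, segDirs (R :: σ) = east :: south :: l := by
  simp only [segDirs, List.length_cons, List.range_succ_eq_map, List.map_cons, List.map_map]
  exact ⟨_, rfl⟩

theorem le_mO_stair_append (m : ℕ) (σ : List Turn) : m ≤ mO east south (stair m ++ σ) := by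
  induction m with
  | zero => exact Nat.zero_le _
  | succ m ih =>
    simp only [mO, stair, List.cons_append, segDirs_R_L] at ih ⊢
    rw [staircaseCount_cons_self (z₁ := east) (z₂ := south) rfl (Or.inr rfl),
      staircaseCount_cons_other (z₁ := east) (z₂ := south) rfl (Or.inr rfl)]
    omega

theorem succ_le_mO_stair_append_R (m : ℕ) (σ : List Turn) :
    m + 1 ≤ mO east south (stair m ++ R :: σ) := by
  induction m with
  | zero =>
    obtain ⟨l, hl⟩ := segDirs_R σ
    simp only [mO, stair, List.nil_append, hl]
    rw [staircaseCount_cons_self (z₁ := east) (z₂ := south) rfl (Or.inr rfl),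
      staircaseCount_cons_other (z₁ := east) (z₂ := south) rfl (Or.inr rfl)]
    omega
  | succ m ih =>
    simp only [mO, stair, List.cons_append, segDirs_R_L] at ih ⊢
    rw [staircaseCount_cons_self (z₁ := east) (z₂ := south) rfl (Or.inr rfl),
      staircaseCount_cons_other (z₁ := east) (z₂ := south) rfl (Or.inr rfl)]
    omega

theorem segDir_length_of_net {σ : List Turn} (h : net σ % 4 = 1) :
    segDir σ σ.length = north := by
  have := segDir_eq_of_net σ σ.length
  rw [net_take_length] at this
  rcases this with h' | h' | h' | h' <;> first | exact h'.2 | omega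

theorem succ_le_mP_append_stair (m : ℕ) {σ : List Turn} (h : net σ % 4 = 1) :
    m + 1 ≤ mP east north (σ ++ stair m) := by
  induction m with
  | zero =>
    have : segDirs σ = (List.range σ.length).map (segDir σ) ++ [north] := by
      rw [segDirs, List.range_succ, List.map_append, List.map_singleton, segDir_length_of_net h]
    simp only [mP, stair, List.append_nil, this, List.reverse_append, List.reverse_singleton,
      List.singleton_append]
    rw [staircaseCount_cons_other (z₁ := east) (z₂ := north) rfl (Or.inl rfl)]
    omega
  | succ m ih =>
    have h0 : segDir (σ ++ stair m) (σ ++ stair m).length = north :=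
      segDir_length_of_net (by simpa using h)
    have e : σ ++ stair (m + 1) = ((σ ++ stair m) ++ [R]) ++ [L] := by rw [stair_succ]; simp
    have h1 : segDir ((σ ++ stair m) ++ [R]) ((σ ++ stair m).length + 1) = east := by
      rw [segDir_succ _ (by simp), segDir_append_left _ _ le_rfl, h0]
      simp [Turn.rotate, north, east]
    have h2 : segDir (((σ ++ stair m) ++ [R]) ++ [L]) (((σ ++ stair m) ++ [R]).length + 1) =
        north := by
      have := segDir_length_of_net (σ := ((σ ++ stair m) ++ [R]) ++ [L]) (by simpa using h)
      rwa [List.length_append (bs := [L])] at this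
    simp only [mP] at ih ⊢
    rw [e, segDirs_append_singleton, segDirs_append_singleton, h1, h2, List.reverse_append,
      List.reverse_append, List.reverse_singleton, List.reverse_singleton, List.singleton_append,
      List.singleton_append, staircaseCount_cons_other (z₁ := east) (z₂ := north) rfl (Or.inl rfl),
      staircaseCount_cons_self (z₁ := east) (z₂ := north) rfl (Or.inl rfl)]
    omega

theorem Route.stairDown (m : ℕ) (x y : ℤ) :
    Route (stair m) (1, 0) (1, 0) (x, y) (x + m + 1, y - m)
      {p | x + 1 ≤ p.1 ∧ y - m ≤ p.2 ∧ p.1 + p.2 ≤ x + y + 1} := by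
  induction m generalizing x y with
  | zero => exact Route.mono (by simpa [stair] using Route.east x (x + 1) y)
  | succ m ih =>
    have := ih (x + 1) (y - 1)
    rw [show (x + 1 + m + 1, y - 1 - m) = (x + ((m + 1 : ℕ) : ℤ) + 1, y - ((m + 1 : ℕ) : ℤ)) by
      ext <;> push_cast <;> ring] at this
    exact Route.mono ((Route.east x (x + 1) y).turn R ((Route.south (x + 1) y (y - 1)).turn L this))

theorem Route.stairUp (m : ℕ) (x y x' y' : ℤ) (hx : x' = x + m := by omega)
    (hy : y' = y + m + 1 := by omega) :
    Route (stair m) (0, 1) (0, 1) (x, y) (x', y') (Rect x x' (y + 1) y') := by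
  induction m generalizing x y with
  | zero =>
    obtain rfl : x' = x := by simpa using hx
    obtain rfl : y' = y + 1 := by simpa using hy
    exact Route.north x' y (y + 1)
  | succ m ih =>
    push_cast at hx hy
    exact Route.mono ((Route.north x y (y + 1)).turn R ((Route.east x (x + 1) (y + 1)).turn L
      (ih (x + 1) (y + 1) (by omega) (by omega))))

/-- Split σ as L u₁ L u₂ v with u₁, u₂ of net turning 2 and v a spiral of k layers. The chain rises
in column 1, passes left of the origin and below it, and enters the spiral from the east. -/
theorem mem_posXDistances_of_head_L {σ : List Turn} {k : ℕ} (h : net σ = 4 * k + 6)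
    (hσ : σ.head? = some L) : k + 2 ∈ posXDistances σ := by
  match σ with
  | L :: σ =>
    rw [net_L] at h
    obtain ⟨u₁, σ, rfl, h₁⟩ := exists_split_L (c := 2) (by omega) (by omega : 2 < net σ)
    rw [net_append, net_L] at h
    obtain ⟨u₂, v, rfl, h₂, hv⟩ := exists_spiral_suffix σ (c := 2) k (by omega) (by omega)
    obtain ⟨ρ, η, hρ, hη, hη', r⟩ := hv.exists_route
    obtain ⟨D₁, w₁⟩ := exists_uTurn u₁ h₁
    obtain ⟨D₂, w₂⟩ := exists_uTurn u₂ h₂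
    have hD₁ := w₁.1
    have hD₂ := w₂.1
    have r' := r.translate 1 0
    rw [show (1 + (ρ + 1), 0 + η) = (ρ + 2, η) by ext <;> simp; ring,
      show ((1 : ℤ) + (1 + k), (0 : ℤ) + 0) = (((k + 2 : ℕ) : ℤ), 0) by ext <;> simp; ring] at r'
    exact Route.mem_posXDistances ((Route.east 0 1 0).turn L
      ((Route.north 1 0 (ρ + D₂ + 1)).append
      ((w₁.north 1 (ρ + D₂ + 1) (-D₁ - 1) (ρ + D₂ + 2)).append
      ((Route.south (-D₁ - 1) (ρ + D₂ + 2) (-(ρ + D₂ + 1))).turn L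
      ((Route.east (-D₁ - 1) (ρ + 1) (-(ρ + D₂ + 1))).append
      ((w₂.east (ρ + 1) (-(ρ + D₂ + 1)) (ρ + 2) η).append r')))))) (by omega)

/-- Here the chain descends in column 1 and goes to the spiral entrance without surrounding the
origin. -/
theorem mem_posXDistances_of_head_R {σ : List Turn} {k : ℕ} (h : net σ = 4 * k + 2)
    (hσ : σ.head? = some R) : k + 2 ∈ posXDistances σ := by
  match σ with
  | R :: σ =>
    rw [net_R] at h
    obtain ⟨u₁, σ, rfl, h₁⟩ := exists_split_L le_rfl (by omega : 0 < net σ)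
    rw [net_append, net_L] at h
    obtain ⟨u₂, v, rfl, h₂, hv⟩ := exists_spiral_suffix σ (c := 2) k (by omega) (by omega)
    obtain ⟨ρ, η, hρ, hη, hη', r⟩ := hv.exists_route
    obtain ⟨X, H, Y, hX, hY, hY', b⟩ := exists_box u₁ h₁
    obtain ⟨D, w⟩ := exists_uTurn u₂ h₂
    have hD := w.1
    have r' := r.translate 1 0
    rw [show (1 + (ρ + 1), 0 + η) = (ρ + 2, η) by ext <;> simp; ring,
      show ((1 : ℤ) + (1 + k), (0 : ℤ) + 0) = (((k + 2 : ℕ) : ℤ), 0) by ext <;> simp; ring] at r'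
    exact Route.mem_posXDistances ((Route.east 0 1 0).turn R
      ((Route.south 1 0 (-(ρ + D))).append
      ((b.fromSouth (x' := 1 + Y) (y' := -(ρ + D) - X)).append
      ((Route.south (1 + Y) (-(ρ + D) - X) (-(ρ + D) - X - 1)).turn L
      ((Route.east (1 + Y) (ρ + H + 2) (-(ρ + D) - X - 1)).append
      ((w.east (ρ + H + 2) (-(ρ + D) - X - 1) (ρ + H + 3) η).append
      ((Route.west (ρ + H + 3) (ρ + 2) η).append r'))))))) (by omega)

/-- From the foot of the staircase, in column m + 1, the chain rises, winds around the origin by two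
U-turns and comes up in column m + 2. -/
theorem mem_posXDistances_stair_L {σ : List Turn} (m : ℕ) (h : net σ = 4) :
    m + 2 ∈ posXDistances (stair m ++ L :: σ) := by
  obtain ⟨u₁, u₂, rfl, h₁⟩ := exists_split (c := 2) (by omega) (by omega : 2 ≤ net σ)
  rw [net_append] at h
  rw [← List.append_nil u₂]
  obtain ⟨D₁, w₁⟩ := exists_uTurn u₁ h₁
  obtain ⟨D₂, w₂⟩ := exists_uTurn u₂ (by omega)
  have hD₁ := w₁.1
  have hD₂ := w₂.1
  have r := Route.stairDown m 0 0
  rw [show ((0 : ℤ) + m + 1, (0 : ℤ) - m) = ((m : ℤ) + 1, -(m : ℤ)) by ext <;> simp] at r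
  exact Route.mem_posXDistances (r.turn L
    ((Route.north (m + 1) (-m) 1).append
    ((w₁.north (m + 1) 1 (-(D₁ + D₂)) 2).append
    ((Route.south (-(D₁ + D₂)) 2 (-m - 1)).append
    ((w₂.south (-(D₁ + D₂)) (-m - 1) ((m + 2 : ℕ) : ℤ) (-m - 2)).append
    (Route.north ((m + 2 : ℕ) : ℤ) (-m - 2) 0)))))) (by omega)

/-- After RR the chain must first turn back below the staircase. It then rises in column m + 2,
encircles everything and arrives in column m + 3. -/
theorem mem_posXDistances_stair_R_R {σ : List Turn} (m : ℕ) (h : net σ = 7) :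
    m + 3 ∈ posXDistances (stair m ++ R :: R :: σ) := by
  obtain ⟨u₀, σ, rfl, h₀⟩ := exists_split_LL (c := 2) (by omega) (by omega : 2 + 2 ≤ net σ)
  simp only [net_append, net_L] at h
  obtain ⟨u₁, σ, rfl, h₁⟩ := exists_split (c := 2) (by omega) (by omega : 2 ≤ net σ)
  rw [net_append] at h
  obtain ⟨u₂, u₃, rfl, h₂⟩ := exists_split_L le_rfl (by omega : 0 < net σ)
  rw [net_append, net_L] at h
  rw [← List.append_nil u₃]
  obtain ⟨D₀, w₀⟩ := exists_uTurn u₀ h₀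
  obtain ⟨D₁, w₁⟩ := exists_uTurn u₁ h₁
  obtain ⟨X₂, H₂, Y₂, hX₂, hY₂, hY₂', b₂⟩ := exists_box u₂ h₂
  obtain ⟨X₃, H₃, Y₃, hX₃, hY₃, hY₃', b₃⟩ := exists_box u₃ (by omega)
  have hD₀ := w₀.1
  have hD₁ := w₁.1
  have r := Route.stairDown m 0 0
  rw [show ((0 : ℤ) + m + 1, (0 : ℤ) - m) = ((m : ℤ) + 1, -(m : ℤ)) by ext <;> simp] at r
  have hm : ((m + 3 : ℕ) : ℤ) = m + 3 := by push_cast; rfl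
  obtain ⟨a, ha⟩ : ∃ a : ℤ, a = -(D₀ + 2 * H₃ + X₂ + 1) := ⟨_, rfl⟩
  obtain ⟨c, hc⟩ : ∃ c : ℤ, c = -(m + 3 * D₀ + 2 * H₂ + X₃ + D₁ + 2) := ⟨_, rfl⟩
  exact Route.mem_posXDistances (r.turn R
    ((Route.south (m + 1) (-m) (-(m + D₀ + 1))).turn R
    ((Route.west (m + 1) m (-(m + D₀ + 1))).append
    ((w₀.west m (-(m + D₀ + 1)) (m - 1) (-(m + 2 * D₀ + 1))).append
    ((Route.east (m - 1) (m + 2) (-(m + 2 * D₀ + 1))).turn L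
    ((Route.north (m + 2) (-(m + 2 * D₀ + 1)) 1).turn L
    ((Route.west (m + 2) a 1).append
    ((w₁.west a 1 (a - 1) c).append
    ((b₂.fromEast (x' := a - 1 + X₂) (y' := c + Y₂)).append
    ((Route.east (a - 1 + X₂) (m + 3 + Y₃) (c + Y₂)).turn L
    ((b₃.fromNorth (x' := ((m + 3 : ℕ) : ℤ)) (y' := c + Y₂ + X₃)).append
    (Route.north ((m + 3 : ℕ) : ℤ) (c + Y₂ + X₃) 0)))))))))))) (by omega)

/-- The chain goes around the endpoint from the east, descends in column 2, and makes a U-turn below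
the final staircase, which starts in column 3. -/
theorem mem_posXDistances_R_stair {u y : List Turn} (m : ℕ) (hu : net u = 3) (hy : net y = 2) :
    m + 3 ∈ posXDistances (R :: (u ++ L :: L :: (y ++ R :: stair m))) := by
  obtain ⟨u₀, u₁, rfl, h₀⟩ := exists_split_L le_rfl (by omega : 0 < net u)
  rw [net_append, net_L] at hu
  obtain ⟨X, H, Y, hX, hY, hY', b⟩ := exists_box u₀ h₀
  obtain ⟨D, w⟩ := exists_uTurn u₁ (by omega)
  obtain ⟨D', w'⟩ := exists_uTurn y hy
  have hD := w.1
  have hD' := w'.1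
  obtain ⟨g, hg⟩ : ∃ g : ℤ, g = D' + m + 2 := ⟨_, rfl⟩
  obtain ⟨A, hA⟩ : ∃ A : ℤ, A = g + 2 * D' + D := ⟨_, rfl⟩
  obtain ⟨C, hC⟩ : ∃ C : ℤ, C = m + 4 + D' + H := ⟨_, rfl⟩
  rw [List.append_assoc]
  exact Route.mem_posXDistances ((Route.east 0 1 0).turn R
    ((Route.south 1 0 (-A)).append
    ((b.fromSouth (x' := 1 + Y) (y' := -A - X)).append
    ((Route.south (1 + Y) (-A - X) (-A - X - 1)).turn L
    ((Route.east (1 + Y) C (-A - X - 1)).append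
    ((w.east C (-A - X - 1) (C + 1) 1).append
    ((Route.west (C + 1) 2 1).turn L
    ((Route.south 2 1 (-g - D')).turn L
    ((Route.east 2 (m + 3) (-g - D')).append
    ((w'.east (m + 3) (-g - D') (m + 4) (-g)).append
    ((Route.west (m + 4) 3 (-g)).turn R
    ((Route.north 3 (-g) (-m - 1)).append
    (Route.stairUp m 3 (-m - 1) ((m + 3 : ℕ) : ℤ) 0))))))))))))) (by omega)

theorem mem_posXDistances_L_L_L_stair {u : List Turn} (m : ℕ) (hu : net u = 3) :
    m + 3 ∈ posXDistances (R :: (u ++ L :: L :: L :: stair m)) := by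
  obtain ⟨u₀, u₁, rfl, h₀⟩ := exists_split_L le_rfl (by omega : 0 < net u)
  rw [net_append, net_L] at hu
  obtain ⟨X, H, Y, hX, hY, hY', b⟩ := exists_box u₀ h₀
  obtain ⟨D, w⟩ := exists_uTurn u₁ (by omega)
  have hD := w.1
  obtain ⟨A, hA⟩ : ∃ A : ℤ, A = m + 2 + D := ⟨_, rfl⟩
  obtain ⟨C, hC⟩ : ∃ C : ℤ, C = m + 4 + H := ⟨_, rfl⟩
  rw [List.append_assoc]
  exact Route.mem_posXDistances ((Route.east 0 1 0).turn R
    ((Route.south 1 0 (-A)).append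
    ((b.fromSouth (x' := 1 + Y) (y' := -A - X)).append
    ((Route.south (1 + Y) (-A - X) (-A - X - 1)).turn L
    ((Route.east (1 + Y) C (-A - X - 1)).append
    ((w.east C (-A - X - 1) (C + 1) 1).append
    ((Route.west (C + 1) 2 1).turn L
    ((Route.south 2 1 (-m - 1)).turn L
    ((Route.east 2 3 (-m - 1)).turn L
    (Route.stairUp m 3 (-m - 1) ((m + 3 : ℕ) : ℤ) 0)))))))))) (by omega)

theorem mem_posXDistances_R_L_L_stair {u : List Turn} (m : ℕ) (hu : net u = 5) :
    m + 3 ∈ posXDistances (R :: (u ++ R :: L :: L :: stair m)) := by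
  obtain ⟨u₀, u, rfl, h₀⟩ := exists_split_L le_rfl (by omega : 0 < net u)
  rw [net_append, net_L] at hu
  obtain ⟨u₁, u₂, rfl, h₁⟩ := exists_split (c := 2) (by omega) (by omega : 2 ≤ net u)
  rw [net_append] at hu
  obtain ⟨X, H, Y, hX, hY, hY', b⟩ := exists_box u₀ h₀
  obtain ⟨D₁, w₁⟩ := exists_uTurn u₁ h₁
  obtain ⟨D₂, w₂⟩ := exists_uTurn u₂ (by omega)
  have hD₁ := w₁.1
  have hD₂ := w₂.1
  obtain ⟨A, hA⟩ : ∃ A : ℤ, A = m + 2 + D₁ + D₂ := ⟨_, rfl⟩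
  obtain ⟨C, hC⟩ : ∃ C : ℤ, C = m + 4 + H := ⟨_, rfl⟩
  simp only [List.append_assoc, List.cons_append]
  exact Route.mem_posXDistances ((Route.east 0 1 0).turn R
    ((Route.south 1 0 (-A)).append
    ((b.fromSouth (x' := 1 + Y) (y' := -A - X)).append
    ((Route.south (1 + Y) (-A - X) (-A - X - 1)).turn L
    ((Route.east (1 + Y) C (-A - X - 1)).append
    ((w₁.east C (-A - X - 1) (C + 1) (D₂ + 1)).append
    ((Route.west (C + 1) 0 (D₂ + 1)).append
    ((w₂.west 0 (D₂ + 1) (-1) 1).append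
    ((Route.east (-1) 2 1).turn R
    ((Route.south 2 1 (-m - 1)).turn L
    ((Route.east 2 3 (-m - 1)).turn L
    (Route.stairUp m 3 (-m - 1) ((m + 3 : ℕ) : ℤ) 0)))))))))))) (by omega)

/-! ### Upper bounds in terms of the staircases -/

/-- Peel off leading pairs RL; positive net turning ensures that this stops at L or RR. -/
theorem exists_stair_prefix (σ : List Turn) (h : net σ = 5) : ∃ m τ,
    (σ = stair m ++ L :: τ ∧ net τ = 4) ∨ (σ = stair m ++ R :: R :: τ ∧ net τ = 7) := by
  match σ with
  | [] => simp at h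
  | [R] => simp at h
  | L :: τ => exact ⟨0, τ, Or.inl ⟨rfl, by rw [net_L] at h; omega⟩⟩
  | R :: R :: τ => exact ⟨0, τ, Or.inr ⟨rfl, by rw [net_R, net_R] at h; omega⟩⟩
  | R :: L :: σ =>
    obtain ⟨m, τ, h | h⟩ := exists_stair_prefix σ (by rw [net_R, net_L] at h; omega)
    · exact ⟨m + 1, τ, Or.inl ⟨by rw [h.1]; rfl, h.2⟩⟩
    · exact ⟨m + 1, τ, Or.inr ⟨by rw [h.1]; rfl, h.2⟩⟩

theorem exists_mem_posXDistances_le_mO {σ : List Turn} (h : net σ = 5) :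
    ∃ a ∈ posXDistances σ, a ≤ mO east south σ + 2 := by
  obtain ⟨m, τ, ⟨rfl, hτ⟩ | ⟨rfl, hτ⟩⟩ := exists_stair_prefix σ h
  · exact ⟨_, mem_posXDistances_stair_L m hτ, Nat.add_le_add_right (le_mO_stair_append _ _) _⟩
  · exact ⟨_, mem_posXDistances_stair_R_R m hτ,
      Nat.add_le_add_right (succ_le_mO_stair_append_R _ _) 2⟩

/-- Trailing pairs RL are absorbed into the staircase. What precedes it then ends in R, RLL or LLL,
one construction for each. -/
theorem exists_mem_posXDistances_append_stair {σ : List Turn} (m : ℕ) (h : net (R :: σ) = 5) :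
    ∃ ρ k, R :: σ ++ stair m = ρ ++ stair k ∧ net ρ = 5 ∧ k + 3 ∈ posXDistances (ρ ++ stair k) := by
  obtain ⟨n, hn⟩ : ∃ n, σ.length = n := ⟨_, rfl⟩
  induction n using Nat.strong_induction_on generalizing σ m with
  | _ n ih =>
    have h' := h
    rw [net_R] at h'
    rcases List.eq_nil_or_concat' σ with rfl | ⟨σ, t, rfl⟩
    · simp at h'
    rw [net_append] at h'
    cases t with
    | R =>
      simp only [net_R, net_nil] at h'
      obtain ⟨u, y, rfl, hu⟩ := exists_split_LL (c := 3) (by omega) (by omega : 3 + 2 ≤ net σ)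
      simp only [net_append, net_L] at h'
      refine ⟨_, m, rfl, h, ?_⟩
      simpa using mem_posXDistances_R_stair m hu (by omega : net y = 2)
    | L =>
      simp only [net_L, net_nil] at h'
      rcases List.eq_nil_or_concat' σ with rfl | ⟨σ, t, rfl⟩
      · simp at h'
      rw [net_append] at h'
      cases t with
      | R =>
        simp only [net_R, net_nil] at h'
        obtain ⟨ρ, k, e, hk⟩ := ih σ.length (by subst hn; simp) (m + 1)
          (by rw [net_R]; omega) rfl
        exact ⟨ρ, k, by rw [← e]; simp [stair], hk⟩
      | L =>
        simp only [net_L, net_nil] at h'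
        rcases List.eq_nil_or_concat' σ with rfl | ⟨σ, t, rfl⟩
        · simp at h'
        rw [net_append] at h'
        refine ⟨_, m, rfl, h, ?_⟩
        cases t with
        | R =>
          simp only [net_R, net_nil] at h'
          simpa using mem_posXDistances_R_L_L_stair m (by omega : net σ = 5)
        | L =>
          simp only [net_L, net_nil] at h'
          simpa using mem_posXDistances_L_L_L_stair m (by omega : net σ = 3)

theorem exists_mem_posXDistances_le_mP {σ : List Turn} (h : net σ = 5) (hσ : σ.head? = some R) :
    ∃ a ∈ posXDistances σ, a ≤ mP east north σ + 2 := by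
  match σ with
  | R :: σ =>
    obtain ⟨ρ, k, e, hρ, hk⟩ := exists_mem_posXDistances_append_stair 0 h
    rw [stair, List.append_nil] at e
    rw [e]
    exact ⟨_, hk, Nat.add_le_add_right (succ_le_mP_append_stair k (by omega)) 2⟩

/-! ### Attainment of the minimum and finiteness behind the maximum -/

theorem xPlus_le {σ : List Turn} {a : ℕ} (h : a ∈ posXDistances σ) : xPlus σ ≤ a :=
  Nat.sInf_le h

theorem ReachesPosX.exists_realizes {σ : List Turn} (h : ReachesPosX σ) :
    0 < xPlus σ ∧ ∃ v, Realizes v σ ∧ v (σ.length + 1) = ((xPlus σ : ℤ), 0) := by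
  obtain ⟨h0, v, hv, he⟩ := Nat.sInf_mem h
  exact ⟨h0, v, hv, he⟩

theorem length_eq_count_add_count (σ : List Turn) : σ.length = σ.count L + σ.count R := by
  induction σ with
  | nil => rfl
  | cons t σ ih => cases t <;> simp [ih] <;> omega

instance : Finite Turn := Finite.of_injective (fun t => decide (t = L)) (by
  intro s t h
  cases s <;> cases t <;> simp at h ⊢)

theorem ReachesPosX.xPlus_le_xPlusMax {σ : List Turn} (h : ReachesPosX σ) :
    xPlus σ ≤ xPlusMax (σ.count L) (σ.count R) := by
  refine le_csSup (Set.Finite.bddAbove ?_) ⟨σ, rfl, rfl, h, rfl⟩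
  refine ((List.finite_length_eq Turn (σ.count L + σ.count R)).image xPlus).subset ?_
  rintro _ ⟨τ, hl, hr, -, rfl⟩
  exact ⟨τ, by rw [Set.mem_ofPred_eq, length_eq_count_add_count, hl, hr], rfl⟩

end Turn

/-! ### Comparison of the lower bounds with the constructed chains -/

theorem theorem6 (l r : ℕ) (hlr : r ≤ l) (σ : List Turn)
    (hl : σ.count Turn.L = l) (hr : σ.count Turn.R = r) :
    -- lower bounds, for every `σ` with `l` left and `r` right turns that reaches the `+x`-axis
    (Turn.ReachesPosX σ →
      -- `x⁺_{l,r}` is the maximum of the `x⁺_σ`, so each bound below is one for it as well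
      Turn.xPlus σ ≤ Turn.xPlusMax l r ∧
      -- `l - r ≡ 1 (mod 4)`
      (((l : ℤ) - r) % 4 = 1 →
        (σ.head? = some Turn.R →
          min (Turn.mO Turn.east Turn.south σ : ℤ) (Turn.mP Turn.east Turn.north σ)
            + ((l : ℤ) - r + 2) / 4 + 1 ≤ Turn.xPlus σ) ∧
        (σ.head? = some Turn.L →
          |((l : ℤ) - r + 2) / 4 - 1| + 2 ≤ Turn.xPlus σ)) ∧
      -- `l - r ≡ 3 (mod 4)`
      (((l : ℤ) - r) % 4 = 3 →
        (σ.head? = some Turn.L →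
          min (Turn.mO Turn.east Turn.north σ : ℤ) (Turn.mP Turn.east Turn.south σ)
            + |((l : ℤ) - r + 2) / 4 - 2| + 1 ≤ Turn.xPlus σ) ∧
        (σ.head? = some Turn.R →
          ((l : ℤ) - r + 2) / 4 + 1 ≤ Turn.xPlus σ)) ∧
      -- `l - r ≡ 2 (mod 4)`
      (((l : ℤ) - r) % 4 = 2 →
        (σ.head? = some Turn.L →
          |((l : ℤ) - r + 2) / 4 - 2| + 2 ≤ Turn.xPlus σ) ∧
        (σ.head? = some Turn.R →
          ((l : ℤ) - r + 2) / 4 + 1 ≤ Turn.xPlus σ)) ∧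
      -- `l - r ≡ 0 (mod 4)`, `l - r ≥ 8`
      (((l : ℤ) - r) % 4 = 0 → 8 ≤ (l : ℤ) - r →
        (σ.head? = some Turn.L →
          min (min (Turn.mO Turn.east Turn.north σ : ℤ) (Turn.mP Turn.east Turn.south σ)) 2
            + ((l : ℤ) - r + 2) / 4 ≤ Turn.xPlus σ) ∧
        (σ.head? = some Turn.R →
          ((l : ℤ) - r + 2) / 4 + 2 ≤ Turn.xPlus σ)) ∧
      -- `l - r = 0`
      ((l : ℤ) - r = 0 →
        (σ.head? = some Turn.L →
          min (min (Turn.mO Turn.east Turn.north σ : ℤ) (Turn.mP Turn.east Turn.south σ)) 2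
            + 2 ≤ Turn.xPlus σ) ∧
        (σ.head? = some Turn.R →
          min (min (Turn.mO Turn.east Turn.south σ : ℤ) (Turn.mP Turn.east Turn.north σ)) 2
            + 2 ≤ Turn.xPlus σ)) ∧
      -- `l - r = 4`
      ((l : ℤ) - r = 4 → 3 ≤ Turn.xPlus σ)) ∧
    -- the lower bounds are attained for `l - r = 5`
    ((l : ℤ) - r = 5 →
      Turn.ReachesPosX σ ∧
      (σ.head? = some Turn.L →
        (Turn.xPlus σ : ℤ) = |((l : ℤ) - r + 2) / 4 - 1| + 2) ∧
      (σ.head? = some Turn.R →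
        (Turn.xPlus σ : ℤ) =
          min (Turn.mO Turn.east Turn.south σ : ℤ) (Turn.mP Turn.east Turn.north σ)
            + ((l : ℤ) - r + 2) / 4 + 1)) ∧
    -- the lower bounds are attained for `l - r ≡ 2 (mod 4)`, `l - r ≥ 6`
    (((l : ℤ) - r) % 4 = 2 → 6 ≤ (l : ℤ) - r →
      Turn.ReachesPosX σ ∧
      (σ.head? = some Turn.L →
        (Turn.xPlus σ : ℤ) = |((l : ℤ) - r + 2) / 4 - 2| + 2) ∧
      (σ.head? = some Turn.R →
        (Turn.xPlus σ : ℤ) = ((l : ℤ) - r + 2) / 4 + 1)) := by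
  subst hl hr
  have hn : Turn.net σ = (σ.count Turn.L : ℤ) - σ.count Turn.R := rfl
  rw [← hn]
  have h0 : 0 ≤ Turn.net σ := by omega
  have lower := fun h : Turn.ReachesPosX σ =>
    let ⟨_, hv, he⟩ := h.exists_realizes.2
    hv.lower_bounds (Int.natCast_pos.2 h.exists_realizes.1) he
  refine ⟨fun h => ?_, fun h5 => ?_, fun h2 h6 => ?_⟩
  · obtain ⟨l1, l3, l2, l0⟩ := lower h
    exact ⟨h.xPlus_le_xPlusMax, fun e => ⟨(l1 e).1, fun e' => (l1 e).2 e' h0⟩,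
      fun e => ⟨fun e' => (l3 e).1 e' h0, (l3 e).2⟩,
      fun e => ⟨fun e' => (l2 e).1 e' h0, (l2 e).2⟩,
      fun e e8 => ⟨(l0 e).1 e8, (l0 e).2.1 e8⟩,
      fun e => ⟨(l0 (by omega)).2.2.1 e, (l0 (by omega)).2.2.2.1 e⟩,
      fun e => by exact_mod_cast (l0 (by omega)).2.2.2.2 e⟩
  · obtain ⟨a, ha, hle⟩ := Turn.exists_mem_posXDistances_le_mO h5
    have hx : Turn.ReachesPosX σ := ⟨a, ha⟩
    have h1 := (lower hx).1 (by omega)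
    refine ⟨hx, fun hL => ?_, fun hR => ?_⟩
    · have hge := h1.2 hL h0
      -- With first turn L the initial staircase is empty, so the construction with m = 0 applies.
      have hle' : Turn.xPlus σ ≤ 2 := by
        match σ with
        | Turn.L :: τ =>
          exact Turn.xPlus_le (Turn.mem_posXDistances_stair_L 0 (by rw [Turn.net_L] at h5; omega))
      rw [h5] at hge ⊢
      norm_num at hge ⊢
      omega
    · obtain ⟨b, hb, hle'⟩ := Turn.exists_mem_posXDistances_le_mP h5 hR
      have hge := h1.1 hR
      have ha' := Turn.xPlus_le ha
      have hb' := Turn.xPlus_le hb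
      rw [h5] at hge ⊢
      omega
  · have h1 := fun h => (lower h).2.2.1 h2
    obtain ⟨k, hk⟩ : ∃ k : ℕ, Turn.net σ = 4 * k + 6 := ⟨((Turn.net σ - 6) / 4).toNat, by omega⟩
    match σ with
    | [] => simp at h6
    | Turn.L :: τ =>
      have hmem := Turn.mem_posXDistances_of_head_L hk rfl
      have hle := Turn.xPlus_le hmem
      have hge := (h1 ⟨_, hmem⟩).1 rfl h0
      refine ⟨⟨_, hmem⟩, fun _ => ?_, fun h => by simp at h⟩
      rw [hk] at hge ⊢
      rw [abs_eq_max_neg] at hge ⊢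
      omega
    | Turn.R :: τ =>
      -- With first turn R the same net turning 4k + 6 leaves one more spiral layer.
      have hmem := Turn.mem_posXDistances_of_head_R (σ := Turn.R :: τ) (k := k + 1)
        (by rw [hk]; push_cast; ring) rfl
      have hle := Turn.xPlus_le hmem
      have hge := (h1 ⟨_, hmem⟩).2 rfl
      refine ⟨⟨_, hmem⟩, fun h => by simp at h, fun _ => ?_⟩
      rw [hk] at hge ⊢
      omega
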